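/- Let $\Sigma$ be a finite alphabet. A *nondeterministic logspace machine* is a nondeterministic Turing machine with a read-only input tape, finitely many work tapes and a write-only output tape which, on every computation branch on an input of length $n$, uses $O(\log n)$ cells of the work tapes and halts after at most polynomially (in $n$) many steps. $\#\mathsf{L}$ is the class of functions $\varphi$ on strings such that $\varphi(x)$ is the number of accepting branches, on input $x$, of some nondeterministic logspace machine. For $k\ge 2$, $\mathsf{Mod}_k\mathsf{L}$ (respectively $\mathsf{coMod}_k\mathsf{L}$) is the class of languages $L$ for which there is $\varphi\in\#\mathsf{L}$ such that $x\in L$ if and only if $\varphi(x)\not\equiv 0 \pmod k$ (respectively $\varphi(x)\equiv 0\pmod k$). For a partial function $f:\Sigma^*\rightharpoonup\Sigma^*$ and a symbol $\bullet\notin\Sigma$, let $\mathrm{bits}(f)$ be the set of (encoded) triples $(x,j,b)$ with $x\in\mathrm{dom}(f)$, $j\ge 1$ (written in binary), $b\in\Sigma\cup\{\bullet\}$, such that either $j\le|f(x)|$ and $b$ is the $j$-th symbol of $f(x)$, or $j>|f(x)|$ and $b=\bullet$. Let $\mathsf{F}\cdot\mathsf{Mod}_k\mathsf{L}$ (respectively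 $\mathsf{F}\cdot\mathsf{coMod}_k\mathsf{L}$) be the class of partial functions $f$ such that $|f(x)|$ is bounded by a polynomial in $|x|$ for $x\in\mathrm{dom}(f)$ and $\mathrm{bits}(f)\in\mathsf{Mod}_k\mathsf{L}$ (respectively $\mathrm{bits}(f)\in\mathsf{coMod}_k\mathsf{L}$). Let $\mathsf{FUL}_k$ be the class of partial functions $f$ for which there is a nondeterministic logspace machine such that, on every input $x$ and for every string $y\in\Sigma^*$, the number of accepting branches with $y$ on the output tape is $\equiv 1\pmod k$ if $x\in\mathrm{dom}(f)$ and $y=f(x)$, and is $\equiv 0\pmod k$ otherwise. Then for every prime $p$ and every integer $e\ge 1$, $$\mathsf{FUL}_{p^e}=\mathsf{F}\cdot\mathsf{Mod}_p\mathsf{L}=\mathsf{F}\cdot\mathsf{coMod}_p\mathsf{L}.$$ In particular, every partial function $f$ of polynomially bounded length with $\mathrm{bits}(f)\in\mathsf{Mod}_p\mathsf{L}$ is computed by a nondeterministic logspace machine that, on each input $x\in\mathrm{dom}(f)$, outputs $f(x)$ on a number $\equiv 1\pmod{p^e}$ of accepting branches and, on each input $x$, outputs any other string (any string at all, if $x\notin\mathrm{dom}(f)$)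 on a number $\equiv 0\pmod{p^e}$ of accepting branches. -/

import Mathlib

/-- What a read-only input head can see: one of the two end markers, or a letter of the input. -/
inductive InputSymbol (α : Type) : Type where
  | leftEnd : InputSymbol α
  | rightEnd : InputSymbol α
  | letter (a : α) : InputSymbol α

/-- The content of cell `i` of the input tape holding `x`: the left end marker in cell `0`,
the letters of `x` in the cells `1, …, |x|`, the right end marker in cell `|x| + 1`. -/
def inputCell {α : Type} (x : List α) : ℕ → InputSymbol α
  | 0 => InputSymbol.leftEnd
  | i + 1 =>
    match x[i]? with
    | some a => InputSymbol.letter a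
    | none => InputSymbol.rightEnd

/-- One instruction of a Turing machine with state set `Q`, work tapes indexed by `ι`, work
alphabet `Γ` and output alphabet `β`. Head moves are `-1` (left), `0` (stay), `1` (right). -/
structure TMAction (Q ι Γ β : Type) : Type where
  /-- the new state -/
  next : Q
  /-- the move of the input head -/
  inputMove : SignType
  /-- the symbol written into the scanned cell of each work tape -/
  write : ι → Γ
  /-- the move of each work head -/
  workMove : ι → SignType
  /-- the symbol appended to the write-only output tape, if any -/
  emit : Option β

/-- A nondeterministic Turing machine with a two-way read-only input tape (alphabet `α`), finitely
many two-way infinite work tapes, and a one-way write-only output tape (alphabet `β`). -/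
structure NTM (α β : Type) : Type 1 where
  /-- the states -/
  State : Type
  /-- the index set of the work tapes -/
  WorkTape : Type
  /-- the work alphabet -/
  Work : Type
  finite_state : Finite State
  finite_workTape : Finite WorkTape
  finite_work : Finite Work
  /-- the blank symbol of the work tapes -/
  blank : Work
  /-- the initial state -/
  startState : State
  /-- the accepting states -/
  accept : Set State
  /-- the instructions that may be carried out in a given state with given scanned symbols -/
  delta : State → InputSymbol α → (WorkTape → Work) →
    Finset (TMAction State WorkTape Work β)

namespace NTM

variable {α β : Type} (M : NTM α β)

/-- The instructions of `M`. -/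
abbrev Action : Type := TMAction M.State M.WorkTape M.Work β

/-- A configuration of `M` (on an input that is kept fixed). -/
structure Config : Type where
  state : M.State
  inputHead : ℕ
  workHead : M.WorkTape → ℤ
  work : M.WorkTape → ℤ → M.Work
  output : List β

/-- The initial configuration: all work tapes blank, empty output. -/
def start : M.Config where
  state := M.startState
  inputHead := 0
  workHead := fun _ => 0
  work := fun _ _ => M.blank
  output := []

/-- The instructions applicable in the configuration `c` on input `x`. -/
def choices (x : List α) (c : M.Config) : Finset M.Action :=
  M.delta c.state (inputCell x c.inputHead) (fun i => c.work i (c.workHead i))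

/-- The configuration reached from `c` by the instruction `a`. The input head cannot move beyond
the end markers. -/
def step (x : List α) (c : M.Config) (a : M.Action) : M.Config where
  state := a.next
  inputHead := min (x.length + 1) ((c.inputHead : ℤ) + (a.inputMove : ℤ)).toNat
  workHead := fun i => c.workHead i + (a.workMove i : ℤ)
  work := fun i => Function.update (c.work i) (c.workHead i) (a.write i)
  output := c.output ++ a.emit.toList

/-- `M.Legal x c w`: the sequence `w` of instructions can be carried out from `c` on input `x`. -/
def Legal (x : List α) : M.Config → List M.Action → Prop
  | _, [] => True
  | c, a :: w => a ∈ M.choices x c ∧ Legal x (M.step x c a) w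

/-- `w` is a (partial) computation of `M` on input `x`, given by its sequence of instructions. -/
def IsComputation (x : List α) (w : List M.Action) : Prop :=
  M.Legal x M.start w

/-- The configuration at the end of the computation `w` on input `x`. -/
def final (x : List α) (w : List M.Action) : M.Config :=
  w.foldl (M.step x) M.start

/-- The accepting branches of `M` on input `x`: the computations that cannot be continued and end
in an accepting state. -/
def acceptingBranches (x : List α) : Set (List M.Action) :=
  {w | M.IsComputation x w ∧ M.choices x (M.final x w) = ∅ ∧ (M.final x w).state ∈ M.accept}

/-- The number of accepting branches of `M` on input `x`. -/
noncomputable def numAccept (x : List α) : ℕ :=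
  (M.acceptingBranches x).ncard

/-- The number of accepting branches of `M` on input `x` with `y` on the output tape. -/
noncomputable def numAcceptWith (x : List α) (y : List β) : ℕ :=
  {w ∈ M.acceptingBranches x | (M.final x w).output = y}.ncard

/-- `M` is a logspace machine: on inputs of length `n`, every computation (whatever the choices)
visits only `O(log n)` cells of the work tapes and stops within a polynomial number of steps, so
that branches can be counted. The input and the output tape do not count as space. -/
def IsLogspace : Prop :=
  (∃ c : ℕ, ∀ (x : List α) (w : List M.Action), M.IsComputation x w →
    ∀ i, |(M.final x w).workHead i| ≤ ((c * (Nat.log 2 x.length + 1) : ℕ) : ℤ)) ∧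
  (∃ q : Polynomial ℕ, ∀ (x : List α) (w : List M.Action), M.IsComputation x w →
    w.length ≤ q.eval x.length)

end NTM

/-- The class `#L` of counting functions over the alphabet `α`: numbers of accepting branches of
nondeterministic logspace machines (without output). -/
def NumL (α : Type) : Set (List α → ℕ) :=
  {φ | ∃ M : NTM α Empty, M.IsLogspace ∧ ∀ x, φ x = M.numAccept x}

/-- The class `Mod_k L` of languages over the alphabet `α`. -/
def ModL (α : Type) (k : ℕ) : Set (Language α) :=
  {L | ∃ φ ∈ NumL α, ∀ x, x ∈ L ↔ ¬ φ x ≡ 0 [MOD k]}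

/-- The class `coMod_k L` of languages over the alphabet `α`. -/
def CoModL (α : Type) (k : ℕ) : Set (Language α) :=
  {L | ∃ φ ∈ NumL α, ∀ x, x ∈ L ↔ φ x ≡ 0 [MOD k]}

/-- The alphabet in which triples `(x, j, b)` are written: letters of `x`, binary digits of `j`,
and the symbol `b`, which is a letter or the extra symbol `•` (that is, `none`). -/
abbrev TripleAlphabet (α : Type) : Type := α ⊕ (Bool ⊕ Option α)

/-- The triple `(x, j, b)` as a string: `x`, then `j` in binary (least significant digit first),
then `b`. No separators are needed since the three parts use disjoint sets of symbols. -/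
def encodeTriple {α : Type} (x : List α) (j : ℕ) (b : Option α) : List (TripleAlphabet α) :=
  x.map Sum.inl ++ (Nat.bits j).map (fun d => Sum.inr (Sum.inl d)) ++ [Sum.inr (Sum.inr b)]

/-- The decision problem `bits[f]` of a partial function `f`: the triples `(x, j, b)` with
`x ∈ dom f` and `j ≥ 1` such that either `j ≤ |f x|` and `b` is the `j`-th symbol of `f x`, or
`j > |f x|` and `b = •`. -/
def bitsLanguage {α : Type} (f : List α →. List α) : Language (TripleAlphabet α) :=
  {z | ∃ (x : List α) (j : ℕ) (b : Option α), z = encodeTriple x j b ∧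
    1 ≤ j ∧ ∃ y ∈ f x, y[j - 1]? = b}

/-- The length of `f x` is bounded by a polynomial in the length of `x`, for `x ∈ dom f`. -/
def PolyLength {α : Type} (f : List α →. List α) : Prop :=
  ∃ q : Polynomial ℕ, ∀ x, ∀ y ∈ f x, y.length ≤ q.eval x.length

/-- The class `F·Mod_k L` of partial functions over the alphabet `α`. -/
def FModL (α : Type) (k : ℕ) : Set (List α →. List α) :=
  {f | PolyLength f ∧ bitsLanguage f ∈ ModL (TripleAlphabet α) k}

/-- The class `F·coMod_k L` of partial functions over the alphabet `α`. -/
def FCoModL (α : Type) (k : ℕ) : Set (List α →. List α) :=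
  {f | PolyLength f ∧ bitsLanguage f ∈ CoModL (TripleAlphabet α) k}

/-- `M` is an `FUL[k]` machine computing the partial function `f`. Here `y ∈ f x` says that
`x ∈ dom f` and `y = f x`. -/
def IsFULMachine {α : Type} (k : ℕ) (M : NTM α α) (f : List α →. List α) : Prop :=
  M.IsLogspace ∧ ∀ x y,
    (y ∈ f x → M.numAcceptWith x y ≡ 1 [MOD k]) ∧ (y ∉ f x → M.numAcceptWith x y ≡ 0 [MOD k])

/-- The class `FUL[k]` of partial functions over the alphabet `α`. -/
def FUL (α : Type) (k : ℕ) : Set (List α →. List α) :=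
  {f | ∃ M : NTM α α, IsFULMachine k M f}

/-! Both inclusions compare multiplicities of branches modulo `p ^ e`.

From bits to functions, let `φ` decide the bits modulo `p`. With `t` the totient of `p ^ e`, the
power `φ ^ t` is congruent modulo `p ^ e` to 0 or 1 according to whether `p` divides `φ`
(`pow_totient_modEq`): Euler's theorem covers the coprime case, and `e ≤ t` the other one. Thus `φ ^
t`, or `1 + (p ^ e - 1) * φ ^ t` for the complementary class, is an indicator modulo `p ^ e`. A
machine guesses an output word symbol by symbol, ending with `•`, and after each guess runs the
machine of `φ` `t` times on the corresponding triple. Consecutive runs multiply numbers of branches,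
so a word is output with the product of the indicators of its symbols and of its end. This product
is 1 exactly for `f x` and 0 for every other word (`wordVal_modEq`, `Symbolwise.mem_FUL`).

From functions to bits, a machine simulates an `FUL` machine on `x`, guesses when the requested
symbol is written, and compares its position with `j`. Each accepting branch of the simulated
machine whose output agrees with the triple is counted once. Modulo `p ^ e` only the output `f x`
matters, so the total is the indicator of the triple (`sum_agree_modEq`). Reduced modulo `p` it
decides the bits; `1 + (p - 1) * n` in place of `n` gives the complementary class.

The rest is the construction of the machines. `Eval` records termination, an invariant of the
reachable configurations and the multiset of outputs in one inductive predicate, so branch counts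
are computed along the program. Only space has to be bounded: a machine that always halts never
repeats a configuration up to output, and in logarithmic space there are polynomially many of these
(`isLogspace_of_eval`). `Core` adds subroutines on single tapes and marks of the origins.

Three devices keep the first machine in logarithmic space. The triple is never written down: its
parts lie on the input tape, on a work tape and in the state. Every cell visited by a simulated run
becomes nonblank, so the tapes can be cleared between runs. The number of guessed symbols is limited
by a clock of logarithmic length, the binary digits of `|x| + 2` read in a large base; its value
exceeds the given polynomial bound (`pow_log_le_digitsVal`). -/

namespace NTM

/-! ### Computation trees and branch counts -/

variable {α β : Type} (M : NTM α β) (x : List α)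

open Classical in
/-- `M.Eval x P c m`: from the configuration `c` on input `x` every computation is finite, all
configurations that are reached satisfy `P`, and `m` is the multiset of the outputs of the
accepting branches. -/
inductive Eval (P : M.Config → Prop) : M.Config → Multiset (List β) → Prop
  | halt {c m} : P c → M.choices x c = ∅ →
      m = (if c.state ∈ M.accept then {c.output} else 0) → Eval P c m
  | step {c m} (u : M.Action → Multiset (List β)) : P c → (M.choices x c).Nonempty →
      (∀ a ∈ M.choices x c, Eval P (M.step x c a) (u a)) →
      m = ∑ a ∈ M.choices x c, u a → Eval P c m

/-- The accepting branches that start in the configuration `c`. -/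
def branchesFrom (c : M.Config) : Set (List M.Action) :=
  {w | M.Legal x c w ∧ M.choices x (w.foldl (M.step x) c) = ∅ ∧
    (w.foldl (M.step x) c).state ∈ M.accept}

variable {M x}

/-- A branch from a configuration is a first instruction followed by a branch from its successor, so
the branches form a finite sigma type by induction. Finiteness is what makes the `ncard` in the
definitions an honest count. -/
theorem Eval.exists_finset {P : M.Config → Prop} {c : M.Config} {m : Multiset (List β)}
    (h : M.Eval x P c m) :
    ∃ s : Finset (List M.Action), (∀ w, w ∈ s ↔ w ∈ M.branchesFrom x c) ∧
      m = ∑ w ∈ s, {(w.foldl (M.step x) c).output} := by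
  classical
  induction h with
  | @halt c m hP hc hm =>
    by_cases hs : c.state ∈ M.accept
    · refine ⟨{[]}, fun w => ?_, by simp [hm, hs]⟩
      cases w with
      | nil => simp [branchesFrom, Legal, hc, hs]
      | cons a w => simp [branchesFrom, Legal, hc]
    · refine ⟨∅, fun w => ?_, by simp [hm, hs]⟩
      cases w with
      | nil => simp [branchesFrom, hs]
      | cons a w => simp [branchesFrom, Legal, hc]
  | @step c m u hP hne _ hm ih =>
    choose! s hs hu using ih
    refine ⟨((M.choices x c).sigma s).map ⟨fun p => p.1 :: p.2, ?_⟩, fun w => ?_, ?_⟩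
    · rintro ⟨a, w⟩ ⟨a', w'⟩ h
      simp only [List.cons.injEq] at h
      obtain ⟨rfl, rfl⟩ := h
      rfl
    · cases w with
      | nil =>
        simp [branchesFrom, hne.ne_empty]
      | cons a w =>
        simp only [Finset.mem_map, Finset.mem_sigma]
        constructor
        · rintro ⟨⟨a', w'⟩, ⟨h1, h2⟩, e⟩
          change a' :: w' = a :: w at e
          obtain ⟨rfl, rfl⟩ := List.cons.inj e
          have := (hs _ h1 w').1 h2
          exact ⟨⟨h1, this.1⟩, this.2⟩
        · rintro ⟨⟨h1, h2⟩, h3⟩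
          exact ⟨⟨a, w⟩, ⟨h1, (hs a h1 w).2 ⟨h2, h3⟩⟩, rfl⟩
    · rw [Finset.sum_map, Finset.sum_sigma, hm]
      exact Finset.sum_congr rfl fun a ha => hu a ha

theorem Eval.prop {P : M.Config → Prop} {c : M.Config} {m : Multiset (List β)}
    (h : M.Eval x P c m) : P c := by
  cases h <;> assumption

theorem Eval.mono {P P' : M.Config → Prop} (hP : ∀ c, P c → P' c) {c : M.Config}
    {m : Multiset (List β)} (h : M.Eval x P c m) : M.Eval x P' c m := by
  induction h with
  | halt h1 h2 h3 => exact .halt (hP _ h1) h2 h3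
  | step u h1 h2 _ h4 ih => exact .step u (hP _ h1) h2 ih h4

theorem Eval.forward {P : M.Config → Prop} {w : List M.Action} :
    ∀ {c : M.Config} {m : Multiset (List β)}, M.Eval x P c m → M.Legal x c w →
      ∃ m', M.Eval x P (w.foldl (M.step x) c) m' := by
  induction w with
  | nil => intro c m h _; exact ⟨m, h⟩
  | cons a w ih =>
    rintro c m h ⟨ha, hw⟩
    cases h with
    | halt _ hc _ => simp [hc] at ha
    | step u _ _ hu _ => exact ih (hu a ha) hw

theorem Eval.numAcceptWith_eq [DecidableEq β] {P : M.Config → Prop} {m : Multiset (List β)}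
    (h : M.Eval x P M.start m) (y : List β) : M.numAcceptWith x y = m.count y := by
  classical
  obtain ⟨s, hs, rfl⟩ := h.exists_finset
  have : {w ∈ M.acceptingBranches x | (M.final x w).output = y} =
      ((s.filter fun w => (M.final x w).output = y : Finset _) : Set (List M.Action)) := by
    ext w
    simp only [Finset.coe_filter, hs]
    rfl
  rw [numAcceptWith, this, Set.ncard_coe_finset, Multiset.count_sum', Finset.card_filter]
  refine Finset.sum_congr rfl fun w _ => ?_
  rw [Multiset.count_singleton]
  simp only [final, eq_comm]

theorem Eval.numAccept_eq {P : M.Config → Prop} {m : Multiset (List β)}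
    (h : M.Eval x P M.start m) : M.numAccept x = Multiset.card m := by
  obtain ⟨s, hs, rfl⟩ := h.exists_finset
  have : M.acceptingBranches x = (s : Set (List M.Action)) := by
    ext w
    simp only [Finset.mem_coe, hs]
    rfl
  rw [numAccept, this, Set.ncard_coe_finset]
  simp

theorem legal_append {c : M.Config} {w w' : List M.Action} :
    M.Legal x c (w ++ w') ↔ M.Legal x c w ∧ M.Legal x (w.foldl (M.step x) c) w' := by
  induction w generalizing c with
  | nil => simp [Legal]
  | cons a w ih => simp [Legal, ih, and_assoc]

theorem isComputation_concat {w : List M.Action} {a : M.Action} :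
    M.IsComputation x (w ++ [a]) ↔ M.IsComputation x w ∧ a ∈ M.choices x (M.final x w) := by
  simp [IsComputation, legal_append, Legal, final]

theorem final_concat (w : List M.Action) (a : M.Action) :
    M.final x (w ++ [a]) = M.step x (M.final x w) a := by
  simp [final]

theorem output_length_le (w : List M.Action) : (M.final x w).output.length ≤ w.length := by
  induction w using List.reverseRecOn with
  | nil => simp [final, start]
  | append_singleton w a ih =>
    rw [final_concat]
    simp only [step, List.length_append, List.length_singleton]
    have : a.emit.toList.length ≤ 1 := by cases a.emit <;> simp
    omega

/-- A logspace machine evaluates on every input. -/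
theorem IsLogspace.exists_eval (hM : M.IsLogspace) (x : List α) :
    ∃ m, M.Eval x (fun c => ∃ w, M.IsComputation x w ∧ c = M.final x w) M.start m := by
  classical
  obtain ⟨-, q, hq⟩ := hM
  -- The induction is on the steps `d` that may still follow; at `d = 0` the computation would
  -- already exceed the time bound.
  suffices H : ∀ (d : ℕ) (w : List M.Action), M.IsComputation x w →
      q.eval x.length + 1 ≤ w.length + d →
      ∃ m, M.Eval x (fun c => ∃ w, M.IsComputation x w ∧ c = M.final x w) (M.final x w) m from
    H (q.eval x.length + 1) [] trivial (by simp)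
  intro d
  induction d with
  | zero =>
    intro w hw hd
    have := hq x w hw
    omega
  | succ d ih =>
    intro w hw hd
    rcases (M.choices x (M.final x w)).eq_empty_or_nonempty with hc | hc
    · exact ⟨_, .halt ⟨w, hw, rfl⟩ hc rfl⟩
    · have key : ∀ a ∈ M.choices x (M.final x w), ∃ m,
          M.Eval x (fun c => ∃ w, M.IsComputation x w ∧ c = M.final x w)
            (M.step x (M.final x w) a) m := by
        intro a ha
        obtain ⟨m, hm⟩ := ih (w ++ [a]) (isComputation_concat.2 ⟨hw, ha⟩) (by simp; omega)
        exact ⟨m, by rwa [final_concat] at hm⟩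
      choose! u hu using key
      exact ⟨_, .step u ⟨w, hw, rfl⟩ hc hu rfl⟩

theorem Eval.output_prefix {P : M.Config → Prop} {c : M.Config} {m : Multiset (List β)}
    (h : M.Eval x P c m) : ∀ y ∈ m, c.output <+: y := by
  classical
  induction h with
  | halt _ _ hm =>
    intro y hy
    rw [hm] at hy
    split_ifs at hy with h
    · rw [Multiset.mem_singleton.1 hy]
    · simp at hy
  | step u _ _ _ hm ih =>
    intro y hy
    rw [hm, Multiset.mem_sum] at hy
    obtain ⟨a, ha, hy⟩ := hy
    exact (List.prefix_append _ _).trans (ih a ha y hy)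

/-! ### Halting in logarithmic space implies polynomial time -/

/-- The configuration without its output. -/
def strip (c : M.Config) : M.Config := { c with output := [] }

theorem choices_strip (c : M.Config) : M.choices x (strip c) = M.choices x c := rfl

theorem strip_step_strip (c : M.Config) (a : M.Action) :
    strip (M.step x (strip c) a) = strip (M.step x c a) := rfl

/-- The step relation, up to output. -/
def StripStep (x : List α) (d c : M.Config) : Prop :=
  ∃ a ∈ M.choices x c, d = strip (M.step x c a)

/-- The output is never read, so dropping it does not change the tree of choices, and the finiteness
of the tree becomes accessibility. This excludes cycles up to output. -/
theorem Eval.acc {P : M.Config → Prop} {c : M.Config} {m : Multiset (List β)}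
    (h : M.Eval x P c m) : Acc (StripStep x) (strip c) := by
  induction h with
  | halt _ hc _ =>
    refine ⟨_, ?_⟩
    rintro d ⟨a, ha, -⟩
    simp [choices_strip, hc] at ha
  | step u _ _ _ _ ih =>
    refine ⟨_, ?_⟩
    rintro d ⟨a, ha, rfl⟩
    rw [strip_step_strip]
    exact ih a ha

theorem not_transGen_of_acc {C : Type*} {r : C → C → Prop} {a : C} (h : Acc r a) :
    ¬ Relation.TransGen r a a := by
  have := h.transGen
  induction this with
  | intro a _ ih => exact fun h' => ih a h' h h'

theorem transGen_stripStep {c : M.Config} {w : List M.Action} (hw : M.Legal x c w)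
    (hne : w ≠ []) :
    Relation.TransGen (StripStep x) (strip (w.foldl (M.step x) c)) (strip c) := by
  induction w generalizing c with
  | nil => exact absurd rfl hne
  | cons a w ih =>
    have h1 : StripStep x (strip (M.step x c a)) (strip c) := ⟨a, hw.1, rfl⟩
    rcases eq_or_ne w [] with rfl | hw'
    · exact .single h1
    · exact (ih hw.2 hw').tail h1

/-- A cell changes only while it is scanned, and every scanned position lies in the window. Finitely
many cells therefore describe a configuration. -/
theorem work_eq_blank {S : ℕ}
    (hS : ∀ w, M.IsComputation x w → ∀ i, |(M.final x w).workHead i| ≤ (S : ℤ))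
    {w : List M.Action} (hw : M.IsComputation x w) (τ : M.WorkTape) (i : ℤ) (hi : (S : ℤ) < |i|) :
    (M.final x w).work τ i = M.blank := by
  induction w using List.reverseRecOn with
  | nil => rfl
  | append_singleton w a ih =>
    rw [final_concat]
    have hw' := (isComputation_concat.1 hw).1
    have := hS w hw' τ
    simp only [step]
    rw [Function.update_of_ne (by rintro rfl; omega)]
    exact ih hw'

theorem inputHead_le (w : List M.Action) : (M.final x w).inputHead ≤ x.length + 1 := by
  induction w using List.reverseRecOn with
  | nil => simp [final, start]
  | append_singleton w a ih =>
    rw [final_concat]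
    simp [step]

/-- The left side counts states, input positions, work head positions and window contents. The
contents are polynomially many because `g ≤ 2 ^ g` and `2 ^ Nat.log 2 n ≤ n + 1`. -/
theorem exists_poly_config_bound (Q k g c : ℕ) : ∃ q : Polynomial ℕ, ∀ n : ℕ,
    Q * ((n + 2) * ((2 * (c * (Nat.log 2 n + 1)) + 1) ^ k *
      (g ^ (2 * (c * (Nat.log 2 n + 1)) + 1)) ^ k)) ≤ q.eval n := by
  open Polynomial in
  refine ⟨C Q * ((X + 2) * ((C (2 * c + 1) * (X + 1)) ^ k *
    (C (2 ^ (g * (2 * c + 1))) * (X + 1) ^ (2 * c * g)) ^ k)), fun n => ?_⟩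
  have hl : Nat.log 2 n ≤ n := Nat.log_le_self 2 n
  have h1 : 2 * (c * (Nat.log 2 n + 1)) + 1 ≤ (2 * c + 1) * (n + 1) := by nlinarith
  have h2 : 2 ^ Nat.log 2 n ≤ n + 1 := by
    rcases Nat.eq_zero_or_pos n with rfl | hn
    · simp
    · exact (Nat.pow_log_le_self 2 hn.ne').trans (Nat.le_succ n)
  have h3 : g ^ (2 * (c * (Nat.log 2 n + 1)) + 1) ≤
      2 ^ (g * (2 * c + 1)) * (n + 1) ^ (2 * c * g) := by
    calc g ^ (2 * (c * (Nat.log 2 n + 1)) + 1)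
        ≤ (2 ^ g) ^ (2 * (c * (Nat.log 2 n + 1)) + 1) :=
          Nat.pow_le_pow_left (Nat.lt_two_pow_self).le _
      _ = 2 ^ (g * (2 * c + 1)) * (2 ^ Nat.log 2 n) ^ (2 * c * g) := by
          rw [← pow_mul, ← pow_mul, ← pow_add]
          congr 1
          ring
      _ ≤ _ := by gcongr
  simp only [Polynomial.eval_mul, Polynomial.eval_C, Polynomial.eval_pow, Polynomial.eval_add,
    Polynomial.eval_X, Polynomial.eval_one, Polynomial.eval_ofNat]
  gcongr

/-- A machine that halts on all branches and uses logarithmic space is a logspace machine: the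
time bound is automatic, as no configuration occurs twice up to output. -/
theorem isLogspace_of_eval {M : NTM α β} (c : ℕ)
    (h : ∀ x, ∃ m, M.Eval x
      (fun d => ∀ i, |d.workHead i| ≤ ((c * (Nat.log 2 x.length + 1) : ℕ) : ℤ)) M.start m) :
    M.IsLogspace := by
  have hsp : ∀ (x : List α) (w : List M.Action), M.IsComputation x w →
      ∀ i, |(M.final x w).workHead i| ≤ ((c * (Nat.log 2 x.length + 1) : ℕ) : ℤ) := by
    intro x w hw
    obtain ⟨m, hm⟩ := h x
    obtain ⟨m', hm'⟩ := hm.forward hw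
    exact hm'.prop
  refine ⟨⟨c, hsp⟩, ?_⟩
  have := M.finite_state
  have := M.finite_workTape
  have := M.finite_work
  obtain ⟨q, hq⟩ := exists_poly_config_bound (Nat.card M.State) (Nat.card M.WorkTape)
    (Nat.card M.Work) c
  refine ⟨q, fun x w hw => le_trans ?_ (hq x.length)⟩
  set S := c * (Nat.log 2 x.length + 1) with hS
  let F : Fin (w.length + 1) → M.Config := fun i => M.final x (w.take i)
  have hF : ∀ i, M.IsComputation x (w.take i) := fun i => by
    have := hw
    rw [← List.take_append_drop i w] at this
    exact (legal_append.1 this).1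
  -- A repetition up to output would be a cycle of `StripStep` through an accessible point.
  have hlt : ∀ i j : Fin (w.length + 1), i < j → strip (F i) ≠ strip (F j) := by
    intro i j hij he
    have h1 : M.Legal x (F i) ((w.take j).drop i) := by
      have := hF j
      rw [← List.take_append_drop i (w.take j)] at this
      have := (legal_append.1 this).2
      rwa [List.take_take, min_eq_left (by exact hij.le)] at this
    have h2 : ((w.take j).drop i).foldl (M.step x) (F i) = F j := by
      simp only [F, final]
      rw [← List.foldl_append]
      congr 1
      conv_rhs => rw [← List.take_append_drop i (w.take j)]
      rw [List.take_take, min_eq_left (by exact hij.le)]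
    have h3 : (w.take j).drop i ≠ [] := by
      intro h0
      have := congrArg List.length h0
      simp only [List.length_drop, List.length_take, List.length_nil] at this
      have h4 : (i : ℕ) < j := hij
      have h5 := j.2
      omega
    have h4 := transGen_stripStep h1 h3
    rw [h2, ← he] at h4
    obtain ⟨m, hm⟩ := h x
    obtain ⟨m', hm'⟩ := hm.forward (hF i)
    exact not_transGen_of_acc hm'.acc h4
  -- The contents of the cells `-S, …, S` suffice, all others being blank.
  let code : Fin (w.length + 1) → M.State × (Fin (x.length + 2) ×
      ((M.WorkTape → Fin (2 * S + 1)) × (M.WorkTape → Fin (2 * S + 1) → M.Work))) := fun i =>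
    ((F i).state, ⟨(F i).inputHead, Nat.lt_succ_of_le (inputHead_le _)⟩,
      fun τ => ⟨((F i).workHead τ + S).toNat, by
        have := hsp x _ (hF i) τ
        simp only [F]
        rw [abs_le] at this
        omega⟩,
      fun τ k => (F i).work τ ((k : ℤ) - S))
  have hinj : Function.Injective code := by
    intro i j hij
    simp only [code, Prod.mk.injEq, Fin.mk.injEq] at hij
    obtain ⟨e1, e2, e3, e4⟩ := hij
    have : strip (F i) = strip (F j) := by
      have e5 : (F i).workHead = (F j).workHead := by
        funext τ
        have := congrFun e3 τ
        simp only [Fin.mk.injEq] at this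
        have a1 := hsp x _ (hF i) τ
        have a2 := hsp x _ (hF j) τ
        rw [abs_le] at a1 a2
        simp only [F] at this ⊢
        omega
      have e6 : (F i).work = (F j).work := by
        funext τ k
        by_cases hk : |k| ≤ (S : ℤ)
        · have := congrFun (congrFun e4 τ) ⟨(k + S).toNat, by rw [abs_le] at hk; omega⟩
          simp only at this
          rw [abs_le] at hk
          rwa [show (((k + S).toNat : ℕ) : ℤ) - S = k by omega] at this
        · rw [not_le] at hk
          simp only [F]
          rw [work_eq_blank (hsp x) (hF i) τ k hk, work_eq_blank (hsp x) (hF j) τ k hk]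
      unfold strip
      rw [e1, e2, e5, e6]
    by_contra hne
    rcases lt_or_gt_of_ne hne with h' | h'
    · exact hlt i j h' this
    · exact hlt j i h' this.symm
  have := Nat.card_le_card_of_injective code hinj
  rw [Nat.card_prod, Nat.card_prod, Nat.card_prod, Nat.card_fun, Nat.card_fun, Nat.card_fun] at this
  simp only [Nat.card_eq_fintype_card (α := Fin _), Fintype.card_fin] at this
  exact (Nat.le_succ _).trans this

end NTM


/-! ### Subroutines on a single tape: counters and clearing -/

theorem TMAction.finite {Q ι Γ β : Type} [Finite Q] [Finite ι] [Finite Γ] [Finite β] :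
    Finite (TMAction Q ι Γ β) :=
  Finite.of_injective
    (fun a : TMAction Q ι Γ β => (a.next, a.inputMove, a.write, a.workMove, a.emit)) (by
      rintro ⟨⟩ ⟨⟩ h
      simp only [Prod.mk.injEq] at h
      obtain ⟨rfl, rfl, rfl, rfl, rfl⟩ := h
      rfl)

/-- The content of a work cell, apart from the mark of the origin: blank, a letter of `G`, or a
digit in base `b + 2`. -/
abbrev Cell (G : Type) (b : ℕ) : Type := Option (G ⊕ Fin (b + 2))

/-- The states of the subroutines that work on a single tape: binary increment, decrement in base
`b + 2`, the return to the origin, and the three phases of clearing a tape. -/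
inductive Routine : Type where
  | inc | dec | home | toRight | erase | toMark

instance : Finite Routine :=
  Finite.of_injective (fun r : Routine => (match r with
    | .inc => 0 | .dec => 1 | .home => 2 | .toRight => 3 | .erase => 4 | .toMark => 5 : Fin 6))
    (by rintro ⟨⟩ ⟨⟩ h <;> first | rfl | simp at h)

namespace Routine

variable {G : Type} {b : ℕ}

/-- One step of a subroutine: from the mark and the content of the scanned cell, the new content,
the move and the next state (`none` when the subroutine is finished). -/
def step : Routine → Bool → Cell G b → Option (Cell G b × SignType × Option Routine)
  | inc, _, none => some (some (.inr 1), 0, some home)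
  | inc, _, some (.inr d) =>
    if d = 0 then some (some (.inr 1), 0, some home) else some (some (.inr 0), 1, some inc)
  | inc, _, some (.inl _) => none
  | dec, _, none => none
  | dec, _, some (.inr d) =>
    if d = 0 then some (some (.inr (Fin.last _)), 1, some dec)
    else some (some (.inr (d - 1)), 0, some home)
  | dec, _, some (.inl _) => none
  | home, m, u => if m then some (u, 0, none) else some (u, -1, some home)
  | toRight, _, none => some (none, -1, some erase)
  | toRight, _, some u => some (some u, 1, some toRight)
  | erase, _, none => some (none, 1, some toMark)
  | erase, _, some _ => some (none, -1, some erase)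
  | toMark, m, u => if m then some (u, 0, none) else some (u, 1, some toMark)

/-- `Run S r T h o`: started on the tape `T` with head position `h`, the subroutine stays within
the cells `-S, …, S` and either gets stuck (`o = none`) or ends with the tape and the head
position in `o`. -/
inductive Run (S : ℕ) : Option Routine → (ℤ → Cell G b) → ℤ → Option ((ℤ → Cell G b) × ℤ) → Prop
  | done {T h} : Run S none T h (some (T, h))
  | stuck {r T h} : |h| ≤ (S : ℤ) → r.step (decide (h = 0)) (T h) = none → Run S (some r) T h none
  | step {r T h u r' o} {d : SignType} : |h| ≤ (S : ℤ) →
      r.step (decide (h = 0)) (T h) = some (u, d, r') →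
      Run S r' (Function.update T h u) (h + (d : ℤ)) o → Run S (some r) T h o

theorem Run.step' {S : ℕ} {r : Routine} {T T' : ℤ → Cell G b} {h h' : ℤ} {u : Cell G b}
    {d : SignType} {r' : Option Routine} {o} (hS : |h| ≤ (S : ℤ))
    (hs : r.step (decide (h = 0)) (T h) = some (u, d, r'))
    (hT : Function.update T h u = T') (hh : h + (d : ℤ) = h') (H : Run S r' T' h' o) :
    Run S (some r) T h o := by
  subst hT hh
  exact .step hS hs H

theorem run_home {S : ℕ} {T : ℤ → Cell G b} (n : ℕ) (hn : n ≤ S) :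
    Run S (some home) T n (some (T, 0)) := by
  induction n with
  | zero =>
    refine .step' (by simp) (u := T 0) (d := 0) (r' := none) ?_ (by simp) (by simp) .done
    simp [Routine.step]
  | succ n ih =>
    refine .step' (by rw [abs_le]; omega) (u := T ((n : ℤ) + 1)) (d := -1) (r' := some home)
      ?_ (by simp) (h' := n) (by simp) (ih (by omega))
    have : (n : ℤ) + 1 ≠ 0 := by omega
    simp [Routine.step, this]

/-- The tape that holds the digits `l` in the cells `0, 1, …`. -/
def tapeOf (G : Type) {b : ℕ} (l : List (Fin (b + 2))) : ℤ → Cell G b :=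
  fun i => if 0 ≤ i then l[i.toNat]?.map Sum.inr else none

theorem tapeOf_natCast (l : List (Fin (b + 2))) (n : ℕ) :
    tapeOf G l n = l[n]?.map Sum.inr := by
  simp [tapeOf]

theorem tapeOf_length (pre : List (Fin (b + 2))) : tapeOf G pre pre.length = none := by
  simp [tapeOf_natCast]

theorem tapeOf_append_cons (pre l : List (Fin (b + 2))) (d : Fin (b + 2)) :
    tapeOf G (pre ++ d :: l) pre.length = some (.inr d) := by
  simp [tapeOf_natCast]

theorem update_tapeOf (pre l : List (Fin (b + 2))) (d d' : Fin (b + 2)) :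
    Function.update (tapeOf G (pre ++ d :: l)) pre.length (some (.inr d')) =
      tapeOf G (pre ++ d' :: l) := by
  funext i
  by_cases hi : i = pre.length
  · subst hi
    simp [tapeOf_append_cons]
  · rw [Function.update_of_ne hi]
    unfold tapeOf
    split_ifs with h0
    · congr 1
      rw [List.getElem?_append, List.getElem?_append]
      split_ifs with h1
      · rfl
      · obtain ⟨k, hk⟩ : ∃ k, i.toNat - pre.length = k + 1 :=
          ⟨i.toNat - pre.length - 1, by omega⟩
        simp [hk]
    · rfl

theorem update_tapeOf_length (pre : List (Fin (b + 2))) (d : Fin (b + 2)) :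
    Function.update (tapeOf G pre) pre.length (some (.inr d)) = tapeOf G (pre ++ [d]) := by
  funext i
  by_cases hi : i = pre.length
  · subst hi
    simp [tapeOf_append_cons]
  · rw [Function.update_of_ne hi]
    unfold tapeOf
    split_ifs with h0
    · congr 1
      rw [List.getElem?_append]
      split_ifs with h1
      · rfl
      · rw [List.getElem?_eq_none (by omega), List.getElem?_eq_none (by simp; omega)]
    · rfl

/-- Binary increment of a list of digits, the least significant digit first. -/
def incList : List (Fin (b + 2)) → List (Fin (b + 2))
  | [] => [1]
  | d :: l => if d = 0 then 1 :: l else 0 :: incList l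

/-- Decrement of a list of digits in base `b + 2`, of fixed length. -/
def decList : List (Fin (b + 2)) → Option (List (Fin (b + 2)))
  | [] => none
  | d :: l => if d = 0 then (decList l).map (Fin.last _ :: ·) else some ((d - 1) :: l)

/-- The list `pre` holds the digits over which the carry has already moved; passing one more digit
from `l` to `pre` drives the induction. -/
theorem run_inc {S : ℕ} (l pre : List (Fin (b + 2))) (hS : pre.length + l.length ≤ S) :
    Run S (some inc) (tapeOf G (pre ++ l)) pre.length (some (tapeOf G (pre ++ incList l), 0)) := by
  induction l generalizing pre with
  | nil =>
    refine .step' (by rw [abs_le]; simp at hS; omega) (u := some (.inr 1)) (d := 0)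
      (r' := some home) ?_ rfl (h' := pre.length) (by simp) ?_
    · rw [List.append_nil, tapeOf_length]
      rfl
    · rw [List.append_nil, update_tapeOf_length]
      exact run_home _ (by simp at hS; omega)
  | cons d l ih =>
    simp only [List.length_cons] at hS
    by_cases hd : d = 0
    · refine .step' (by rw [abs_le]; omega) (u := some (.inr 1)) (d := 0)
        (r' := some home) ?_ rfl (h' := pre.length) (by simp) ?_
      · rw [tapeOf_append_cons]
        simp [Routine.step, hd]
      · rw [update_tapeOf, incList, if_pos hd]
        exact run_home _ (by omega)
    · refine .step' (by rw [abs_le]; omega) (u := some (.inr 0)) (d := 1)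
        (r' := some inc) ?_ rfl (h' := (pre ++ [(0 : Fin (b + 2))]).length) (by simp) ?_
      · rw [tapeOf_append_cons]
        simp [Routine.step, hd]
      · rw [update_tapeOf, incList, if_neg hd, List.append_cons pre 0 l,
          List.append_cons pre 0 (incList l)]
        exact ih _ (by simp; omega)

/-- If all digits are zero, the borrow runs into the blank after them and the subroutine is stuck.
The calling machine uses this to kill the branch when the clock has expired. -/
theorem run_dec {S : ℕ} (l pre : List (Fin (b + 2))) (hS : pre.length + l.length ≤ S) :
    Run S (some dec) (tapeOf G (pre ++ l)) pre.length
      ((decList l).map fun l' => (tapeOf G (pre ++ l'), 0)) := by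
  induction l generalizing pre with
  | nil =>
    refine .stuck (by rw [abs_le]; simp at hS; omega) ?_
    rw [List.append_nil, tapeOf_length]
    rfl
  | cons d l ih =>
    simp only [List.length_cons] at hS
    by_cases hd : d = 0
    · refine .step' (by rw [abs_le]; omega) (u := some (.inr (Fin.last _))) (d := 1)
        (r' := some dec) ?_ rfl (h' := (pre ++ [Fin.last (b + 1)]).length) (by simp) ?_
      · rw [tapeOf_append_cons]
        simp [Routine.step, hd]
      · rw [update_tapeOf, decList, if_pos hd, List.append_cons pre (Fin.last _) l]
        have := ih (pre ++ [Fin.last (b + 1)]) (by simp; omega)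
        rw [Option.map_map]
        convert this using 2
        funext l'
        simp
    · refine .step' (by rw [abs_le]; omega) (u := some (.inr (d - 1))) (d := 0)
        (r' := some home) ?_ rfl (h' := pre.length) (by simp) ?_
      · rw [tapeOf_append_cons]
        simp [Routine.step, hd]
      · rw [update_tapeOf, decList, if_neg hd]
        exact run_home _ (by omega)

theorem run_toMark {S : ℕ} {T : ℤ → Cell G b} (n : ℕ) (h : ℤ) (hh : h = -n) (hn : n ≤ S) :
    Run S (some toMark) T h (some (T, 0)) := by
  induction n generalizing h with
  | zero =>
    simp only [CharP.cast_eq_zero, neg_zero] at hh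
    subst hh
    refine .step' (by simp) (u := T 0) (d := 0) (r' := none) ?_ (by simp) (by simp) .done
    simp [Routine.step]
  | succ n ih =>
    refine .step' (by rw [abs_le]; omega) (u := T h) (d := 1) (r' := some toMark)
      ?_ (by simp) rfl (ih _ (by push_cast at hh; simp; omega) (by omega))
    have : h ≠ 0 := by omega
    simp [Routine.step, this]

/-- The sweep to the left stops at the first blank, in cell `l - 1`. The strict inequality `-S < l`
leaves room for this overshoot, and the mark at the origin is found on the way back. -/
theorem run_erase {S : ℕ} {T : ℤ → Cell G b} {l : ℤ} (hl : l ≤ 0) (n : ℕ) (h : ℤ)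
    (hh : h + 1 = l + n) (hS : -(S : ℤ) < l) (hS' : h ≤ S)
    (hT : ∀ i, T i ≠ none ↔ l ≤ i ∧ i ≤ h) :
    Run S (some erase) T h (some (fun _ => none, 0)) := by
  induction n generalizing h T with
  | zero =>
    have e : T = fun _ => none := by
      funext i
      by_contra hi
      have := (hT i).1 hi
      omega
    subst e
    refine .step' (by rw [abs_le]; omega) (u := none) (d := 1) (r' := some toMark)
      (by simp [Routine.step]) (by simp) (h' := l) (by simp at hh ⊢; omega)
      (run_toMark l.natAbs l (by omega) (by omega))
  | succ n ih =>
    have h1 := (hT h).2 ⟨by omega, le_rfl⟩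
    obtain ⟨u, hu⟩ := Option.ne_none_iff_exists'.1 h1
    refine .step' (by rw [abs_le]; omega) (u := none) (d := -1) (r' := some erase)
      (by simp [Routine.step, hu]) rfl (h' := h - 1) (by simp; omega)
      (ih _ (by push_cast at hh; omega) (by omega) ?_)
    intro i
    by_cases hi : i = h
    · subst hi
      simp
    · rw [Function.update_of_ne hi, hT]
      omega

/-- Clearing a tape whose nonblank cells form an interval that contains the origin and the head. -/
theorem run_toRight {S : ℕ} {T : ℤ → Cell G b} {l r h : ℤ} (hl : l ≤ 0) (hr : 0 ≤ r)
    (hlh : l ≤ h) (hhr : h ≤ r) (hS : -(S : ℤ) < l) (hS' : r < S)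
    (hT : ∀ i, T i ≠ none ↔ l ≤ i ∧ i ≤ r) :
    Run S (some toRight) T h (some (fun _ => none, 0)) := by
  obtain ⟨n, hn⟩ : ∃ n : ℕ, h + n = r + 1 := ⟨(r + 1 - h).toNat, by omega⟩
  replace hhr : h ≤ r + 1 := by omega
  induction n generalizing h with
  | zero =>
    have e : T h = none := by
      by_contra hi
      have := (hT h).1 hi
      simp at hn
      omega
    refine .step' (by rw [abs_le]; omega) (u := none) (d := -1) (r' := some erase)
      (by simp [Routine.step, e]) (by rw [← e]; simp) (h' := r) (by simp at hn ⊢; omega)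
      (run_erase hl (r + 1 - l).toNat r (by omega) hS (by omega) hT)
  | succ n ih =>
    have h1 := (hT h).2 ⟨by omega, by omega⟩
    obtain ⟨u, hu⟩ := Option.ne_none_iff_exists'.1 h1
    exact .step' (by rw [abs_le]; omega) (u := some u) (d := 1) (r' := some toRight)
      (by simp [Routine.step, hu]) (by rw [← hu]; simp) (h' := h + 1) (by simp)
      (ih (by omega) (by push_cast at hn; omega) (by push_cast at hn; omega))

end Routine

/-! ### Machines with subroutine calls -/

/-- A machine that may call the subroutines of `Routine` on its tapes. A state is followed by the
subroutine to be carried out before it, if any. Marks of the origins are left unchanged. -/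
structure Core (K W G : Type) (b : ℕ) (α β : Type) : Type where
  /-- the initial state -/
  start : K
  /-- the accepting states -/
  accept : Set K
  /-- the instructions -/
  delta : K → InputSymbol α → (W → Bool × Cell G b) →
    Finset (TMAction (K × Option (Routine × W)) W (Cell G b) β)

namespace Core

variable {K W G : Type} {b : ℕ} {α β : Type}

/-- The instruction that writes the marks `m` together with the contents given by `a`. -/
def lift (m : W → Bool) :
    TMAction (K × Option (Routine × W)) W (Cell G b) β ↪
      TMAction (Option (K × Option (Routine × W))) W (Bool × Cell G b) β where
  toFun a := ⟨some a.next, a.inputMove, fun τ => (m τ, a.write τ), a.workMove, a.emit⟩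
  inj' := by
    rintro ⟨⟩ ⟨⟩ h
    simp only [TMAction.mk.injEq, Option.some.injEq] at h
    obtain ⟨rfl, rfl, h, rfl, rfl⟩ := h
    simp only [TMAction.mk.injEq, true_and, and_true]
    funext τ
    exact (Prod.mk.inj (congrFun h τ)).2

/-- The Turing machine of a `Core`: it marks the origins of its tapes and then carries out the
instructions and the subroutines. -/
@[reducible] def toNTM [Finite K] [Finite W] [Finite G] [DecidableEq W] (X : Core K W G b α β) :
    NTM α β where
  State := Option (K × Option (Routine × W))
  WorkTape := W
  Work := Bool × Cell G b
  finite_state := inferInstance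
  finite_workTape := inferInstance
  finite_work := inferInstance
  blank := (false, none)
  startState := none
  accept := {q | ∃ k ∈ X.accept, q = some (k, none)}
  delta q s t :=
    match q with
    | none => {⟨some (X.start, none), 0, fun _ => (true, none), 0, none⟩}
    | some (k, none) => (X.delta k s t).map (lift fun τ => (t τ).1)
    | some (k, some (r, τ)) =>
      match r.step (t τ).1 (t τ).2 with
      | none => ∅
      | some (u, d, r') =>
        {⟨some (k, r'.map fun r' => (r', τ)), 0, Function.update t τ ((t τ).1, u),
          Function.update 0 τ d, none⟩}

variable [Finite K] [Finite W] [Finite G] [DecidableEq W] (X : Core K W G b α β) {x : List α}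

/-- A configuration of the machine of `X`, with the origins marked. -/
def cfg (q : K × Option (Routine × W)) (inp : ℕ) (h : W → ℤ) (U : W → ℤ → Cell G b)
    (out : List β) : X.toNTM.Config where
  state := some q
  inputHead := inp
  workHead := h
  work τ i := (decide (i = 0), U τ i)
  output := out

/-- Evaluation with all heads in the cells `-S, …, S`. -/
abbrev Ev (x : List α) (S : ℕ) (c : X.toNTM.Config) (m : Multiset (List β)) : Prop :=
  X.toNTM.Eval x (fun d => ∀ i, |d.workHead i| ≤ (S : ℤ)) c m

/-- What the work heads see. -/
def scan (h : W → ℤ) (U : W → ℤ → Cell G b) : W → Bool × Cell G b :=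
  fun τ => (decide (h τ = 0), U τ (h τ))

variable {X} {S : ℕ} {k : K} {inp : ℕ} {h : W → ℤ} {U : W → ℤ → Cell G b} {out : List β}

theorem choices_cfg :
    X.toNTM.choices x (X.cfg (k, none) inp h U out) =
      (X.delta k (inputCell x inp) (scan h U)).map (lift fun τ => decide (h τ = 0)) := rfl

theorem step_cfg_lift (q : K × Option (Routine × W))
    (a : TMAction (K × Option (Routine × W)) W (Cell G b) β) :
    X.toNTM.step x (X.cfg q inp h U out) (lift (fun τ => decide (h τ = 0)) a) =
      X.cfg a.next (min (x.length + 1) ((inp : ℤ) + (a.inputMove : ℤ)).toNat)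
        (fun τ => h τ + (a.workMove τ : ℤ)) (fun τ => Function.update (U τ) (h τ) (a.write τ))
        (out ++ a.emit.toList) := by
  unfold NTM.step cfg lift
  congr 1
  funext τ i
  by_cases hi : i = h τ
  · subst hi
    simp
    rfl
  · simp [Function.update_of_ne hi]

theorem accept_cfg :
    (X.cfg (k, none) inp h U out).state ∈ X.toNTM.accept ↔ k ∈ X.accept := by
  constructor
  · rintro ⟨k', hk', e⟩
    cases e
    exact hk'
  · intro hk
    exact ⟨k, hk, rfl⟩

theorem ev_accept (hS : ∀ τ, |h τ| ≤ (S : ℤ))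
    (hd : X.delta k (inputCell x inp) (scan h U) = ∅) (hk : k ∈ X.accept) :
    X.Ev x S (X.cfg (k, none) inp h U out) {out} := by
  refine .halt hS (by rw [choices_cfg, hd, Finset.map_empty]) ?_
  rw [if_pos (accept_cfg.2 hk)]
  rfl

theorem ev_reject (hS : ∀ τ, |h τ| ≤ (S : ℤ))
    (hd : X.delta k (inputCell x inp) (scan h U) = ∅) (hk : k ∉ X.accept) :
    X.Ev x S (X.cfg (k, none) inp h U out) 0 := by
  refine .halt hS (by rw [choices_cfg, hd, Finset.map_empty]) ?_
  rw [if_neg fun h => hk (accept_cfg.1 h)]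

theorem ev_congr {q : K × Option (Routine × W)} {inp' : ℕ} {h' : W → ℤ}
    {U' : W → ℤ → Cell G b} {out' : List β} {m m' : Multiset (List β)} (hi : inp = inp')
    (hh : h = h') (hU : U = U') (ho : out = out') (hm : m = m')
    (H : X.Ev x S (X.cfg q inp' h' U' out') m') : X.Ev x S (X.cfg q inp h U out) m := by
  subst hi hh hU ho hm
  exact H

theorem ev_step {s : Finset (TMAction (K × Option (Routine × W)) W (Cell G b) β)}
    (u : TMAction (K × Option (Routine × W)) W (Cell G b) β → Multiset (List β))
    (hS : ∀ τ, |h τ| ≤ (S : ℤ)) (hd : X.delta k (inputCell x inp) (scan h U) = s)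
    (hs : s.Nonempty)
    (H : ∀ a ∈ s, X.Ev x S (X.cfg a.next
      (min (x.length + 1) ((inp : ℤ) + (a.inputMove : ℤ)).toNat)
      (fun τ => h τ + (a.workMove τ : ℤ)) (fun τ => Function.update (U τ) (h τ) (a.write τ))
      (out ++ a.emit.toList)) (u a)) :
    X.Ev x S (X.cfg (k, none) inp h U out) (∑ a ∈ s, u a) := by
  subst hd
  -- Since `lift` is injective, distinct instructions of the core remain distinct branches, and the
  -- weights `u` can be transported along it.
  refine .step (Function.extend (lift fun τ => decide (h τ = 0)) u 0) hS
    (by rw [choices_cfg]; exact hs.map) ?_ ?_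
  · intro a ha
    rw [choices_cfg, Finset.mem_map] at ha
    obtain ⟨a, ha, rfl⟩ := ha
    rw [(lift _).injective.extend_apply, step_cfg_lift]
    exact H a ha
  · rw [choices_cfg, Finset.sum_map]
    exact Finset.sum_congr rfl fun a _ => ((lift _).injective.extend_apply _ _ _).symm

/-- The instruction that only changes the state and moves the input head; `t` is what the work
heads see. -/
def goto (t : W → Bool × Cell G b) (d : SignType) (q : K × Option (Routine × W)) :
    TMAction (K × Option (Routine × W)) W (Cell G b) β :=
  ⟨q, d, fun τ => (t τ).2, 0, none⟩

theorem ev_action {a : TMAction (K × Option (Routine × W)) W (Cell G b) β}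
    {m : Multiset (List β)} (hS : ∀ τ, |h τ| ≤ (S : ℤ))
    (hd : X.delta k (inputCell x inp) (scan h U) = {a})
    (H : X.Ev x S (X.cfg a.next (min (x.length + 1) ((inp : ℤ) + (a.inputMove : ℤ)).toNat)
      (fun τ => h τ + (a.workMove τ : ℤ)) (fun τ => Function.update (U τ) (h τ) (a.write τ))
      (out ++ a.emit.toList)) m) :
    X.Ev x S (X.cfg (k, none) inp h U out) m := by
  have := ev_step (X := X) (fun _ => m) hS hd (Finset.singleton_nonempty a)
    (by simpa using H)
  simpa using this

theorem ev_goto {q : K × Option (Routine × W)} {d : SignType} {inp' : ℕ}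
    {m : Multiset (List β)} (hS : ∀ τ, |h τ| ≤ (S : ℤ))
    (hd : X.delta k (inputCell x inp) (scan h U) = {goto (scan h U) d q})
    (hi : min (x.length + 1) ((inp : ℤ) + (d : ℤ)).toNat = inp')
    (H : X.Ev x S (X.cfg q inp' h U out) m) :
    X.Ev x S (X.cfg (k, none) inp h U out) m := by
  refine ev_action hS hd ?_
  subst hi
  simpa [goto, scan] using H

/-- The nondeterministic choice of a state. -/
def choose {ι : Type} (t : W → Bool × Cell G b) (f : ι ↪ K × Option (Routine × W)) (s : Finset ι) :
    Finset (TMAction (K × Option (Routine × W)) W (Cell G b) β) :=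
  s.map ⟨fun i => goto t 0 (f i), fun i j e => f.injective (by
    simp only [goto, TMAction.mk.injEq] at e
    exact e.1)⟩

/-- Options correspond injectively to instructions, so each option is a branch of its own and the
multiplicities add up. -/
theorem ev_choose {ι : Type} {f : ι ↪ K × Option (Routine × W)} {s : Finset ι}
    (u : ι → Multiset (List β)) (hS : ∀ τ, |h τ| ≤ (S : ℤ)) (hinp : inp ≤ x.length + 1)
    (hd : X.delta k (inputCell x inp) (scan h U) = choose (scan h U) f s) (hs : s.Nonempty)
    (H : ∀ i ∈ s, X.Ev x S (X.cfg (f i) inp h U out) (u i)) :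
    X.Ev x S (X.cfg (k, none) inp h U out) (∑ i ∈ s, u i) := by
  set F : ι ↪ TMAction (K × Option (Routine × W)) W (Cell G b) β :=
    ⟨fun i => goto (scan h U) 0 (f i), fun i j e => f.injective (by
      simp only [goto, TMAction.mk.injEq] at e
      exact e.1)⟩ with hF
  have := ev_step (X := X) (Function.extend F u 0) hS hd (Finset.map_nonempty.2 hs) (by
    intro a ha
    obtain ⟨i, hi, rfl⟩ := Finset.mem_map.1 ha
    rw [show (⟨fun i => goto (scan h U) 0 (f i), _⟩ : ι ↪ _) = F from rfl,
      F.injective.extend_apply]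
    simpa [hF, goto, scan, hinp] using H i hi)
  convert this using 1
  rw [choose, Finset.sum_map]
  exact Finset.sum_congr rfl fun i _ => (F.injective.extend_apply _ _ _).symm

theorem ev_routine_step {r : Routine} {τ : W} {u : Cell G b} {d : SignType} {r' : Option Routine}
    {m : Multiset (List β)} (hS : ∀ τ, |h τ| ≤ (S : ℤ)) (hinp : inp ≤ x.length + 1)
    (hr : r.step (decide (h τ = 0)) (U τ (h τ)) = some (u, d, r'))
    (H : X.Ev x S (X.cfg (k, r'.map fun r' => (r', τ)) inp (Function.update h τ (h τ + (d : ℤ)))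
      (Function.update U τ (Function.update (U τ) (h τ) u)) out) m) :
    X.Ev x S (X.cfg (k, some (r, τ)) inp h U out) m := by
  have hc : X.toNTM.choices x (X.cfg (k, some (r, τ)) inp h U out) =
      {⟨some (k, r'.map fun r' => (r', τ)), 0,
        Function.update (scan h U) τ (decide (h τ = 0), u), Function.update 0 τ d, none⟩} := by
    simp only [NTM.choices, cfg, hr]
    rfl
  refine .step (fun _ => m) hS (by rw [hc]; exact Finset.singleton_nonempty _) ?_
    (by rw [hc]; simp)
  intro a ha
  rw [hc, Finset.mem_singleton] at ha
  subst ha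
  convert H using 1
  unfold NTM.step cfg
  congr 1
  · simp [hinp]
  · funext σ
    by_cases hσ : σ = τ
    · subst hσ
      simp
    · simp [Function.update_of_ne hσ]
  · funext σ i
    by_cases hσ : σ = τ
    · subst hσ
      by_cases hi : i = h σ
      · subst hi
        simp
      · simp [Function.update_of_ne hi]
    · simp only [Function.update_of_ne hσ, scan]
      by_cases hi : i = h σ
      · subst hi
        simp
      · simp [Function.update_of_ne hi]
  · simp

theorem ev_routine_stuck {r : Routine} {τ : W} (hS : ∀ τ, |h τ| ≤ (S : ℤ))
    (hr : r.step (decide (h τ = 0)) (U τ (h τ)) = none) :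
    X.Ev x S (X.cfg (k, some (r, τ)) inp h U out) 0 := by
  have hc : X.toNTM.choices x (X.cfg (k, some (r, τ)) inp h U out) = ∅ := by
    simp only [NTM.choices, cfg, hr]
  refine .halt hS hc ?_
  rw [if_neg]
  rintro ⟨k', -, e⟩
  cases e

/-- The machine carries out a call of a subroutine. -/
theorem ev_call {r : Routine} {τ : W} {T' : ℤ → Cell G b} {h' : ℤ} {m : Multiset (List β)}
    (hr : Routine.Run S (some r) (U τ) (h τ) (some (T', h'))) (hS : ∀ τ, |h τ| ≤ (S : ℤ))
    (hinp : inp ≤ x.length + 1)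
    (H : X.Ev x S (X.cfg (k, none) inp (Function.update h τ h') (Function.update U τ T') out) m) :
    X.Ev x S (X.cfg (k, some (r, τ)) inp h U out) m := by
  generalize ho : some (T', h') = o at hr
  generalize hq : some r = q at hr
  generalize hT : U τ = T at hr
  generalize hg : h τ = g at hr
  have key : X.Ev x S (X.cfg (k, q.map fun r' => (r', τ)) inp h U out) m := by
    clear hq
    induction hr generalizing U h with
    | done =>
      cases ho
      subst hT hg
      simpa using H
    | stuck => cases ho
    | @step r T g u r' o d hg' hs hr ih =>
      subst hT hg
      -- `Run` bounds the head only before each step. If the new position is out of bounds, the run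
      -- must be finished, and `H` takes over.
      by_cases hb : |h τ + (d : ℤ)| ≤ (S : ℤ)
      · refine ev_routine_step hS hinp hs (ih ?_ (by simpa using H) ho (by simp) (by simp))
        intro σ
        by_cases hσ : σ = τ
        · subst hσ
          simpa using hb
        · simpa [Function.update_of_ne hσ] using hS σ
      · cases hr with
        | done =>
          cases ho
          refine ev_routine_step hS hinp hs ?_
          simpa using H
        | stuck h1 _ => exact absurd h1 hb
        | step h1 _ _ => exact absurd h1 hb
  subst hq
  exact key

theorem ev_call_stuck {r : Routine} {τ : W}
    (hr : Routine.Run S (some r) (U τ) (h τ) none) (hS : ∀ τ, |h τ| ≤ (S : ℤ))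
    (hinp : inp ≤ x.length + 1) :
    X.Ev x S (X.cfg (k, some (r, τ)) inp h U out) 0 := by
  generalize ho : none = o at hr
  generalize hq : some r = q at hr
  generalize hT : U τ = T at hr
  generalize hg : h τ = g at hr
  induction hr generalizing U h r with
  | done => cases ho
  | stuck _ hs =>
    cases hq
    subst hT hg
    exact ev_routine_stuck hS hs
  | @step r T g u r' o d hg' hs hr ih =>
    cases hq
    subst hT hg
    refine ev_routine_step hS hinp hs ?_
    cases hr with
    | done => cases ho
    | stuck h1 h2 =>
      refine ih ?_ ho rfl (by simp) (by simp)
      intro σ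
      by_cases hσ : σ = τ
      · subst hσ
        simpa using h1
      · simpa [Function.update_of_ne hσ] using hS σ
    | step h1 h2 h3 =>
      refine ih ?_ ho rfl (by simp) (by simp)
      intro σ
      by_cases hσ : σ = τ
      · subst hσ
        simpa using h1
      · simpa [Function.update_of_ne hσ] using hS σ

/-- The blank carries no mark; the very first instruction marks cell 0 of every tape. -/
theorem ev_start {m : Multiset (List β)}
    (H : X.Ev x S (X.cfg (X.start, none) 0 (fun _ => 0) (fun _ _ => none) []) m) :
    X.Ev x S X.toNTM.start m := by
  have hc : X.toNTM.choices x X.toNTM.start =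
      {⟨some (X.start, none), 0, fun _ => (true, none), 0, none⟩} := rfl
  refine .step (fun _ => m) (fun i => by simp [NTM.start])
    (by rw [hc]; exact Finset.singleton_nonempty _) ?_ (by rw [hc]; simp)
  intro a ha
  rw [hc, Finset.mem_singleton] at ha
  subst ha
  convert H using 1
  unfold NTM.step NTM.start cfg
  congr 1
  funext τ i
  by_cases hi : i = 0
  · subst hi
    simp
  · simp [hi]

end Core


attribute [instance] NTM.finite_state NTM.finite_workTape NTM.finite_work

/-- The letter in a cell of a simulated tape. -/
def NTM.letter {α β : Type} (N : NTM α β) {b : ℕ} : Cell N.Work b → N.Work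
  | some (.inl g) => g
  | _ => N.blank

/-! ### Digits -/

/-- The binary digits of `n`, the least significant digit first, as digits in base `b + 2`. -/
def binDigits (b n : ℕ) : List (Fin (b + 2)) := n.bits.map fun d => if d then 1 else 0

@[simp] theorem length_binDigits (b n : ℕ) : (binDigits b n).length = n.bits.length := by
  simp [binDigits]

theorem binDigits_zero (b : ℕ) : binDigits b 0 = [] := rfl

theorem bits_eq_cons {n : ℕ} (hn : n ≠ 0) : n.bits = decide (n % 2 = 1) :: (n / 2).bits := by
  conv_lhs => rw [← Nat.bit_bodd_div2 n]
  rw [Nat.bits_append_bit, Nat.div2_val]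
  · congr 1
    rcases Nat.mod_two_eq_zero_or_one n with h | h
    · rw [Nat.mod_two_of_bodd] at h
      simp [Nat.mod_two_of_bodd]
    · simp [Nat.mod_two_of_bodd]
  · intro h
    by_contra hb
    rw [Bool.not_eq_true] at hb
    have := Nat.bit_bodd_div2 n
    rw [h, hb] at this
    exact hn this.symm

theorem incList_binDigits (b n : ℕ) :
    Routine.incList (binDigits b n) = binDigits b (n + 1) := by
  induction n using Nat.strong_induction_on with
  | _ n ih =>
    rcases eq_or_ne n 0 with rfl | hn
    · simp [binDigits, Routine.incList]
    · unfold binDigits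
      rw [bits_eq_cons hn, bits_eq_cons (Nat.succ_ne_zero n)]
      rcases Nat.mod_two_eq_zero_or_one n with h | h
      · have h1 : (n + 1) % 2 = 1 := by omega
        have h2 : (n + 1) / 2 = n / 2 := by omega
        simp [h, h1, h2, Routine.incList]
      · have h1 : (n + 1) % 2 = 0 := by omega
        have h2 : (n + 1) / 2 = n / 2 + 1 := by omega
        have := ih (n / 2) (by omega)
        simp only [binDigits] at this
        simp [h, h1, h2, Routine.incList, this]

/-- The value of a list of digits in base `b + 2`. -/
def digitsVal {b : ℕ} (l : List (Fin (b + 2))) : ℕ := Nat.ofDigits (b + 2) (l.map Fin.val)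

theorem digitsVal_cons {b : ℕ} (d : Fin (b + 2)) (l : List (Fin (b + 2))) :
    digitsVal (d :: l) = d + (b + 2) * digitsVal l := by
  simp [digitsVal, Nat.ofDigits_cons]

theorem digitsVal_lt {b : ℕ} (l : List (Fin (b + 2))) : digitsVal l < (b + 2) ^ l.length := by
  have := Nat.ofDigits_lt_base_pow_length (b := b + 2) (l := l.map Fin.val) (by omega) (by
    intro x hx
    obtain ⟨d, -, rfl⟩ := List.mem_map.1 hx
    exact d.2)
  simpa [digitsVal] using this

/-- Borrowing turns `0 + B * (v + 1)` into `(B - 1) + B * v + 1`, where `B` is the base. The length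
is preserved, so the clock never needs more space. -/
theorem decList_spec {b : ℕ} (l : List (Fin (b + 2))) :
    (digitsVal l = 0 ∧ Routine.decList l = none) ∨
    ∃ l', Routine.decList l = some l' ∧ digitsVal l = digitsVal l' + 1 ∧
      l'.length = l.length := by
  induction l with
  | nil => exact .inl ⟨rfl, rfl⟩
  | cons d l ih =>
    by_cases hd : d = 0
    · subst hd
      rcases ih with ⟨h1, h2⟩ | ⟨l', h1, h2, h3⟩
      · left
        simp [digitsVal_cons, h1, Routine.decList, h2]
      · right
        refine ⟨Fin.last _ :: l', by simp [Routine.decList, h1], ?_, by simp [h3]⟩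
        rw [digitsVal_cons, digitsVal_cons, h2]
        simp
        ring
    · right
      refine ⟨(d - 1) :: l, by simp [Routine.decList, hd], ?_, rfl⟩
      rw [digitsVal_cons, digitsVal_cons]
      have h1 : 0 < (d : ℕ) := Nat.pos_of_ne_zero fun h => hd (Fin.ext h)
      have h2 : ((d - 1 : Fin (b + 2)) : ℕ) = d - 1 := by
        rw [Fin.sub_def]
        have := d.2
        simp only [Fin.val_one]
        rw [show b + 2 - 1 + (d : ℕ) = (d - 1) + (b + 2) by omega, Nat.add_mod_right,
          Nat.mod_eq_of_lt (by omega)]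
      omega

/-- The leading binary digit is 1 and stands at position `Nat.log 2 n`. Reading the same digits in a
larger base raises `n` to roughly any desired power without any arithmetic by the machine. -/
theorem pow_log_le_digitsVal (b : ℕ) {n : ℕ} (hn : n ≠ 0) :
    (b + 2) ^ Nat.log 2 n ≤ digitsVal (binDigits b n) := by
  induction n using Nat.strong_induction_on with
  | _ n ih =>
    rw [binDigits, bits_eq_cons hn, List.map_cons, digitsVal_cons]
    rcases Nat.lt_or_ge n 2 with h | h
    · obtain rfl : n = 1 := by omega
      simp
    · have h2 : Nat.log 2 n = Nat.log 2 (n / 2) + 1 := Nat.log_of_one_lt_of_le (by omega) h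
      have := ih (n / 2) (by omega) (by omega)
      rw [binDigits] at this
      rw [h2, pow_succ']
      exact (Nat.mul_le_mul_left _ this).trans (Nat.le_add_left _ _)

theorem length_bits_le (n : ℕ) : n.bits.length ≤ Nat.log 2 n + 1 := by
  rw [Nat.size_eq_bits_len, Nat.size_le]
  exact Nat.lt_pow_succ_log_self (by norm_num) n

theorem length_bits_mono {m n : ℕ} (h : m ≤ n) : m.bits.length ≤ n.bits.length := by
  rw [Nat.size_eq_bits_len, Nat.size_eq_bits_len]
  exact Nat.size_le_size h

theorem bits_length_pos {n : ℕ} (hn : n ≠ 0) : 0 < n.bits.length := by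
  rw [bits_eq_cons hn]
  simp

/-! ### Input cells -/

theorem inputCell_succ {α : Type} (x : List α) (i : ℕ) (hi : i < x.length) :
    inputCell x (i + 1) = .letter x[i] := by
  simp [inputCell, hi]

theorem inputCell_of_lt {α : Type} (x : List α) (i : ℕ) (hi : x.length < i) :
    inputCell x i = .rightEnd := by
  obtain ⟨i, rfl⟩ : ∃ k, i = k + 1 := ⟨i - 1, by omega⟩
  simp only [inputCell]
  rw [List.getElem?_eq_none (by omega)]

theorem inputCell_ne_rightEnd {α : Type} (x : List α) {i : ℕ} (hi : i ≤ x.length) :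
    inputCell x i ≠ .rightEnd := by
  cases i with
  | zero => simp [inputCell]
  | succ i => simp [inputCell_succ x i hi]

/-! ### Running a machine on a virtual triple -/

namespace Virtual

variable {α G : Type} {b : ℕ}

/-- The symbol that is seen on the virtual input tape `(x, j, d)` when the real input head sees
`s`, the head on the tape of `j` sees `u`, and `f` says whether the virtual head is at the right
end. -/
def symbol (d : Option α) (s : InputSymbol α) (u : Cell G b) (f : Bool) :
    InputSymbol (TripleAlphabet α) :=
  match s with
  | .leftEnd => .leftEnd
  | .letter a => .letter (.inl a)
  | .rightEnd => if f then .rightEnd else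
    match u with
    | some (.inr e) => .letter (.inr (.inl (decide (e ≠ 0))))
    | _ => .letter (.inr (.inr d))

/-- The move of the virtual input head: the moves of the real input head and of the head on the
tape of `j`, and the new flag. -/
def move (s : InputSymbol α) (t : Bool × Cell G b) (f : Bool) (d : SignType) :
    SignType × SignType × Bool :=
  match s with
  | .rightEnd =>
    if f then (0, 0, decide (d ≠ -1)) else
    if d = 0 then (0, 0, false) else
    if d = 1 then (if t.2 = none then (0, 0, true) else (0, 1, false)) else
    if t.1 then (-1, 0, false) else (0, -1, false)
  | _ => (d, 0, false)

variable (x : List α) (j : ℕ) (d : Option α)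

theorem length_encodeTriple :
    (encodeTriple x j d).length = x.length + j.bits.length + 1 := by
  simp [encodeTriple]
  ring

theorem inputCell_encodeTriple_letter {i : ℕ} (hi : i < x.length) :
    inputCell (encodeTriple x j d) (i + 1) = .letter (.inl x[i]) := by
  simp [inputCell, encodeTriple, List.getElem?_append_left, hi]

theorem inputCell_encodeTriple_digit {i : ℕ} (hi : i < j.bits.length) :
    inputCell (encodeTriple x j d) (x.length + 1 + i) = .letter (.inr (.inl j.bits[i])) := by
  rw [show x.length + 1 + i = x.length + i + 1 by ring]
  simp only [inputCell, encodeTriple, List.append_assoc]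
  rw [List.getElem?_append_right (by simp)]
  simp [List.getElem?_append_left, hi]

theorem inputCell_encodeTriple_symbol :
    inputCell (encodeTriple x j d) (x.length + 1 + j.bits.length) = .letter (.inr (.inr d)) := by
  rw [show x.length + 1 + j.bits.length = x.length + j.bits.length + 1 by ring]
  simp [inputCell, encodeTriple]

/-- The position of the real input head for the virtual position `v`. -/
def inpPos (v : ℕ) : ℕ := min v (x.length + 1)

/-- The position of the head on the tape of `j` for the virtual position `v`. -/
def idxPos (v : ℕ) : ℕ := min (v - (x.length + 1)) j.bits.length

/-- The flag for the virtual position `v`. -/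
def flag (v : ℕ) : Bool := decide (v = x.length + j.bits.length + 2)

variable {x j}

theorem exists_cases {v : ℕ} (hv : v ≤ x.length + j.bits.length + 2) :
    v ≤ x.length ∨ (∃ i, i < j.bits.length ∧ v = x.length + 1 + i) ∨
      v = x.length + 1 + j.bits.length ∨ v = x.length + j.bits.length + 2 := by
  by_cases h1 : v ≤ x.length
  · exact .inl h1
  by_cases h2 : v < x.length + 1 + j.bits.length
  · exact .inr (.inl ⟨v - (x.length + 1), by omega, by omega⟩)
  · omega

theorem tapeOf_binDigits_lt {i : ℕ} (hi : i < j.bits.length) :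
    Routine.tapeOf G (binDigits b j) i = some (.inr (if j.bits[i] then 1 else 0)) := by
  rw [Routine.tapeOf_natCast]
  simp [binDigits, hi]

theorem tapeOf_binDigits_length :
    Routine.tapeOf G (binDigits b j) (j.bits.length : ℕ) = none := by
  rw [Routine.tapeOf_natCast]
  simp [binDigits]

/-- A virtual position is on the left marker or `x`, on a digit of `j`, on the last symbol, or on
the right end marker. In the last two cases both real heads stand at the same places, and only the
flag tells them apart. -/
theorem symbol_eq {v : ℕ} (hv : v ≤ x.length + j.bits.length + 2) :
    symbol d (inputCell x (inpPos x v)) (Routine.tapeOf G (binDigits b j) (idxPos x j v))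
      (flag x j v) = inputCell (encodeTriple x j d) v := by
  rcases exists_cases hv with h | ⟨i, hi, rfl⟩ | rfl | rfl
  · have e1 : inpPos x v = v := by unfold inpPos; omega
    rw [e1]
    cases v with
    | zero => rfl
    | succ v =>
      rw [inputCell_succ x v (by omega), inputCell_encodeTriple_letter x j d (by omega)]
      rfl
  · have e1 : inpPos x (x.length + 1 + i) = x.length + 1 := by unfold inpPos; omega
    have e2 : idxPos x j (x.length + 1 + i) = i := by unfold idxPos; omega
    have e3 : flag x j (x.length + 1 + i) = false := by
      unfold flag
      rw [decide_eq_false_iff_not]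
      omega
    rw [e1, e2, e3, inputCell_of_lt x _ (by omega), inputCell_encodeTriple_digit x j d hi,
      tapeOf_binDigits_lt hi]
    cases h : j.bits[i] <;> simp [symbol]
  · have e1 : inpPos x (x.length + 1 + j.bits.length) = x.length + 1 := by unfold inpPos; omega
    have e2 : idxPos x j (x.length + 1 + j.bits.length) = j.bits.length := by unfold idxPos; omega
    have e3 : flag x j (x.length + 1 + j.bits.length) = false := by
      unfold flag
      rw [decide_eq_false_iff_not]
      omega
    rw [e1, e2, e3, inputCell_of_lt x _ (by omega), inputCell_encodeTriple_symbol x j d,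
      tapeOf_binDigits_length]
    rfl
  · have e1 : inpPos x (x.length + j.bits.length + 2) = x.length + 1 := by unfold inpPos; omega
    have e3 : flag x j (x.length + j.bits.length + 2) = true := by simp [flag]
    rw [e1, e3, inputCell_of_lt x _ (by omega),
      inputCell_of_lt _ _ (by rw [length_encodeTriple]; omega)]
    rfl

/-- Leaving the digits to the left is detected by the mark of the origin, and then the input head
moves instead. A right move at the blank after the digits raises the flag and moves neither head. -/
theorem move_eq {v v' : ℕ} (hv : v ≤ x.length + j.bits.length + 2) (hj : 1 ≤ j) (e : SignType)
    (hv' : v' = min (x.length + j.bits.length + 2) ((v : ℤ) + (e : ℤ)).toNat)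
    (r : SignType × SignType × Bool)
    (hr : r = move (inputCell x (inpPos x v)) (decide ((idxPos x j v : ℤ) = 0),
      Routine.tapeOf G (binDigits b j) (idxPos x j v)) (flag x j v) e) :
    min (x.length + 1) ((inpPos x v : ℤ) + (r.1 : ℤ)).toNat = inpPos x v' ∧
      (idxPos x j v : ℤ) + (r.2.1 : ℤ) = idxPos x j v' ∧ r.2.2 = flag x j v' := by
  have hL := bits_length_pos (n := j) (by omega)
  rcases exists_cases hv with h | ⟨i, hi, rfl⟩ | rfl | rfl
  · have e1 : inpPos x v = v := by unfold inpPos; omega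
    have hr' : r = (e, 0, false) := by
      rw [hr, e1]
      have := inputCell_ne_rightEnd x h
      cases hc : inputCell x v <;> simp_all [move]
    subst hr'
    simp only [inpPos, idxPos, flag]
    have h2 : v' ≤ x.length + 1 := by
      rcases e with _ | _ | _ <;> simp at hv' <;> omega
    refine ⟨?_, by simp; omega, ?_⟩
    · rcases e with _ | _ | _ <;> simp at hv' ⊢ <;> omega
    · symm
      rw [decide_eq_false_iff_not]
      omega
  · have e1 : inpPos x (x.length + 1 + i) = x.length + 1 := by unfold inpPos; omega
    have e2 : idxPos x j (x.length + 1 + i) = i := by unfold idxPos; omega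
    have e3 : flag x j (x.length + 1 + i) = false := by
      unfold flag
      rw [decide_eq_false_iff_not]
      omega
    rw [e1, e2, e3, inputCell_of_lt x _ (by omega), tapeOf_binDigits_lt hi] at hr
    rw [e1, e2]
    simp only [inpPos, idxPos, flag]
    rcases e with _ | _ | _
    · simp [move] at hr hv'
      subst hr
      simp
      omega
    · by_cases h0 : i = 0
      · simp [move, h0] at hr hv'
        subst hr
        simp
        omega
      · simp [move, h0] at hr hv'
        subst hr
        simp
        omega
    · simp [move] at hr hv'
      subst hr
      simp
      omega
  · have e1 : inpPos x (x.length + 1 + j.bits.length) = x.length + 1 := by unfold inpPos; omega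
    have e2 : idxPos x j (x.length + 1 + j.bits.length) = j.bits.length := by unfold idxPos; omega
    have e3 : flag x j (x.length + 1 + j.bits.length) = false := by
      unfold flag
      rw [decide_eq_false_iff_not]
      omega
    rw [e1, e2, e3, inputCell_of_lt x _ (by omega), tapeOf_binDigits_length] at hr
    rw [e1, e2]
    simp only [inpPos, idxPos, flag]
    have h0 : j.bits.length ≠ 0 := by omega
    rcases e with _ | _ | _
    · simp [move] at hr hv'
      subst hr
      simp
      omega
    · have h0' : j.bits ≠ [] := by
        intro h
        simp [h] at h0
      simp [move, h0'] at hr hv'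
      subst hr
      simp
      omega
    · simp [move] at hr hv'
      subst hr
      simp
      omega
  · have e1 : inpPos x (x.length + j.bits.length + 2) = x.length + 1 := by unfold inpPos; omega
    have e3 : flag x j (x.length + j.bits.length + 2) = true := by simp [flag]
    have e2 : idxPos x j (x.length + j.bits.length + 2) = j.bits.length := by unfold idxPos; omega
    rw [e1, e3, inputCell_of_lt x _ (by omega)] at hr
    rw [e1, e2]
    simp only [inpPos, idxPos, flag]
    rcases e with _ | _ | _
    · simp [move] at hr hv'
      subst hr
      simp
      omega
    · simp [move] at hr hv'
      subst hr
      simp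
      omega
    · simp [move] at hr hv'
      subst hr
      simp
      omega

end Virtual


/-! ### The machine that computes a function symbol by symbol -/

namespace Symbolwise

variable {α : Type}

/-- The states of the machine that guesses the symbols of `f x` one after the other and verifies
each of them by runs of the machine `N`. -/
inductive State (N : NTM (TripleAlphabet α) Empty) (t a₀ b₀ : ℕ) : Type where
  | count
  | toStart
  | loop
  | index
  | guess
  | pick (d : Option α) (m : Fin a₀ ⊕ Fin b₀)
  | rewind (d : Option α) (r : Fin (t + 1))
  | sim (d : Option α) (r : Fin (t + 1)) (q : N.State) (f : Bool)
  | exec (d : Option α) (r : Fin (t + 1)) (a : N.Action) (f : Bool)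
  | clear (d : Option α) (r : Fin (t + 1)) (A : Finset N.WorkTape)
  | finish (d : Option α)

variable (N : NTM (TripleAlphabet α) Empty) (t a₀ b₀ : ℕ)

instance [Finite α] : Finite (State N t a₀ b₀) := by
  have : Finite N.Action := TMAction.finite
  have := Fintype.ofFinite N.WorkTape
  refine Finite.of_surjective (α := Fin 5 ⊕ (Option α × (Fin a₀ ⊕ Fin b₀)) ⊕
    (Option α × Fin (t + 1)) ⊕ (Option α × Fin (t + 1) × N.State × Bool) ⊕
    (Option α × Fin (t + 1) × N.Action × Bool) ⊕ (Option α × Fin (t + 1) × Finset N.WorkTape) ⊕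
    Option α) (fun s => match s with
    | .inl i => ![.count, .toStart, .loop, .index, .guess] i
    | .inr (.inl (d, m)) => .pick d m
    | .inr (.inr (.inl (d, r))) => .rewind d r
    | .inr (.inr (.inr (.inl (d, r, q, f)))) => .sim d r q f
    | .inr (.inr (.inr (.inr (.inl (d, r, a, f))))) => .exec d r a f
    | .inr (.inr (.inr (.inr (.inr (.inl (d, r, A)))))) => .clear d r A
    | .inr (.inr (.inr (.inr (.inr (.inr d))))) => .finish d) ?_
  rintro (_ | _ | _ | _ | _ | ⟨d, m⟩ | ⟨d, r⟩ | ⟨d, r, q, f⟩ | ⟨d, r, a, f⟩ | ⟨d, r, A⟩ | d)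
  · exact ⟨.inl 0, rfl⟩
  · exact ⟨.inl 1, rfl⟩
  · exact ⟨.inl 2, rfl⟩
  · exact ⟨.inl 3, rfl⟩
  · exact ⟨.inl 4, rfl⟩
  · exact ⟨.inr (.inl (d, m)), rfl⟩
  · exact ⟨.inr (.inr (.inl (d, r))), rfl⟩
  · exact ⟨.inr (.inr (.inr (.inl (d, r, q, f)))), rfl⟩
  · exact ⟨.inr (.inr (.inr (.inr (.inl (d, r, a, f))))), rfl⟩
  · exact ⟨.inr (.inr (.inr (.inr (.inr (.inl (d, r, A)))))), rfl⟩
  · exact ⟨.inr (.inr (.inr (.inr (.inr (.inr d))))), rfl⟩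

variable {N t}

/-- The number of remaining runs, after one more run. -/
def pred (r : Fin (t + 1)) : Fin (t + 1) := ⟨r - 1, by omega⟩

/-- The work tapes: those of `N`, the tape of `j`, and the tape that bounds the number of symbols. -/
abbrev Tape (N : NTM (TripleAlphabet α) Empty) : Type := N.WorkTape ⊕ Bool

variable {a₀ b₀}

/-- The choice of an instruction of `N`. -/
def execEmb (d : Option α) (r : Fin (t + 1)) (f : Bool) :
    N.Action ↪ State N t a₀ b₀ × Option (Routine × Tape N) :=
  ⟨fun a => (.exec d r a f, none), fun a a' h => by
    simp only [Prod.mk.injEq, State.exec.injEq] at h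
    exact h.1.2.2.1⟩

/-- The choice of a symbol and of one of `a₀ + b₀` ways to proceed. -/
def pickEmb : Option α × (Fin a₀ ⊕ Fin b₀) ↪ State N t a₀ b₀ × Option (Routine × Tape N) :=
  ⟨fun p => (.pick p.1 p.2, none), fun p p' h => by
    simp only [Prod.mk.injEq, State.pick.injEq] at h
    exact Prod.ext h.1.1 h.1.2⟩

variable (N t a₀ b₀)

open Core Classical in
/-- The machine: count the input length on the tape `true`, and then repeat: decrement the tape
`true`, increment the number `j` on the tape `false`, guess a symbol `d`, either accept it at once
(in `a₀` ways) or (in `b₀` ways) run `N` on `(x, j, d)` for `t` times, and append `d` to the output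
or stop. -/
noncomputable def core [Fintype α] [Fintype N.WorkTape] [DecidableEq N.WorkTape] (b : ℕ) :
    Core (State N t a₀ b₀) (Tape N) N.Work b α α where
  start := .count
  accept := {.finish none}
  delta k s w :=
    match k with
    | .count =>
      match s with
      | .rightEnd => {goto w 0 (.toStart, some (.inc, .inr true))}
      | _ => {goto w 1 (.count, some (.inc, .inr true))}
    | .toStart =>
      match s with
      | .leftEnd => {goto w 0 (.loop, none)}
      | _ => {goto w (-1) (.toStart, none)}
    | .loop => {goto w 0 (.index, some (.dec, .inr true))}
    | .index => {goto w 0 (.guess, some (.inc, .inr false))}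
    | .guess => choose w pickEmb Finset.univ
    | .pick d m =>
      match m with
      | .inl _ => {goto w 0 (.finish d, none)}
      | .inr _ => {goto w 0 (.rewind d (Fin.last t), none)}
    | .rewind d r =>
      match s with
      | .leftEnd =>
        if r = 0 then {goto w 0 (.finish d, none)}
        else {goto w 0 (.sim d r N.startState false, none)}
      | _ => {goto w (-1) (.rewind d r, none)}
    | .sim d r q f =>
      let s' := N.delta q (Virtual.symbol d s (w (.inr false)).2 f) fun i => N.letter (w (.inl i)).2
      if s' = ∅ then
        if q ∈ N.accept then
          {⟨(.clear d r Finset.univ, none), 0,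
            Sum.elim (fun i => some (.inl (N.letter (w (.inl i)).2))) (fun i => (w (.inr i)).2),
            0, none⟩}
        else ∅
      else choose w (execEmb d r f) s'
    | .exec d r a f =>
      let m := Virtual.move s (w (.inr false)) f a.inputMove
      {⟨(.sim d r a.next m.2.2, none), m.1,
        Sum.elim (fun i => some (.inl (a.write i))) (fun i => (w (.inr i)).2),
        Sum.elim a.workMove (fun i => bif i then 0 else m.2.1), none⟩}
    | .clear d r A =>
      if h : A.Nonempty then
        {goto w 0 (.clear d r (A.erase h.choose), some (.toRight, .inl h.choose))}
      else {goto w 0 (.rewind d (pred r), some (.home, .inr false))}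
    | .finish d =>
      match d with
      | none => ∅
      | some c => {⟨(.loop, none), 0, fun i => (w i).2, 0, some c⟩}

variable {N t a₀ b₀} {b : ℕ}

/-- The head positions: those of `N`, and `i` on the tape of `j`. -/
def heads (wh : N.WorkTape → ℤ) (i : ℤ) : Tape N → ℤ :=
  Sum.elim wh fun c => bif c then 0 else i

/-- The tapes: those of `N`, and the digits `l` and `j` on the two counter tapes. -/
def tapes (V : N.WorkTape → ℤ → Cell N.Work b) (l j : List (Fin (b + 2))) :
    Tape N → ℤ → Cell N.Work b :=
  Sum.elim V fun c => bif c then Routine.tapeOf _ l else Routine.tapeOf _ j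

theorem heads_le {S : ℕ} {wh : N.WorkTape → ℤ} {i : ℤ} (h : ∀ τ, |wh τ| ≤ (S : ℤ))
    (hi : |i| ≤ (S : ℤ)) : ∀ τ, |heads wh i τ| ≤ (S : ℤ)
  | .inl τ => h τ
  | .inr true => by simp [heads]
  | .inr false => hi

theorem heads_zero_le {S : ℕ} : ∀ τ, |heads (N := N) (fun _ => 0) 0 τ| ≤ (S : ℤ) :=
  heads_le (by simp) (by simp)

section Update

variable [DecidableEq N.WorkTape] (wh : N.WorkTape → ℤ) (i v : ℤ)
  (V : N.WorkTape → ℤ → Cell N.Work b) (T : ℤ → Cell N.Work b) (l j l' : List (Fin (b + 2)))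
  (τ : N.WorkTape)

theorem update_heads_inl :
    Function.update (heads wh i) (.inl τ) v = heads (Function.update wh τ v) i :=
  Sum.update_elim_inl

theorem update_heads_true : Function.update (heads wh i) (.inr true) 0 = heads wh i := by
  funext c
  rcases c with c | _ | _ <;> simp [heads]

theorem update_heads_false : Function.update (heads wh i) (.inr false) v = heads wh v := by
  funext c
  rcases c with c | _ | _ <;> simp [heads]

theorem update_tapes_inl :
    Function.update (tapes V l j) (.inl τ) T = tapes (Function.update V τ T) l j :=
  Sum.update_elim_inl

theorem update_tapes_true :
    Function.update (tapes V l j) (.inr true) (Routine.tapeOf _ l') = tapes V l' j := by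
  funext c
  rcases c with c | _ | _ <;> simp [tapes]

theorem update_tapes_false :
    Function.update (tapes V l j) (.inr false) (Routine.tapeOf _ l') = tapes V l l' := by
  funext c
  rcases c with c | _ | _ <;> simp [tapes]

end Update

theorem heads_move (wh : N.WorkTape → ℤ) (i : ℤ) (d : N.WorkTape → SignType) (e : SignType) :
    (fun τ => heads wh i τ + ((Sum.elim d (fun c => bif c then 0 else e) τ : SignType) : ℤ)) =
      heads (fun τ => wh τ + (d τ : ℤ)) (i + (e : ℤ)) := by
  funext c
  rcases c with c | _ | _ <;> simp [heads]

theorem tapes_write (wh : N.WorkTape → ℤ) (i : ℤ) (V : N.WorkTape → ℤ → Cell N.Work b)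
    (l j : List (Fin (b + 2))) (g : N.WorkTape → Cell N.Work b) :
    (fun τ => Function.update (tapes V l j τ) (heads wh i τ)
      (Sum.elim g (fun c => (Core.scan (heads wh i) (tapes V l j) (.inr c)).2) τ)) =
      tapes (fun τ => Function.update (V τ) (wh τ) (g τ)) l j := by
  funext c
  rcases c with c | _ | _
  · rfl
  · exact Function.update_eq_self _ _
  · exact Function.update_eq_self _ _

/-- `Vis N S T w h`: the tape `T` represents the tape `w` of `N`, its nonblank cells are the
visited ones, where the cell scanned by the head `h` counts as visited. -/
def Vis (N : NTM (TripleAlphabet α) Empty) (S : ℕ) (T : ℤ → Cell N.Work b) (w : ℤ → N.Work)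
    (h : ℤ) : Prop :=
  ∃ lo hi : ℤ, lo ≤ 0 ∧ 0 ≤ hi ∧ lo ≤ h ∧ h ≤ hi ∧ -(S : ℤ) < lo ∧ hi < S ∧
    (∀ k, T k ≠ none → lo ≤ k ∧ k ≤ hi) ∧ (∀ k, lo ≤ k → k ≤ hi → k ≠ h → T k ≠ none) ∧
    ∀ k, N.letter (T k) = w k

theorem Vis.zero {S : ℕ} (hS : 0 < S) :
    Vis (b := b) N S (fun _ => none) (fun _ => N.blank) 0 :=
  ⟨0, 0, le_rfl, le_rfl, le_rfl, le_rfl, by omega, by omega, by simp,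
    fun k h1 h2 h3 => absurd (le_antisymm h2 h1) h3, fun _ => rfl⟩

/-- The cell that is left has just been written, and the interval is extended to the newly scanned
cell, the only one in it that may still be blank. -/
theorem Vis.step {S : ℕ} {T : ℤ → Cell N.Work b} {w : ℤ → N.Work} {h : ℤ}
    (H : Vis N S T w h) (g : N.Work) (d : SignType) (hd : |h + (d : ℤ)| < (S : ℤ)) :
    Vis N S (Function.update T h (some (.inl g))) (Function.update w h g) (h + (d : ℤ)) := by
  obtain ⟨lo, hi, h1, h2, h3, h4, h5, h6, h7, h8, h9⟩ := H
  rw [_root_.abs_lt] at hd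
  have hd' : (d : ℤ) = -1 ∨ (d : ℤ) = 0 ∨ (d : ℤ) = 1 := by
    rcases d with _ | _ | _ <;> simp
  refine ⟨min lo (h + d), max hi (h + d), by omega, by omega, by omega, by omega, by omega,
    by omega, fun k hk => ?_, fun k k1 k2 k3 => ?_, fun k => ?_⟩
  · by_cases hkh : k = h
    · omega
    · rw [Function.update_of_ne hkh] at hk
      have := h7 k hk
      omega
  · by_cases hkh : k = h
    · subst hkh
      simp
    · rw [Function.update_of_ne hkh]
      exact h8 k (by omega) (by omega) hkh
  · by_cases hkh : k = h
    · subst hkh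
      simp [NTM.letter]
    · rw [Function.update_of_ne hkh, Function.update_of_ne hkh, h9]

/-- Writing into the scanned cell closes the only possible gap, so the nonblank cells form exactly
an interval, as clearing requires. -/
theorem Vis.run {S : ℕ} {T : ℤ → Cell N.Work b} {w : ℤ → N.Work} {h : ℤ}
    (H : Vis N S T w h) (g : N.Work) :
    Routine.Run S (some .toRight) (Function.update T h (some (.inl g))) h
      (some (fun _ => none, 0)) := by
  obtain ⟨lo, hi, h1, h2, h3, h4, h5, h6, h7, h8, h9⟩ := H
  refine Routine.run_toRight h1 h2 h3 h4 h5 h6 fun k => ?_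
  by_cases hkh : k = h
  · subst hkh
    simp [h3, h4]
  · rw [Function.update_of_ne hkh]
    exact ⟨h7 k, fun hk => h8 k hk.1 hk.2 hkh⟩

/-! ### Branch counts of the symbol-by-symbol machine -/

section Eval

variable [Fintype α] [Fintype N.WorkTape] [DecidableEq N.WorkTape] {x : List α} {S : ℕ}
  {V : N.WorkTape → ℤ → Cell N.Work b} {wh : N.WorkTape → ℤ} {i : ℤ} {l j : List (Fin (b + 2))}
  {out : List α} {m : Multiset (List α)}

/-- The configurations of the machine. -/
noncomputable abbrev conf (k : State N t a₀ b₀) (inp : ℕ) (wh : N.WorkTape → ℤ) (i : ℤ)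
    (V : N.WorkTape → ℤ → Cell N.Work b) (l j : List (Fin (b + 2))) (out : List α) :=
  (core N t a₀ b₀ b).cfg (k, none) inp (heads wh i) (tapes V l j) out

/-- The configurations in which the simulated machine is reset. -/
noncomputable abbrev clean (k : State N t a₀ b₀) (inp : ℕ) (l j : List (Fin (b + 2)))
    (out : List α) :=
  conf k inp (fun _ => 0) 0 (fun _ _ => none) l j out

theorem ev_rewind {d : Option α} {r : Fin (t + 1)} {inp : ℕ} (hinp : inp ≤ x.length + 1)
    (H : (core N t a₀ b₀ b).Ev x S (clean (.rewind d r) 0 l j out) m) :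
    (core N t a₀ b₀ b).Ev x S (clean (.rewind d r) inp l j out) m := by
  induction inp with
  | zero => exact H
  | succ n ih =>
    refine Core.ev_goto (d := -1) (q := (.rewind d r, none)) heads_zero_le ?_ ?_ (ih (by omega))
    · rcases Nat.lt_or_ge n x.length with hn | hn
      · rw [inputCell_succ x n hn]
        rfl
      · rw [inputCell_of_lt x _ (by omega)]
        rfl
    · simp
      omega

theorem ev_toStart {inp : ℕ} (hinp : inp ≤ x.length + 1)
    (H : (core N t a₀ b₀ b).Ev x S (clean .loop 0 l j out) m) :
    (core N t a₀ b₀ b).Ev x S (clean .toStart inp l j out) m := by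
  induction inp with
  | zero => exact Core.ev_goto (d := 0) (q := (.loop, none)) heads_zero_le rfl (by simp) H
  | succ n ih =>
    refine Core.ev_goto (d := -1) (q := (.toStart, none)) heads_zero_le ?_ ?_ (ih (by omega))
    · rcases Nat.lt_or_ge n x.length with hn | hn
      · rw [inputCell_succ x n hn]
        rfl
      · rw [inputCell_of_lt x _ (by omega)]
        rfl
    · simp
      omega

/-- Clearing is deterministic, so it does not affect multiplicities. The set `A` contains the tapes
still to be cleared; afterwards the head on the index and the input head return, ready for another
run. -/
theorem ev_clear {d : Option α} {r : Fin (t + 1)} {inp : ℕ} (hinp : inp ≤ x.length + 1)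
    {i : ℕ} (hi : i ≤ S)
    (H : (core N t a₀ b₀ b).Ev x S (clean (.rewind d (pred r)) 0 l j out) m)
    (A : Finset N.WorkTape) (hA : ∀ τ ∉ A, V τ = (fun _ => none) ∧ wh τ = 0)
    (hA' : ∀ τ ∈ A, |wh τ| ≤ (S : ℤ) ∧
      Routine.Run S (some .toRight) (V τ) (wh τ) (some (fun _ => none, 0))) :
    (core N t a₀ b₀ b).Ev x S (conf (.clear d r A) inp wh i V l j out) m := by
  obtain ⟨n, hn⟩ : ∃ n, A.card = n := ⟨_, rfl⟩
  have hwh : ∀ τ, |wh τ| ≤ (S : ℤ) := fun τ => by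
    by_cases h : τ ∈ A
    · exact (hA' τ h).1
    · simp [(hA τ h).2]
  have hh := heads_le (i := i) hwh (by rw [abs_le]; omega)
  induction n generalizing A V wh with
  | zero =>
    rw [Finset.card_eq_zero] at hn
    subst hn
    obtain rfl : V = fun _ _ => none := funext fun τ => (hA τ (by simp)).1
    obtain rfl : wh = fun _ => 0 := funext fun τ => (hA τ (by simp)).2
    refine Core.ev_goto (d := 0) (q := (.rewind d (pred r), some (.home, .inr false))) hh ?_
      (inp' := inp) (by simpa using hinp) (Core.ev_call (Routine.run_home i hi) hh hinp ?_)
    · simp [core]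
    · rw [update_heads_false, Function.update_eq_self]
      exact ev_rewind hinp H
  | succ n ih =>
    have hne : A.Nonempty := by
      rw [← Finset.card_pos]
      omega
    have hmem := hne.choose_spec
    refine Core.ev_goto (d := 0)
      (q := (.clear d r (A.erase hne.choose), some (.toRight, .inl hne.choose))) hh ?_
      (inp' := inp) (by simpa using hinp) (Core.ev_call (τ := .inl hne.choose)
        (hA' _ hmem).2 hh hinp ?_)
    · simp [core, hne]
    · rw [update_heads_inl, update_tapes_inl]
      have h1 : ∀ τ ∉ A.erase hne.choose,
          Function.update V hne.choose (fun _ => none) τ = (fun _ => none) ∧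
            Function.update wh hne.choose 0 τ = 0 := by
        intro τ hτ
        by_cases h : τ = hne.choose
        · rw [h]
          simp
        · rw [Function.update_of_ne h, Function.update_of_ne h]
          exact hA τ fun h' => hτ (Finset.mem_erase.2 ⟨h, h'⟩)
      have h2 : ∀ τ, |Function.update wh hne.choose 0 τ| ≤ (S : ℤ) := by
        intro τ
        by_cases h : τ = hne.choose
        · rw [h]
          simp
        · rw [Function.update_of_ne h]
          exact hwh τ
      refine ih _ h1 ?_ (by rw [Finset.card_erase_of_mem hmem]; omega) h2
        (heads_le h2 (by rw [abs_le]; omega))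
      intro τ hτ
      have h := (Finset.mem_erase.1 hτ).1
      rw [Function.update_of_ne h, Function.update_of_ne h]
      exact hA' τ (Finset.mem_erase.1 hτ).2

/-- One run of `N` on the virtual input `(x, j, d)`. -/
theorem ev_sim {d : Option α} {r : Fin (t + 1)} {j : ℕ} (hj : 1 ≤ j) (hjS : j.bits.length ≤ S)
    (H : (core N t a₀ b₀ b).Ev x S (clean (.rewind d (pred r)) 0 l (binDigits b j) out) m)
    {P : N.Config → Prop} (hP : ∀ c, P c → (∀ τ, |c.workHead τ| < (S : ℤ)) ∧
      c.inputHead ≤ x.length + j.bits.length + 2)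
    {c : N.Config} {ms : Multiset (List Empty)} (hc : N.Eval (encodeTriple x j d) P c ms)
    (hV : ∀ τ, Vis N S (V τ) (c.work τ) (c.workHead τ)) :
    (core N t a₀ b₀ b).Ev x S (conf (.sim d r c.state (Virtual.flag x j c.inputHead))
      (Virtual.inpPos x c.inputHead) c.workHead (Virtual.idxPos x j c.inputHead) V l
      (binDigits b j) out) (Multiset.card ms • m) := by
  have hidx : ∀ v, Virtual.idxPos x j v ≤ S := fun v => (min_le_right _ _).trans hjS
  have hinp : ∀ v, Virtual.inpPos x v ≤ x.length + 1 := fun v => min_le_right _ _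
  -- In a represented configuration the core sees exactly what `N` would see on the encoded triple,
  -- so the choices coincide.
  have key : ∀ (c : N.Config) (V : N.WorkTape → ℤ → Cell N.Work b), P c →
      (∀ τ, Vis N S (V τ) (c.work τ) (c.workHead τ)) →
      (∀ τ, |heads c.workHead (Virtual.idxPos x j c.inputHead : ℕ) τ| ≤ (S : ℤ)) ∧
      N.delta c.state (Virtual.symbol d (inputCell x (Virtual.inpPos x c.inputHead))
        (Core.scan (heads c.workHead (Virtual.idxPos x j c.inputHead : ℕ))
          (tapes V l (binDigits b j)) (.inr false)).2 (Virtual.flag x j c.inputHead))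
        (fun i => N.letter (Core.scan (heads c.workHead (Virtual.idxPos x j c.inputHead : ℕ))
          (tapes V l (binDigits b j)) (.inl i)).2) = N.choices (encodeTriple x j d) c := by
    intro c V hc hV
    refine ⟨heads_le (fun τ => ((hP c hc).1 τ).le) (by rw [abs_le]; have := hidx c.inputHead; omega),
      ?_⟩
    unfold NTM.choices
    rw [← Virtual.symbol_eq (G := N.Work) (b := b) d (hP c hc).2]
    congr 1
    funext τ
    obtain ⟨_, _, -, -, -, -, -, -, -, -, h⟩ := hV τ
    exact h _
  induction hc generalizing V with
  | @halt c ms hc h0 hms =>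
    obtain ⟨hh, hδ⟩ := key c V hc hV
    rw [h0] at hδ
    by_cases hacc : c.state ∈ N.accept
    · rw [hms, if_pos hacc, Multiset.card_singleton, one_smul]
      -- The scanned cells are written even though `N` has halted; without this a freshly entered
      -- cell could be blank and interrupt the interval to be cleared.
      refine Core.ev_action (a := ⟨(.clear d r Finset.univ, none), 0,
        Sum.elim (fun i => some (.inl (N.letter (V i (c.workHead i)))))
          (fun i => (Core.scan (heads c.workHead (Virtual.idxPos x j c.inputHead : ℕ))
            (tapes V l (binDigits b j)) (.inr i)).2), 0, none⟩) hh ?_ ?_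
      · simp only [core]
        rw [if_pos hδ, if_pos hacc]
        rfl
      · refine Core.ev_congr (inp' := Virtual.inpPos x c.inputHead) (by simpa using hinp _)
          (by simp; rfl) (tapes_write _ _ _ _ _ _) (by simp) rfl
          (ev_clear (hinp _) (hidx _) H Finset.univ (by simp) ?_)
        exact fun τ _ => ⟨((hP c hc).1 τ).le, (hV τ).run _⟩
    · rw [hms, if_neg hacc, Multiset.card_zero, zero_smul]
      refine Core.ev_reject hh ?_ (by simp [core])
      simp only [core]
      rw [if_pos hδ, if_neg hacc]
  | @step c ms u hc hne hu hms ih =>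
    obtain ⟨hh, hδ⟩ := key c V hc hV
    -- Every accepting branch of `N` is continued by the same remaining computation, so `m` is
    -- repeated once per branch.
    rw [hms, Multiset.card_sum, Finset.sum_smul]
    refine Core.ev_choose (f := execEmb d r (Virtual.flag x j c.inputHead))
      (fun a => Multiset.card (u a) • m) hh (hinp _) ?_ hne ?_
    · simp only [core]
      rw [hδ, if_neg hne.ne_empty]
    · intro a ha
      set v := Virtual.move (inputCell x (Virtual.inpPos x c.inputHead))
        (decide ((Virtual.idxPos x j c.inputHead : ℤ) = 0),
          Routine.tapeOf N.Work (binDigits b j) (Virtual.idxPos x j c.inputHead))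
        (Virtual.flag x j c.inputHead) a.inputMove with hv
      obtain ⟨e1, e2, e3⟩ := Virtual.move_eq (hP c hc).2 hj a.inputMove
        (v' := (N.step (encodeTriple x j d) c a).inputHead)
        (by simp [NTM.step, Virtual.length_encodeTriple]) v hv
      refine Core.ev_action (a := ⟨(.sim d r a.next v.2.2, none), v.1,
        Sum.elim (fun i => some (.inl (a.write i)))
          (fun i => (Core.scan (heads c.workHead (Virtual.idxPos x j c.inputHead : ℕ))
            (tapes V l (binDigits b j)) (.inr i)).2),
        Sum.elim a.workMove (fun i => bif i then 0 else v.2.1), none⟩) hh rfl ?_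
      rw [e3]
      refine Core.ev_congr e1 ((heads_move _ _ _ _).trans (by rw [e2]; rfl)) (tapes_write _ _ _ _ _ _)
        (by simp) rfl (ih a ha fun τ => (hV τ).step _ _ ?_)
      exact (hP _ (hu a ha).prop).1 τ

/-- `r` runs of `N` on the virtual input `(x, j, d)`. -/
theorem ev_runs {d : Option α} {j : ℕ} (hj : 1 ≤ j) (hjS : j.bits.length ≤ S) (hS : 0 < S)
    (H : (core N t a₀ b₀ b).Ev x S (clean (.finish d) 0 l (binDigits b j) out) m)
    {P : N.Config → Prop} (hP : ∀ c, P c → (∀ τ, |c.workHead τ| < (S : ℤ)) ∧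
      c.inputHead ≤ x.length + j.bits.length + 2)
    {ms : Multiset (List Empty)} (hN : N.Eval (encodeTriple x j d) P N.start ms)
    (r : ℕ) (hr : r < t + 1) :
    (core N t a₀ b₀ b).Ev x S (clean (.rewind d ⟨r, hr⟩) 0 l (binDigits b j) out)
      (Multiset.card ms ^ r • m) := by
  induction r with
  | zero =>
    rw [pow_zero, one_smul]
    refine Core.ev_goto (d := 0) (q := (.finish d, none)) heads_zero_le ?_ (by simp) H
    simp [core, inputCell]
  | succ r ih =>
    rw [pow_succ', mul_smul]
    refine Core.ev_goto (d := 0) (q := (.sim d ⟨r + 1, hr⟩ N.startState false, none))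
      heads_zero_le ?_ (inp' := 0) (by simp) ?_
    · simp [core, inputCell]
    · have := ev_sim (r := ⟨r + 1, hr⟩) hj hjS (ih (by omega)) hP hN (fun τ => Vis.zero hS)
      have e1 : Virtual.flag x j 0 = false := by simp [Virtual.flag]
      have e2 : Virtual.inpPos x 0 = 0 := by simp [Virtual.inpPos]
      have e3 : Virtual.idxPos x j 0 = 0 := by simp [Virtual.idxPos]
      simp only [NTM.start, e1, e2, e3] at this
      exact this

end Eval

/-- The outputs that are produced from the position `j` on, when at most `F` symbols are guessed
and the symbol `d` at the position `j` is accepted with multiplicity `ψ j d`. -/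
def loopVal [Fintype α] (ψ : ℕ → Option α → ℕ) : ℕ → ℕ → List α → Multiset (List α)
  | 0, _, _ => 0
  | F + 1, j, out => ∑ d : Option α, ψ (j + 1) d •
    match d with
    | none => {out}
    | some c => loopVal ψ F (j + 1) (out ++ [c])

section Eval

variable [Fintype α] [Fintype N.WorkTape] [DecidableEq N.WorkTape] {x : List α} {S : ℕ}

/-- The clock `l` has value `F`, the number of symbols that may still be guessed. The invariant `j +
F ≤ J` keeps the index below `J`, whose length bounds the space for the index. -/
theorem ev_loop (hab : 0 < a₀ + b₀) {J : ℕ} (hJ : J.bits.length ≤ S) (hS : 0 < S)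
    (hN : ∀ j d, 1 ≤ j → j ≤ J → ∃ ms, N.Eval (encodeTriple x j d)
      (fun c => (∀ τ, |c.workHead τ| < (S : ℤ)) ∧ c.inputHead ≤ x.length + j.bits.length + 2)
      N.start ms)
    (F : ℕ) : ∀ (l : List (Fin (b + 2))) (j : ℕ) (out : List α), digitsVal l = F →
      l.length ≤ S → j + F ≤ J →
      (core N t a₀ b₀ b).Ev x S (clean .loop 0 l (binDigits b j) out)
        (loopVal (fun j d => a₀ + b₀ * N.numAccept (encodeTriple x j d) ^ t) F j out) := by
  induction F with
  | zero =>
    intro l j out hl hlS hjJ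
    -- With an expired clock the decrement is stuck in a state that does not accept, in agreement
    -- with the empty `loopVal`.
    obtain ⟨-, hd⟩ | ⟨l', -, h, -⟩ := decList_spec l
    · refine Core.ev_goto (d := 0) (q := (.index, some (.dec, .inr true))) heads_zero_le rfl
        (inp' := 0) (by simp) (Core.ev_call_stuck ?_ heads_zero_le (by simp))
      change Routine.Run S (some .dec) (Routine.tapeOf _ l) 0 _
      have := Routine.run_dec (G := N.Work) (S := S) l [] (by simpa using hlS)
      simpa [hd] using this
    · omega
  | succ F ih =>
    intro l j out hl hlS hjJ
    obtain ⟨h, -⟩ | ⟨l', hd, hl', hlen⟩ := decList_spec l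
    · omega
    have hbits : (j + 1).bits.length ≤ S := (length_bits_mono (by omega)).trans hJ
    have hbits' : j.bits.length ≤ S := (length_bits_mono (by omega)).trans hJ
    refine Core.ev_goto (d := 0) (q := (.index, some (.dec, .inr true))) heads_zero_le rfl
      (inp' := 0) (by simp) (Core.ev_call (T' := Routine.tapeOf _ l') (h' := 0) ?_
        heads_zero_le (by simp) ?_)
    · change Routine.Run S (some .dec) (Routine.tapeOf _ l) 0 _
      have := Routine.run_dec (G := N.Work) (S := S) l [] (by simpa using hlS)
      simpa [hd] using this
    rw [update_heads_true, update_tapes_true]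
    refine Core.ev_goto (d := 0) (q := (.guess, some (.inc, .inr false))) heads_zero_le rfl
      (inp' := 0) (by simp) (Core.ev_call (T' := Routine.tapeOf _ (binDigits b (j + 1))) (h' := 0) ?_
        heads_zero_le (by simp) ?_)
    · change Routine.Run S (some .inc) (Routine.tapeOf _ (binDigits b j)) 0 _
      have := Routine.run_inc (G := N.Work) (S := S) (binDigits b j) [] (by simpa using hbits')
      simpa [incList_binDigits] using this
    rw [update_heads_false, update_tapes_false]
    have hu : (Finset.univ : Finset (Option α × (Fin a₀ ⊕ Fin b₀))).Nonempty := by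
      rcases Nat.eq_zero_or_pos a₀ with h | h
      · exact ⟨(none, .inr ⟨0, by omega⟩), Finset.mem_univ _⟩
      · exact ⟨(none, .inl ⟨0, h⟩), Finset.mem_univ _⟩
    -- Each of the `a₀` ways to skip the check has weight 1, each of the `b₀` checks contributes the
    -- branches of `t` runs. Their sum is the weight of the symbol.
    have := Core.ev_choose (X := core N t a₀ b₀ b) (x := x) (S := S) (f := pickEmb)
      (k := .guess) (inp := 0) (h := heads (fun _ => 0) 0)
      (U := tapes (fun _ _ => none) l' (binDigits b (j + 1))) (out := out)
      (fun p => (match p.2 with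
        | .inl _ => 1
        | .inr _ => N.numAccept (encodeTriple x (j + 1) p.1) ^ t) •
        match p.1 with
        | none => {out}
        | some c => loopVal (fun j d => a₀ + b₀ * N.numAccept (encodeTriple x j d) ^ t) F (j + 1)
          (out ++ [c])) heads_zero_le (by simp) rfl hu ?_
    · convert this using 1
      rw [loopVal, Fintype.sum_prod_type]
      refine Finset.sum_congr rfl fun d _ => ?_
      simp [Fintype.sum_sum_type, add_smul, mul_smul]
    · rintro ⟨d, p⟩ -
      have hfin : (core N t a₀ b₀ b).Ev x S (clean (.finish d) 0 l' (binDigits b (j + 1)) out)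
          (match d with
          | none => {out}
          | some c => loopVal (fun j d => a₀ + b₀ * N.numAccept (encodeTriple x j d) ^ t) F (j + 1)
            (out ++ [c])) := by
        cases d with
        | none => exact Core.ev_accept heads_zero_le rfl rfl
        | some c =>
          refine Core.ev_action (a := ⟨(.loop, none), 0, fun i => (Core.scan _ _ i).2, 0, some c⟩)
            heads_zero_le rfl ?_
          refine Core.ev_congr (by simp) (by simp) ?_ rfl rfl
            (ih l' (j + 1) (out ++ [c]) (by omega) (by omega) (by omega))
          funext τ
          exact Function.update_eq_self _ _
      cases p with
      | inl p =>
        rw [one_smul]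
        exact Core.ev_goto (d := 0) (q := (.finish d, none)) heads_zero_le rfl (by simp) hfin
      | inr p =>
        obtain ⟨ms, hms⟩ := hN (j + 1) d (by omega) (by omega)
        rw [hms.numAccept_eq]
        exact Core.ev_goto (d := 0) (q := (.rewind d (Fin.last t), none)) heads_zero_le rfl
          (by simp) (ev_runs (by omega) hbits hS hfin (fun _ h => h) hms t (by omega))

/-- Each of the cells `0, …, |x| + 1`, both end markers included, causes one increment; hence the
final value `|x| + 2`. -/
theorem ev_count {m : Multiset (List α)} (hS : (x.length + 2).bits.length ≤ S)
    (H : (core N t a₀ b₀ b).Ev x S (clean .loop 0 (binDigits b (x.length + 2)) [] []) m)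
    (k i : ℕ) (hk : i + k = x.length + 1) :
    (core N t a₀ b₀ b).Ev x S (clean .count i (binDigits b i) [] []) m := by
  have hinc : ∀ i ≤ x.length + 1, Routine.Run S (some .inc)
      (Routine.tapeOf N.Work (binDigits b i)) 0
      (some (Routine.tapeOf N.Work (binDigits b (i + 1)), 0)) := by
    intro i hi
    have := Routine.run_inc (G := N.Work) (S := S) (binDigits b i) []
      (by simpa using (length_bits_mono (by omega)).trans hS)
    simpa [incList_binDigits] using this
  induction k generalizing i with
  | zero =>
    obtain rfl : i = x.length + 1 := by omega
    refine Core.ev_goto (d := 0) (q := (.toStart, some (.inc, .inr true))) heads_zero_le ?_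
      (inp' := x.length + 1) (by simp)
      (Core.ev_call (τ := .inr true) (hinc _ le_rfl) heads_zero_le le_rfl ?_)
    · rw [inputCell_of_lt x _ (by omega)]
      rfl
    · rw [update_heads_true, update_tapes_true]
      exact ev_toStart le_rfl H
  | succ k ih =>
    refine Core.ev_goto (d := 1) (q := (.count, some (.inc, .inr true))) heads_zero_le ?_
      (inp' := i + 1) (by simp; omega)
      (Core.ev_call (τ := .inr true) (hinc _ (by omega)) heads_zero_le (by omega) ?_)
    · have := inputCell_ne_rightEnd x (i := i) (by omega)
      simp only [core]
    · rw [update_heads_true, update_tapes_true]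
      exact ih (i + 1) (by omega)

theorem ev_all (hab : 0 < a₀ + b₀) (hS : (x.length + 2).bits.length ≤ S)
    (hJ : (digitsVal (binDigits b (x.length + 2))).bits.length ≤ S)
    (hN : ∀ j d, 1 ≤ j → j ≤ digitsVal (binDigits b (x.length + 2)) →
      ∃ ms, N.Eval (encodeTriple x j d)
        (fun c => (∀ τ, |c.workHead τ| < (S : ℤ)) ∧ c.inputHead ≤ x.length + j.bits.length + 2)
        N.start ms) :
    (core N t a₀ b₀ b).Ev x S (core N t a₀ b₀ b).toNTM.start
      (loopVal (fun j d => a₀ + b₀ * N.numAccept (encodeTriple x j d) ^ t)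
        (digitsVal (binDigits b (x.length + 2))) 0 []) := by
  have h0 : 0 < S := (bits_length_pos (by omega)).trans_le hS
  have := ev_count hS (ev_loop (b := b) (t := t) hab hJ h0 hN _ (binDigits b (x.length + 2)) 0 []
    rfl (by simpa using hS) (by omega)) (x.length + 1) 0 (by omega)
  refine Core.ev_start (Core.ev_congr rfl ?_ ?_ rfl rfl this)
  · funext c
    rcases c with c | _ | _ <;> rfl
  · funext c i
    rcases c with c | _ | _ <;> simp [tapes, Routine.tapeOf, binDigits_zero]

end Eval

end Symbolwise


/-! ### The machine that decides a single output symbol -/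

namespace OutputSymbol

/-! #### Parsing the end of a triple -/

section Parse

variable {α : Type}

/-- The number with the binary digits `l`, the least significant digit first. -/
def ofBits : List Bool → ℕ
  | [] => 0
  | d :: l => Nat.bit d (ofBits l)

theorem ofBits_bits (n : ℕ) : ofBits n.bits = n := by
  induction n using Nat.strong_induction_on with
  | _ n ih =>
    rcases eq_or_ne n 0 with rfl | hn
    · rfl
    · rw [bits_eq_cons hn, ofBits, ih _ (by omega), Nat.bit_val]
      rcases Nat.mod_two_eq_zero_or_one n with h | h <;> simp [h] <;> omega

theorem bits_ofBits {l : List Bool} (hl : l.getLast? = some true) :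
    (ofBits l).bits = l ∧ ofBits l ≠ 0 := by
  induction l with
  | nil => simp at hl
  | cons d l ih =>
    rcases eq_or_ne l [] with rfl | hne
    · simp only [List.getLast?_singleton, Option.some.injEq] at hl
      subst hl
      simp [ofBits]
    · have := ih (by rwa [List.getLast?_cons_of_ne_nil hne] at hl)
      refine ⟨?_, ?_⟩
      · rw [ofBits, Nat.bits_append_bit _ _ (fun h => absurd h this.2), this.1]
      · rw [ofBits, Nat.bit_val]
        omega

theorem getLast?_bits {n : ℕ} (hn : n ≠ 0) : n.bits.getLast? = some true := by
  induction n using Nat.strong_induction_on with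
  | _ n ih =>
    rw [bits_eq_cons hn]
    rcases eq_or_ne (n / 2) 0 with h | h
    · obtain rfl : n = 1 := by omega
      simp
    · rw [List.getLast?_cons_of_ne_nil]
      · exact ih _ (by omega) h
      · intro h'
        have := bits_length_pos h
        simp [h'] at this

theorem ofBits_lt (l : List Bool) : ofBits l < 2 ^ l.length := by
  induction l with
  | nil => simp [ofBits]
  | cons d l ih =>
    rw [ofBits, Nat.bit_val, List.length_cons, pow_succ]
    cases d <;> simp <;> omega

/-- The comparison of two binary numbers after one more digit, given the comparison of the lower
digits. -/
def ordStep (o : Ordering) (d e : Bool) : Ordering :=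
  match d, e with
  | false, true => .lt
  | true, false => .gt
  | _, _ => o

/-- A tie of the higher parts is decided by the lowest digit, and then by `o`. So two numbers can be
compared reading the least significant digit first, with a state in `Ordering`. -/
theorem compare_bit (k n : ℕ) (e : Bool) (o : Ordering) :
    (compare k (Nat.bit e n)).then o =
      (compare (k / 2) n).then (ordStep o (decide (k % 2 = 1)) e) := by
  rw [Nat.bit_val]
  rcases lt_trichotomy (k / 2) n with h | h | h
  · rw [compare_lt_iff_lt.2 h, compare_lt_iff_lt.2 (by omega)]
    rfl
  · rw [compare_eq_iff_eq.2 h]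
    rcases Nat.mod_two_eq_zero_or_one k with h' | h' <;> cases e
    · rw [compare_eq_iff_eq.2 (by simp; omega)]
      simp [h', ordStep]
    · rw [compare_lt_iff_lt.2 (by simp; omega)]
      simp [h', ordStep]
    · rw [compare_gt_iff_gt.2 (by simp; omega)]
      simp [h', ordStep]
    · rw [compare_eq_iff_eq.2 (by simp; omega)]
      simp [h', ordStep]
  · rw [compare_gt_iff_gt.2 h, compare_gt_iff_gt.2 (by cases e <;> simp <;> omega)]
    rfl

/-- The required comparison of the number of counted symbols with `j`. -/
def target (g : Option α) : Ordering := if g.isSome then .eq else .lt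

/-- The digit in a counter cell. -/
def digit {G : Type} : Cell G 0 → Bool
  | some (.inr d) => decide (d ≠ 0)
  | _ => false

/-- The final check: the remaining input `r` consists of digits and of a last symbol `g`, and the
comparison of the digits with those on the counter yields `target g`. Here `o` is the result for
the digits that have been read, and `last` is the last of them. -/
def Check (g : Option α) : Ordering → Option Bool → ℕ → List (TripleAlphabet α) → Prop
  | o, _, k, .inr (.inl e) :: r => Check g (ordStep o (decide (k % 2 = 1)) e) (some e) (k / 2) r
  | o, last, k, [.inr (.inr d)] => last = some true ∧ d = g ∧ k = 0 ∧ o = target g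
  | _, _, _, _ => False

theorem check_iff (g : Option α) (r : List (TripleAlphabet α)) (o : Ordering)
    (last : Option Bool) (k : ℕ) :
    Check g o last k r ↔ ∃ l : List Bool, r = l.map (fun d => .inr (.inl d)) ++ [.inr (.inr g)] ∧
      l.getLast?.or last = some true ∧ k < 2 ^ l.length ∧
      (compare k (ofBits l)).then o = target g := by
  induction r generalizing o last k with
  | nil => simp [Check]
  | cons a r ih =>
    rcases a with a | e | d
    · simp only [Check, false_iff, not_exists, not_and]
      rintro (_ | ⟨d, l⟩) h <;> simp at h
    · rw [Check, ih]
      constructor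
      · rintro ⟨l, rfl, h1, h2, h3⟩
        refine ⟨e :: l, rfl, ?_, ?_, ?_⟩
        · rcases eq_or_ne l [] with rfl | hne
          · simpa using h1
          · rw [List.getLast?_cons_of_ne_nil hne]
            rwa [Option.or_of_isSome (by simpa using hne)] at h1 ⊢
        · rw [List.length_cons, pow_succ]
          omega
        · rw [ofBits, compare_bit, h3]
      · rintro ⟨_ | ⟨e', l⟩, h, h1, h2, h3⟩
        · simp at h
        · simp only [List.map_cons, List.cons_append, List.cons.injEq, Sum.inr.injEq,
            Sum.inl.injEq] at h
          obtain ⟨rfl, rfl⟩ := h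
          refine ⟨l, rfl, ?_, ?_, ?_⟩
          · rcases eq_or_ne l [] with rfl | hne
            · simpa using h1
            · rw [List.getLast?_cons_of_ne_nil hne] at h1
              rwa [Option.or_of_isSome (by simpa using hne)] at h1 ⊢
          · rw [List.length_cons, pow_succ] at h2
            omega
          · rw [← h3, ofBits, compare_bit]
    · cases r with
      | nil =>
        rw [Check]
        constructor
        · rintro ⟨rfl, rfl, rfl, rfl⟩
          exact ⟨[], rfl, rfl, by simp, by simp [ofBits]⟩
        · rintro ⟨_ | ⟨e', l⟩, h, h1, h2, h3⟩
          · simp at h h1 h2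
            subst h h1 h2
            simpa [ofBits] using h3
          · simp at h
      | cons a r =>
        simp only [Check, false_iff, not_exists, not_and]
        rintro (_ | ⟨d, l⟩) h <;> simp at h

/-- The end of the triple `(x, j, d)`, after `x`. -/
def tripleEnd (j : ℕ) (d : Option α) : List (TripleAlphabet α) :=
  j.bits.map (fun d => .inr (.inl d)) ++ [.inr (.inr d)]

theorem encodeTriple_eq (x : List α) (j : ℕ) (d : Option α) :
    encodeTriple x j d = x.map Sum.inl ++ tripleEnd j d := by
  simp [encodeTriple, tripleEnd]

theorem tripleEnd_inj {j j' : ℕ} {d d' : Option α} (h : tripleEnd j d = tripleEnd j' d') :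
    j = j' ∧ d = d' := by
  have h1 := List.append_inj' h rfl
  have h2 : j.bits = j'.bits := by
    refine List.map_injective_iff.2 ?_ h1.1
    intro a a' h
    simpa using h
  refine ⟨?_, by simpa using h1.2⟩
  rw [← ofBits_bits j, h2, ofBits_bits]

/-- A last digit 1 makes a string of digits canonical and its value positive, so the syntax check
needs only a finite state. -/
theorem check_start_iff (g : Option α) (k : ℕ) (r : List (TripleAlphabet α)) :
    Check g .eq none k r ↔ ∃ j, 1 ≤ j ∧ r = tripleEnd j g ∧ compare k j = target g := by
  rw [check_iff]
  have hthen : ∀ o : Ordering, o.then .eq = o := by rintro (_ | _ | _) <;> rfl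
  constructor
  · rintro ⟨l, rfl, h1, h2, h3⟩
    rw [Option.or_none] at h1
    obtain ⟨h4, h5⟩ := bits_ofBits h1
    refine ⟨ofBits l, by omega, by rw [tripleEnd, h4], by rwa [hthen] at h3⟩
  · rintro ⟨j, hj, rfl, h⟩
    refine ⟨j.bits, rfl, ?_, ?_, ?_⟩
    · rw [getLast?_bits (by omega)]
      rfl
    -- `target` is never `.gt`, hence `k ≤ j` and `k` has no more digits than `j`.
    · refine lt_of_le_of_lt ?_ (ofBits_lt _)
      rw [ofBits_bits]
      by_contra hlt
      rw [compare_gt_iff_gt.2 (by omega)] at h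
      unfold target at h
      split_ifs at h
    · rw [ofBits_bits, hthen, h]

open Classical in
/-- The parts `j` and `d` of the end of a triple. -/
noncomputable def parse (r : List (TripleAlphabet α)) : Option (ℕ × Option α) :=
  if h : ∃ p : ℕ × Option α, 1 ≤ p.1 ∧ r = tripleEnd p.1 p.2 then some h.choose else none

theorem parse_eq_some {r : List (TripleAlphabet α)} {j : ℕ} {d : Option α} :
    parse r = some (j, d) ↔ 1 ≤ j ∧ r = tripleEnd j d := by
  unfold parse
  split_ifs with h
  · rw [Option.some_inj]
    have := h.choose_spec
    constructor
    · intro e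
      rwa [e] at this
    · rintro ⟨-, h2⟩
      have := tripleEnd_inj (this.2.symm.trans h2)
      exact Prod.ext this.1 this.2
  · simp only [false_iff]
    exact fun h' => h ⟨(j, d), h'⟩

open Classical in
/-- Whether the final check succeeds with the guess `g` and with `k` on the counter. -/
noncomputable def checkVal (r : List (TripleAlphabet α)) (g : Option α) (k : ℕ) : ℕ :=
  if Check g .eq none k r then 1 else 0

open Classical in
/-- Whether the output `y` agrees with the symbol asked for, at a position greater than `k`. -/
noncomputable def agree (r : List (TripleAlphabet α)) (k : ℕ) (y : List α) : ℕ :=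
  match parse r with
  | none => 0
  | some (j, none) => if y.length < j then 1 else 0
  | some (j, some c) => if k < j ∧ y[j - 1]? = some c then 1 else 0

/-- No guess has been made when the simulation ends. This amounts to the claim that the requested
symbol is `•`, which is right exactly when `j` exceeds the number of symbols written. -/
theorem checkVal_none (r : List (TripleAlphabet α)) (y : List α) :
    checkVal r none y.length = agree r y.length y := by
  unfold checkVal agree
  rw [check_start_iff]
  rcases h : parse r with _ | ⟨j, _ | c⟩
  · rw [if_neg]
    rintro ⟨j, h1, h2, -⟩
    rw [parse_eq_some.2 ⟨h1, h2⟩] at h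
    simp at h
  · obtain ⟨h1, rfl⟩ := parse_eq_some.1 h
    have hc : (∃ j', 1 ≤ j' ∧ tripleEnd j none = tripleEnd j' (none : Option α) ∧
        compare y.length j' = target (none : Option α)) ↔ y.length < j := by
      refine ⟨?_, fun h => ⟨j, h1, rfl, compare_lt_iff_lt.2 h⟩⟩
      rintro ⟨j', -, h2, h3⟩
      rw [(tripleEnd_inj h2).1]
      exact compare_lt_iff_lt.1 h3
    classical exact if_congr hc rfl rfl
  · obtain ⟨h1, rfl⟩ := parse_eq_some.1 h
    simp only
    rw [if_neg, if_neg]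
    · rintro ⟨h2, h3⟩
      rw [List.getElem?_eq_none (by omega)] at h3
      simp at h3
    · rintro ⟨j', -, h2, -⟩
      have := (tripleEnd_inj h2).2
      simp at this

/-- A requested position beyond the old output is either the one just filled with `c`, which a guess
made now certifies, or a later one. For `•` the position `k` plays no role and a guess fails the
check. -/
theorem agree_eq_add (r : List (TripleAlphabet α)) (o y : List α) (c : α) (hy : o ++ [c] <+: y) :
    agree r o.length y = agree r (o ++ [c]).length y + checkVal r (some c) (o ++ [c]).length := by
  obtain ⟨s, rfl⟩ := hy
  obtain ⟨n, hn⟩ : ∃ n, n = (o ++ [c]).length := ⟨_, rfl⟩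
  rw [← hn]
  rw [List.length_append, List.length_singleton] at hn
  unfold checkVal agree
  rw [check_start_iff]
  rcases h : parse r with _ | ⟨j, _ | c'⟩
  · simp only
    rw [if_neg]
    rintro ⟨j, h1, h2, -⟩
    rw [parse_eq_some.2 ⟨h1, h2⟩] at h
    simp at h
  · obtain ⟨h1, rfl⟩ := parse_eq_some.1 h
    simp only
    rw [if_neg (c := ∃ j', _), add_zero]
    rintro ⟨j', -, h2, -⟩
    have := (tripleEnd_inj h2).2
    simp at this
  · obtain ⟨h1, rfl⟩ := parse_eq_some.1 h
    have hc : (∃ j', 1 ≤ j' ∧ tripleEnd j (some c') = tripleEnd j' (some c) ∧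
        compare n j' = target (some c)) ↔ n = j ∧ c' = c := by
      constructor
      · rintro ⟨j', -, h2, h3⟩
        have := tripleEnd_inj h2
        rw [this.1]
        exact ⟨compare_eq_iff_eq.1 h3, by simpa using this.2⟩
      · rintro ⟨rfl, rfl⟩
        exact ⟨_, h1, rfl, compare_eq_iff_eq.2 rfl⟩
    simp only
    rw [@if_congr ℕ _ _ (Classical.propDecidable _) (Classical.propDecidable _) 1 0 1 0 hc rfl rfl]
    rcases lt_trichotomy n j with h | h | h
    · rw [if_neg (c := n = j ∧ c' = c) fun h' => h.ne h'.1, add_zero]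
      by_cases h' : (o ++ [c] ++ s)[j - 1]? = some c'
      · rw [if_pos ⟨by omega, h'⟩, if_pos ⟨h, h'⟩]
      · rw [if_neg fun h'' => h' h''.2, if_neg fun h'' => h' h''.2]
    · subst h
      rw [if_neg (c := n < n ∧ _) fun h' => lt_irrefl _ h'.1, zero_add]
      have : (o ++ [c] ++ s)[n - 1]? = some c := by simp [hn]
      rw [this]
      by_cases h' : c' = c
      · rw [if_pos ⟨by omega, by rw [h']⟩, if_pos ⟨rfl, h'⟩]
      · rw [if_neg fun h'' => h' (Option.some_inj.1 h''.2).symm, if_neg fun h'' => h' h''.2]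
    · rw [if_neg (by omega), if_neg (by omega), if_neg (by omega)]

end Parse

/-! ### Simulation with a guessed output position -/

variable {α : Type}

/-- The states of the machine that simulates `M` on the letters at the beginning of the input,
guesses at some point that the symbol asked for is appended to the output, and then checks the
guess. -/
inductive State (M : NTM α α) (a₀ b₀ : ℕ) : Type where
  | init
  | pick (m : Fin a₀ ⊕ Fin b₀)
  | sim (q : M.State) (g : Option α)
  | exec (a : M.Action) (g : Option α)
  | post (q : M.State) (o g : Option α)
  | skip (g : Option α)
  | cmp (g : Option α) (o : Ordering) (last : Option Bool)
  | fin
  | acc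

variable (M : NTM α α) (a₀ b₀ : ℕ)

instance [Finite α] : Finite (State M a₀ b₀) := by
  have : Finite M.Action := TMAction.finite
  have : Finite Ordering := Finite.of_surjective (α := Fin 3) ![.lt, .eq, .gt] (by
    rintro (_ | _ | _)
    exacts [⟨0, rfl⟩, ⟨1, rfl⟩, ⟨2, rfl⟩])
  refine Finite.of_surjective (α := Fin 3 ⊕ (Fin a₀ ⊕ Fin b₀) ⊕ (M.State × Option α) ⊕
    (M.Action × Option α) ⊕ (M.State × Option α × Option α) ⊕ Option α ⊕
    (Option α × Ordering × Option Bool)) (fun s => match s with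
    | .inl i => ![.init, .fin, .acc] i
    | .inr (.inl m) => .pick m
    | .inr (.inr (.inl (q, g))) => .sim q g
    | .inr (.inr (.inr (.inl (a, g)))) => .exec a g
    | .inr (.inr (.inr (.inr (.inl (q, o, g))))) => .post q o g
    | .inr (.inr (.inr (.inr (.inr (.inl g))))) => .skip g
    | .inr (.inr (.inr (.inr (.inr (.inr (g, o, l)))))) => .cmp g o l) ?_
  rintro (_ | m | ⟨q, g⟩ | ⟨a, g⟩ | ⟨q, o, g⟩ | g | ⟨g, o, l⟩ | _ | _)
  · exact ⟨.inl 0, rfl⟩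
  · exact ⟨.inr (.inl m), rfl⟩
  · exact ⟨.inr (.inr (.inl (q, g))), rfl⟩
  · exact ⟨.inr (.inr (.inr (.inl (a, g)))), rfl⟩
  · exact ⟨.inr (.inr (.inr (.inr (.inl (q, o, g))))), rfl⟩
  · exact ⟨.inr (.inr (.inr (.inr (.inr (.inl g))))), rfl⟩
  · exact ⟨.inr (.inr (.inr (.inr (.inr (.inr (g, o, l)))))), rfl⟩
  · exact ⟨.inl 1, rfl⟩
  · exact ⟨.inl 2, rfl⟩

/-- The symbol that the simulated machine sees. -/
def symbol : InputSymbol (TripleAlphabet α) → InputSymbol α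
  | .leftEnd => .leftEnd
  | .letter (.inl a) => .letter a
  | _ => .rightEnd

/-- The move of the input head in the simulation. -/
def move (s : InputSymbol (TripleAlphabet α)) (d : SignType) : SignType :=
  match symbol s with
  | .rightEnd => if d = 1 then 0 else d
  | _ => d

/-- The work tapes: those of `M`, and a counter. -/
abbrev Tape (M : NTM α α) : Type := M.WorkTape ⊕ Unit

variable {M a₀ b₀}

/-- The choice of an instruction of `M`. -/
def execEmb (g : Option α) : M.Action ↪ State M a₀ b₀ × Option (Routine × Tape M) :=
  ⟨fun a => (.exec a g, none), fun a a' h => by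
    simp only [Prod.mk.injEq, State.exec.injEq] at h
    exact h.1.1⟩

/-- The choice of one of `a₀ + b₀` ways to start. -/
def pickEmb : Fin a₀ ⊕ Fin b₀ ↪ State M a₀ b₀ × Option (Routine × Tape M) :=
  ⟨fun p => (.pick p, none), fun p p' h => by
    simp only [Prod.mk.injEq, State.pick.injEq] at h
    exact h.1⟩

/-- The guess whether the symbol `c` that has just been output is the one asked for. -/
def postEmb (q : M.State) (c : α) : Bool ↪ State M a₀ b₀ × Option (Routine × Tape M) :=
  ⟨fun i => (.sim q (bif i then some c else none), some (.inc, .inr ())), fun i i' h => by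
    simp only [Prod.mk.injEq, State.sim.injEq] at h
    cases i <;> cases i' <;> simp at h ⊢⟩

variable (M a₀ b₀)

open Core Classical in
/-- The machine: accept at once (in `a₀` ways) or (in `b₀` ways) simulate `M`, count the symbols
that are output up to a guessed one, and check the guess. -/
noncomputable def core [DecidableEq M.WorkTape] :
    Core (State M a₀ b₀) (Tape M) M.Work 0 (TripleAlphabet α) Empty where
  start := .init
  accept := {.acc}
  delta k s w :=
    match k with
    | .init => choose w pickEmb Finset.univ
    | .pick m =>
      match m with
      | .inl _ => {goto w 0 (.acc, none)}
      | .inr _ => {goto w 0 (.sim M.startState none, none)}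
    | .sim q g =>
      let s' := M.delta q (symbol s) fun i => M.letter (w (.inl i)).2
      if s' = ∅ then if q ∈ M.accept then {goto w 0 (.skip g, none)} else ∅
      else choose w (execEmb g) s'
    | .exec a g =>
      {⟨(.post a.next a.emit g, none), move s a.inputMove,
        Sum.elim (fun i => some (.inl (a.write i))) (fun i => (w (.inr i)).2),
        Sum.elim a.workMove (fun _ => 0), none⟩}
    | .post q o g =>
      match o, g with
      | some c, none => choose w (postEmb q c) Finset.univ
      | _, _ => {goto w 0 (.sim q g, none)}
    | .skip g =>
      match s with
      | .leftEnd => {goto w 1 (.skip g, none)}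
      | .letter (.inl _) => {goto w 1 (.skip g, none)}
      | _ => {goto w 0 (.cmp g .eq none, none)}
    | .cmp g o last =>
      match s with
      | .letter (.inr (.inl e)) =>
        {⟨(.cmp g (ordStep o (digit (w (.inr ())).2) e) (some e), none), 1, fun i => (w i).2,
          Sum.elim 0 (fun _ => if (w (.inr ())).2 = none then 0 else 1), none⟩}
      | .letter (.inr (.inr d)) =>
        if last = some true ∧ d = g ∧ (w (.inr ())).2 = none ∧ o = target g then
          {goto w 1 (.fin, none)}
        else ∅
      | _ => ∅
    | .fin =>
      match s with
      | .rightEnd => {goto w 0 (.acc, none)}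
      | _ => ∅
    | .acc => ∅

variable {M a₀ b₀}

/-- The head positions: those of `M`, and `i` on the counter. -/
def heads (wh : M.WorkTape → ℤ) (i : ℤ) : Tape M → ℤ := Sum.elim wh fun _ => i

/-- The tapes: those of `M`, and `k` on the counter. -/
def tapes (V : M.WorkTape → ℤ → Cell M.Work 0) (k : ℕ) : Tape M → ℤ → Cell M.Work 0 :=
  Sum.elim V fun _ => Routine.tapeOf _ (binDigits 0 k)

theorem heads_le {S : ℕ} {wh : M.WorkTape → ℤ} {i : ℤ} (h : ∀ τ, |wh τ| ≤ (S : ℤ))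
    (hi : |i| ≤ (S : ℤ)) : ∀ τ, |heads wh i τ| ≤ (S : ℤ)
  | .inl τ => h τ
  | .inr () => hi

theorem heads_move (wh : M.WorkTape → ℤ) (i : ℤ) (d : M.WorkTape → SignType) (e : SignType) :
    (fun τ => heads wh i τ + ((Sum.elim d (fun _ => e) τ : SignType) : ℤ)) =
      heads (fun τ => wh τ + (d τ : ℤ)) (i + (e : ℤ)) := by
  funext c
  rcases c with c | _ <;> simp [heads]

theorem tapes_write (wh : M.WorkTape → ℤ) (i : ℤ) (V : M.WorkTape → ℤ → Cell M.Work 0) (k : ℕ)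
    (g : M.WorkTape → Cell M.Work 0) :
    (fun τ => Function.update (tapes V k τ) (heads wh i τ)
      (Sum.elim g (fun c => (Core.scan (heads wh i) (tapes V k) (.inr c)).2) τ)) =
      tapes (fun τ => Function.update (V τ) (wh τ) (g τ)) k := by
  funext c
  rcases c with c | _
  · rfl
  · exact Function.update_eq_self _ _

theorem tapes_keep (wh : M.WorkTape → ℤ) (i : ℤ) (V : M.WorkTape → ℤ → Cell M.Work 0) (k : ℕ) :
    (fun τ => Function.update (tapes V k τ) (heads wh i τ)
      (Core.scan (heads wh i) (tapes V k) τ).2) = tapes V k :=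
  funext fun _ => Function.update_eq_self _ _

theorem inputCell_of_drop_nil {β : Type} {z : List β} {p : ℕ} (h : z.drop p = []) :
    inputCell z (p + 1) = .rightEnd :=
  inputCell_of_lt z _ (by rw [List.drop_eq_nil_iff] at h; omega)

theorem lt_length_of_drop_cons {β : Type} {z r : List β} {a : β} {p : ℕ}
    (h : z.drop p = a :: r) : p < z.length := by
  by_contra hp
  rw [List.drop_eq_nil_of_le (by omega)] at h
  simp at h

theorem drop_succ_of_drop_cons {β : Type} {z r : List β} {a : β} {p : ℕ}
    (h : z.drop p = a :: r) : z.drop (p + 1) = r := by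
  rw [List.drop_eq_getElem_cons (lt_length_of_drop_cons h)] at h
  exact (List.cons.inj h).2

theorem inputCell_of_drop_cons {β : Type} {z r : List β} {a : β} {p : ℕ}
    (h : z.drop p = a :: r) : inputCell z (p + 1) = .letter a := by
  have hp := lt_length_of_drop_cons h
  rw [List.drop_eq_getElem_cons hp] at h
  rw [inputCell_succ z p hp, (List.cons.inj h).1]

/-- Binary digits have no leading zeros, so a blank in cell `i` means that nothing of `k` is left
after `i` halvings. -/
theorem digit_tapeOf {G : Type} (k i : ℕ) (c : Cell G 0)
    (hc : c = Routine.tapeOf G (binDigits 0 k) i) :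
    digit c = decide ((k / 2 ^ i) % 2 = 1) ∧ (c = none ↔ k / 2 ^ i = 0) ∧
      (c ≠ none → i < k.bits.length) := by
  rw [Routine.tapeOf_natCast] at hc
  subst hc
  refine ⟨?_, ?_, fun h => by simpa using h⟩
  · induction i generalizing k with
    | zero =>
      rcases eq_or_ne k 0 with rfl | hk
      · simp [binDigits, digit]
      · rw [binDigits, bits_eq_cons hk]
        rcases Nat.mod_two_eq_zero_or_one k with h | h <;> simp [h, digit]
    | succ i ih =>
      rcases eq_or_ne k 0 with rfl | hk
      · simp [binDigits, digit]
      · have := ih (k / 2)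
        rw [binDigits, bits_eq_cons hk]
        rwa [binDigits, Nat.div_div_eq_div_mul, ← pow_succ'] at this
  · rw [Option.map_eq_none_iff, List.getElem?_eq_none_iff, length_binDigits, Nat.size_eq_bits_len,
      Nat.size_le, Nat.div_eq_zero_iff]
    simp

section Split

/-- The input without the letters at its beginning. -/
def TripleSplit (z : List (TripleAlphabet α)) (x : List α) (r : List (TripleAlphabet α)) : Prop :=
  z = x.map Sum.inl ++ r ∧ ∀ a, r.head? ≠ some (Sum.inl a)

variable {z : List (TripleAlphabet α)} {x : List α} {r : List (TripleAlphabet α)}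

theorem TripleSplit.drop (hz : TripleSplit z x r) : z.drop x.length = r := by
  rw [hz.1, List.drop_append_of_le_length (by simp)]
  simp

theorem TripleSplit.inputCell (hz : TripleSplit z x r) {i : ℕ} (hi : i < x.length) :
    inputCell z (i + 1) = .letter (.inl x[i]) := by
  rw [hz.1]
  simp [_root_.inputCell, List.getElem?_append_left, hi]

theorem TripleSplit.symbol_end (hz : TripleSplit z x r) :
    symbol (_root_.inputCell z (x.length + 1)) = .rightEnd := by
  have h := hz.drop
  have h' := hz.2
  cases r with
  | nil => rw [inputCell_of_drop_nil h]; rfl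
  | cons a r =>
    rw [inputCell_of_drop_cons h]
    rcases a with a | a
    · exact absurd rfl (h' a)
    · rfl

theorem TripleSplit.symbol_eq (hz : TripleSplit z x r) {i : ℕ} (hi : i ≤ x.length + 1) :
    symbol (_root_.inputCell z i) = _root_.inputCell x i := by
  rcases Nat.eq_or_lt_of_le hi with rfl | hi
  · rw [hz.symbol_end, inputCell_of_lt x _ (by omega)]
  cases i with
  | zero => rfl
  | succ i =>
    rw [hz.inputCell (by omega), inputCell_succ x i (by omega)]
    rfl

theorem TripleSplit.length_le (hz : TripleSplit z x r) : x.length ≤ z.length := by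
  rw [hz.1]
  simp

/-- Right of `x` the real tape continues where the simulated machine sees its end marker; a right
move must be suppressed there. Nothing is assumed about `r` except that it does not begin with a
letter of `x`, so malformed inputs are covered. -/
theorem TripleSplit.move_eq (hz : TripleSplit z x r) {i : ℕ} (hi : i ≤ x.length + 1)
    (d : SignType) :
    min (z.length + 1) ((i : ℤ) + (move (_root_.inputCell z i) d : ℤ)).toNat =
      min (x.length + 1) ((i : ℤ) + (d : ℤ)).toNat := by
  have hl := hz.length_le
  unfold move
  rw [hz.symbol_eq hi]
  rcases Nat.eq_or_lt_of_le hi with rfl | hi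
  · rw [inputCell_of_lt x _ (by omega)]
    rcases d with _ | _ | _ <;> simp <;> omega
  · have := inputCell_ne_rightEnd x (i := i) (by omega)
    have h : (match _root_.inputCell x i with
      | .rightEnd => if d = 1 then 0 else d
      | _ => d) = d := by
      split
      · contradiction
      · rfl
    rw [h]
    rcases d with _ | _ | _ <;> simp <;> omega

theorem step_tapes {V : M.WorkTape → ℤ → Cell M.Work 0} {c : M.Config}
    (hV : ∀ τ i, M.letter (V τ i) = c.work τ i) (a : M.Action) (τ : M.WorkTape) (i : ℤ) :
    M.letter (Function.update (V τ) (c.workHead τ) (some (.inl (a.write τ))) i) =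
      (M.step x c a).work τ i := by
  simp only [NTM.step]
  by_cases hi : i = c.workHead τ
  · subst hi
    simp [NTM.letter]
  · rw [Function.update_of_ne hi, Function.update_of_ne hi, hV]

end Split

/-! ### Branch counts of the output-symbol machine -/

section Eval

variable [Fintype α] [DecidableEq M.WorkTape] {z : List (TripleAlphabet α)} {S : ℕ}
  {V : M.WorkTape → ℤ → Cell M.Work 0} {wh : M.WorkTape → ℤ}

/-- The configurations of the machine. -/
noncomputable abbrev conf (q : State M a₀ b₀) (inp : ℕ) (wh : M.WorkTape → ℤ) (i : ℤ)
    (V : M.WorkTape → ℤ → Cell M.Work 0) (k : ℕ) :=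
  (core M a₀ b₀).cfg (q, none) inp (heads wh i) (tapes V k) []

open Classical in
theorem ev_cmp (hwh : ∀ τ, |wh τ| ≤ (S : ℤ)) {k : ℕ} (hk : k.bits.length ≤ S) (g : Option α)
    (r : List (TripleAlphabet α)) (p i : ℕ) (hi : i ≤ S) (hr : z.drop p = r) (o : Ordering)
    (last : Option Bool) (k' : ℕ) (hk' : k' = k / 2 ^ i) :
    (core M a₀ b₀).Ev z S (conf (.cmp g o last) (p + 1) wh i V k)
      ((if Check g o last k' r then 1 else 0) • {[]}) := by
  induction r generalizing p i o last k' with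
  | nil =>
    rw [if_neg (by simp [Check]), zero_smul]
    refine Core.ev_reject (heads_le hwh (by rw [abs_le]; omega)) ?_ (by simp [core])
    rw [inputCell_of_drop_nil hr]
    rfl
  | cons a r ih =>
    have hh := heads_le (i := i) hwh (by rw [abs_le]; omega)
    have hp := lt_length_of_drop_cons hr
    have hs := inputCell_of_drop_cons hr
    obtain ⟨h1, h2, h3⟩ := digit_tapeOf (G := M.Work) k i _ rfl
    rcases a with a | e | d
    · rw [if_neg (by simp [Check]), zero_smul]
      refine Core.ev_reject hh ?_ (by simp [core])
      rw [hs]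
      rfl
    · obtain ⟨i', hi', hi'', hk''⟩ : ∃ i' : ℕ, (i : ℤ) +
          ((if Routine.tapeOf M.Work (binDigits 0 k) i = none then 0 else 1 : SignType) : ℤ) = i' ∧
          i' ≤ S ∧ k' / 2 = k / 2 ^ i' := by
        -- Beyond the last digit of the counter the rest of `k` is zero and stays zero under
        -- halving, so the head can remain on the blank.
        split_ifs with h
        · refine ⟨i, by simp, hi, ?_⟩
          rw [hk', h2.1 h]
        · refine ⟨i + 1, by simp, (h3 h).trans_le hk, ?_⟩
          rw [hk', pow_succ, Nat.div_div_eq_div_mul]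
      rw [Check]
      refine Core.ev_action (a := ⟨(.cmp g (ordStep o (decide (k' % 2 = 1)) e) (some e), none), 1,
        fun τ => (Core.scan (heads wh i) (tapes V k) τ).2, Sum.elim 0 (fun _ =>
          if Routine.tapeOf M.Work (binDigits 0 k) i = none then 0 else 1), none⟩) hh ?_ ?_
      · rw [hs, hk', ← h1]
        rfl
      · refine Core.ev_congr (inp' := p + 1 + 1) (by simp; omega)
          ((heads_move _ _ _ _).trans (by rw [hi']; simp)) (tapes_keep _ _ _ _) (by simp) rfl
          (ih (p + 1) i' hi'' (drop_succ_of_drop_cons hr) _ _ (k' / 2) hk'')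
    · by_cases hc : last = some true ∧ d = g ∧ k' = 0 ∧ o = target g
      · have hδ : (core M a₀ b₀).delta (.cmp g o last) (inputCell z (p + 1))
            (Core.scan (heads wh i) (tapes V k)) =
            {Core.goto (Core.scan (heads wh i) (tapes V k)) 1 (.fin, none)} := by
          rw [hs]
          exact if_pos ⟨hc.1, hc.2.1, h2.2 (hk' ▸ hc.2.2.1), hc.2.2.2⟩
        refine Core.ev_goto (inp' := p + 1 + 1) hh hδ (by simp; omega) ?_
        have hr' := drop_succ_of_drop_cons hr
        cases r with
        | nil =>
          rw [if_pos (by simpa [Check] using hc), one_smul]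
          refine Core.ev_goto (d := 0) (q := (.acc, none)) (inp' := p + 1 + 1) hh ?_
            (by simp; omega) (Core.ev_accept hh rfl rfl)
          rw [inputCell_of_drop_nil hr']
          rfl
        | cons a r =>
          rw [if_neg (by simp [Check]), zero_smul]
          refine Core.ev_reject hh ?_ (by simp [core])
          rw [inputCell_of_drop_cons hr']
          rfl
      · have hδ : (core M a₀ b₀).delta (.cmp g o last) (inputCell z (p + 1))
            (Core.scan (heads wh i) (tapes V k)) = ∅ := by
          rw [hs]
          exact if_neg fun h => hc ⟨h.1, h.2.1, hk'.trans (h2.1 h.2.2.1), h.2.2.2⟩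
        rw [if_neg, zero_smul]
        · exact Core.ev_reject hh hδ (by simp [core])
        · cases r with
          | nil => simpa [Check] using hc
          | cons a r => simp [Check]

variable {x : List α} {r : List (TripleAlphabet α)}

open Classical in
theorem ev_skip (hz : TripleSplit z x r) (hwh : ∀ τ, |wh τ| ≤ (S : ℤ)) {k : ℕ}
    (hk : k.bits.length ≤ S) (g : Option α) (n i : ℕ) (hi : i + n = x.length + 1) :
    (core M a₀ b₀).Ev z S (conf (.skip g) i wh 0 V k) (checkVal r g k • {[]}) := by
  have hh := heads_le (i := 0) hwh (by simp)
  have hl := hz.length_le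
  induction n generalizing i with
  | zero =>
    obtain rfl : i = x.length + 1 := by omega
    refine Core.ev_goto (d := 0) (q := (.cmp g .eq none, none)) hh ?_ (by simp; omega)
      (ev_cmp hwh hk g r x.length 0 (by omega) hz.drop _ _ k (by simp))
    have h := hz.drop
    have h' := hz.2
    cases r with
    | nil => rw [inputCell_of_drop_nil h]; rfl
    | cons a r =>
      rw [inputCell_of_drop_cons h]
      rcases a with a | a
      · exact absurd rfl (h' a)
      · rfl
  | succ n ih =>
    refine Core.ev_goto (d := 1) (q := (.skip g, none)) (inp' := i + 1) hh ?_ (by simp; omega)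
      (ih (i + 1) (by omega))
    cases i with
    | zero => rfl
    | succ i =>
      rw [hz.inputCell (by omega)]
      rfl

/-- The simulation of a step of `M`. -/
theorem ev_step (hz : TripleSplit z x r) {g : Option α} {k : ℕ}
    {c : M.Config} (hwh : ∀ τ, |c.workHead τ| ≤ (S : ℤ)) (hc : c.inputHead ≤ x.length + 1)
    (hV : ∀ τ i, M.letter (V τ i) = c.work τ i) (hne : (M.choices x c).Nonempty)
    (u : M.Action → Multiset (List Empty))
    (H : ∀ a ∈ M.choices x c, (core M a₀ b₀).Ev z S (conf (.post a.next a.emit g)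
      (M.step x c a).inputHead (M.step x c a).workHead 0
      (fun τ => Function.update (V τ) (c.workHead τ) (some (.inl (a.write τ)))) k) (u a)) :
    (core M a₀ b₀).Ev z S (conf (.sim c.state g) c.inputHead c.workHead 0 V k)
      (∑ a ∈ M.choices x c, u a) := by
  have hh := heads_le (i := 0) hwh (by simp)
  have hl := hz.length_le
  have hδ : (M.delta c.state (symbol (_root_.inputCell z c.inputHead)) fun i =>
      M.letter (Core.scan (heads c.workHead 0) (tapes V k) (.inl i)).2) = M.choices x c := by
    unfold NTM.choices
    rw [hz.symbol_eq hc]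
    congr 1
    funext τ
    exact hV _ _
  refine Core.ev_choose (f := execEmb g) u hh (by omega) ?_ hne fun a ha => ?_
  · simp only [core]
    rw [hδ, if_neg hne.ne_empty]
  · refine Core.ev_action (a := ⟨(.post a.next a.emit g, none),
        move (_root_.inputCell z c.inputHead) a.inputMove,
        Sum.elim (fun i => some (.inl (a.write i)))
          (fun i => (Core.scan (heads c.workHead 0) (tapes V k) (.inr i)).2),
        Sum.elim a.workMove (fun _ => 0), none⟩) hh rfl ?_
    exact Core.ev_congr (hz.move_eq hc _) ((heads_move _ _ _ _).trans (by simp; rfl))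
      (tapes_write _ _ _ _ _) (by simp) rfl (H a ha)

theorem ev_halted (hz : TripleSplit z x r) {g : Option α} {k : ℕ} (hk : k.bits.length ≤ S)
    {c : M.Config} (hwh : ∀ τ, |c.workHead τ| ≤ (S : ℤ)) (hc : c.inputHead ≤ x.length + 1)
    (hV : ∀ τ i, M.letter (V τ i) = c.work τ i) (h0 : M.choices x c = ∅)
    [Decidable (c.state ∈ M.accept)] :
    (core M a₀ b₀).Ev z S (conf (.sim c.state g) c.inputHead c.workHead 0 V k)
      ((if c.state ∈ M.accept then checkVal r g k else 0) • {[]}) := by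
  have hh := heads_le (i := 0) hwh (by simp)
  have hl := hz.length_le
  have hδ : (M.delta c.state (symbol (_root_.inputCell z c.inputHead)) fun i =>
      M.letter (Core.scan (heads c.workHead 0) (tapes V k) (.inl i)).2) = ∅ := by
    rw [← h0]
    unfold NTM.choices
    rw [hz.symbol_eq hc]
    congr 1
    funext τ
    exact hV _ _
  by_cases hacc : c.state ∈ M.accept
  · rw [if_pos hacc]
    refine Core.ev_goto (d := 0) (q := (.skip g, none)) (inp' := c.inputHead) hh ?_
      (by simp; omega) (ev_skip hz hwh hk g (x.length + 1 - c.inputHead) _ (by omega))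
    simp only [core]
    rw [if_pos hδ, if_pos hacc]
  · rw [if_neg hacc, zero_smul]
    refine Core.ev_reject hh ?_ (by simp [core])
    simp only [core]
    rw [if_pos hδ, if_neg hacc]

variable {T : ℕ} {P : M.Config → Prop}

/-- After the guess the counter is frozen, so every accepting branch of `M` meets the same final
check. -/
theorem ev_sim_some (hz : TripleSplit z x r)
    (hP : ∀ c, P c → (∀ τ, |c.workHead τ| ≤ (S : ℤ)) ∧ c.inputHead ≤ x.length + 1)
    {k : ℕ} (hk : k.bits.length ≤ S) (g : α)
    {c : M.Config} {ms : Multiset (List α)} (hc : M.Eval x P c ms)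
    (hV : ∀ τ i, M.letter (V τ i) = c.work τ i) :
    (core M a₀ b₀).Ev z S (conf (.sim c.state (some g)) c.inputHead c.workHead 0 V k)
      ((Multiset.card ms * checkVal r (some g) k) • {[]}) := by
  induction hc generalizing V with
  | @halt c ms hc h0 hms =>
    classical
    have := ev_halted (a₀ := a₀) (b₀ := b₀) (g := some g) hz hk (hP c hc).1 (hP c hc).2 hV h0
    convert this using 2
    rw [hms]
    split_ifs <;> simp
  | @step c ms u hc hne hu hms ih =>
    rw [hms, Multiset.card_sum, Finset.sum_mul, Finset.sum_smul]
    refine ev_step hz (hP c hc).1 (hP c hc).2 hV hne _ fun a ha => ?_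
    have hP' := hP _ (hu a ha).prop
    have hl := hz.length_le
    refine Core.ev_goto (d := 0) (q := (.sim a.next (some g), none))
      (heads_le hP'.1 (by simp)) ?_ (by simp; omega)
      (ih a ha (step_tapes hV a))
    cases a.emit <;> rfl

/-- Before the guess the counter equals the length of the output. By `agree_eq_add`, guessing now or
continuing splits the agreeing positions after that length without overlap. -/
theorem ev_sim_none (hz : TripleSplit z x r) (hT : T.bits.length ≤ S)
    (hP : ∀ c, P c → (∀ τ, |c.workHead τ| ≤ (S : ℤ)) ∧ c.inputHead ≤ x.length + 1 ∧
      c.output.length ≤ T)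
    {c : M.Config} {ms : Multiset (List α)} (hc : M.Eval x P c ms)
    (hV : ∀ τ i, M.letter (V τ i) = c.work τ i) :
    (core M a₀ b₀).Ev z S (conf (.sim c.state none) c.inputHead c.workHead 0 V c.output.length)
      ((ms.map (agree r c.output.length)).sum • {[]}) := by
  have hbits : ∀ n ≤ T, n.bits.length ≤ S := fun n hn => (length_bits_mono hn).trans hT
  induction hc generalizing V with
  | @halt c ms hc h0 hms =>
    classical
    have := ev_halted (a₀ := a₀) (b₀ := b₀) (g := none) hz (hbits _ (hP c hc).2.2) (hP c hc).1
      (hP c hc).2.1 hV h0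
    convert this using 2
    rw [hms, checkVal_none]
    split_ifs <;> simp
  | @step c ms u hc hne hu hms ih =>
    have hms' : (ms.map (agree r c.output.length)).sum =
        ∑ a ∈ M.choices x c, ((u a).map (agree r c.output.length)).sum := by
      rw [hms, ← Multiset.coe_mapAddMonoidHom, map_sum, ← Multiset.coe_sumAddMonoidHom, map_sum]
    rw [hms', Finset.sum_smul]
    refine ev_step hz (hP c hc).1 (hP c hc).2.1 hV hne _ fun a ha => ?_
    have hP' := hP _ (hu a ha).prop
    have hl := hz.length_le
    have hh := heads_le (i := 0) hP'.1 (by simp)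
    have hinp : (M.step x c a).inputHead ≤ z.length + 1 := by omega
    have ih' := ih a ha (step_tapes hV a)
    rcases hem : a.emit with _ | e
    · have ho : (M.step x c a).output = c.output := by simp [NTM.step, hem]
      rw [ho] at ih'
      exact Core.ev_goto (d := 0) (q := (.sim a.next none, none)) hh rfl (by simp; omega) ih'
    · have ho : (M.step x c a).output = c.output ++ [e] := by simp [NTM.step, hem]
      have hlen : (M.step x c a).output.length = c.output.length + 1 := by simp [ho]
      -- All outputs below this node extend the current output, which is what `agree_eq_add` needs
      -- for each of them.
      have hsum : ((u a).map (agree r c.output.length)).sum =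
          ((u a).map (agree r (M.step x c a).output.length)).sum +
            Multiset.card (u a) * checkVal r (some e) (M.step x c a).output.length := by
        rw [← smul_eq_mul, ← Multiset.sum_replicate, ← Multiset.map_const', ← Multiset.sum_map_add]
        refine congrArg _ (Multiset.map_congr rfl fun y hy => ?_)
        rw [ho]
        refine agree_eq_add r _ y e ?_
        rw [← ho]
        exact (hu a ha).output_prefix y hy
      have hinc : Routine.Run S (some .inc) (Routine.tapeOf M.Work (binDigits 0 c.output.length)) 0
          (some (Routine.tapeOf M.Work (binDigits 0 (c.output.length + 1)), 0)) := by
        have := Routine.run_inc (G := M.Work) (S := S) (binDigits 0 c.output.length) []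
          (by simpa using hbits _ (hP c hc).2.2)
        simpa [incList_binDigits] using this
      have hcall : ∀ (q : State M a₀ b₀) (m : Multiset (List Empty)),
          (core M a₀ b₀).Ev z S (conf q (M.step x c a).inputHead (M.step x c a).workHead 0
            (fun τ => Function.update (V τ) (c.workHead τ) (some (.inl (a.write τ))))
            (M.step x c a).output.length) m →
          (core M a₀ b₀).Ev z S ((core M a₀ b₀).cfg (q, some (.inc, .inr ()))
            (M.step x c a).inputHead (heads (M.step x c a).workHead 0)
            (tapes (fun τ => Function.update (V τ) (c.workHead τ) (some (.inl (a.write τ))))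
              c.output.length) []) m := by
        intro q m H
        refine Core.ev_call (τ := .inr ()) (h := heads (M.step x c a).workHead 0)
          (U := tapes (fun τ => Function.update (V τ) (c.workHead τ) (some (.inl (a.write τ))))
            c.output.length) hinc hh hinp ?_
        refine Core.ev_congr rfl ?_ ?_ rfl rfl H
        · funext τ
          rcases τ with τ | _ <;> simp [heads]
        · funext τ
          rcases τ with τ | _ <;> simp [tapes, hlen]
      have := Core.ev_choose (X := core M a₀ b₀) (x := z) (S := S) (f := postEmb a.next e)
        (k := .post a.next (some e) none) (inp := (M.step x c a).inputHead)
        (h := heads (M.step x c a).workHead 0)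
        (U := tapes (fun τ => Function.update (V τ) (c.workHead τ) (some (.inl (a.write τ))))
              c.output.length) (out := []) (s := Finset.univ)
        (fun i => bif i then
          (Multiset.card (u a) * checkVal r (some e) (M.step x c a).output.length) • {[]}
          else ((u a).map (agree r (M.step x c a).output.length)).sum • {[]})
        hh hinp rfl Finset.univ_nonempty ?_
      · rw [hsum]
        convert this using 1
        rw [Fintype.sum_bool, add_smul, add_comm]
        rfl
      · rintro (_ | _) -
        · exact hcall _ _ ih'
        · exact hcall _ _ (ev_sim_some hz (fun c hc => ⟨(hP c hc).1, (hP c hc).2.1⟩)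
            (hbits _ hP'.2.2) e (hu a ha) (step_tapes hV a))

theorem ev_all (hab : 0 < a₀ + b₀) (hz : TripleSplit z x r) (hT : T.bits.length ≤ S)
    (hP : ∀ c, P c → (∀ τ, |c.workHead τ| ≤ (S : ℤ)) ∧ c.inputHead ≤ x.length + 1 ∧
      c.output.length ≤ T)
    {ms : Multiset (List α)} (hM : M.Eval x P M.start ms) :
    (core M a₀ b₀).Ev z S (core M a₀ b₀).toNTM.start
      ((a₀ + b₀ * (ms.map (agree r 0)).sum) • {[]}) := by
  have hh : ∀ τ, |heads (M := M) (fun _ => 0) 0 τ| ≤ (S : ℤ) := heads_le (by simp) (by simp)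
  have hu : (Finset.univ : Finset (Fin a₀ ⊕ Fin b₀)).Nonempty := by
    rcases Nat.eq_zero_or_pos a₀ with h | h
    · exact ⟨.inr ⟨0, by omega⟩, Finset.mem_univ _⟩
    · exact ⟨.inl ⟨0, h⟩, Finset.mem_univ _⟩
  have := Core.ev_choose (X := core M a₀ b₀) (x := z) (S := S) (f := pickEmb)
    (k := .init) (inp := 0) (h := heads (fun _ => 0) 0) (U := tapes (fun _ _ => none) 0) (out := [])
    (fun p => match p with
      | .inl _ => {[]}
      | .inr _ => (ms.map (agree r 0)).sum • {[]}) hh (by simp) rfl hu ?_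
  · refine Core.ev_start (Core.ev_congr rfl ?_ ?_ rfl ?_ this)
    · funext c
      rcases c with c | _ <;> rfl
    · funext c i
      rcases c with c | _ <;> simp [tapes, Routine.tapeOf, binDigits_zero]
    · simp [Fintype.sum_sum_type, add_smul, mul_smul]
  · rintro (p | p) -
    · exact Core.ev_goto (d := 0) (q := (.acc, none)) (inp' := 0) hh rfl (by simp)
        (Core.ev_accept hh rfl rfl)
    · exact Core.ev_goto (d := 0) (q := (.sim M.startState none, none)) (inp' := 0) hh rfl (by simp)
        (ev_sim_none hz hT hP hM fun _ _ => rfl)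

end Eval

end OutputSymbol


/-! ### Space bounds -/

theorem exists_eval_le_two_pow (q : Polynomial ℕ) :
    ∃ c : ℕ, ∀ n : ℕ, q.eval n ≤ 2 ^ (c * (Nat.log 2 n + 1)) := by
  induction q using Polynomial.induction_on' with
  | add p q hp hq =>
    obtain ⟨c, hc⟩ := hp
    obtain ⟨d, hd⟩ := hq
    -- The extra 1 absorbs the factor 2 from adding two powers.
    refine ⟨c + d + 1, fun n => ?_⟩
    rw [Polynomial.eval_add]
    have h1 : 2 ^ (c * (Nat.log 2 n + 1)) ≤ 2 ^ ((c + d) * (Nat.log 2 n + 1)) :=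
      Nat.pow_le_pow_right (by norm_num) (Nat.mul_le_mul_right _ (by omega))
    have h2 : 2 ^ (d * (Nat.log 2 n + 1)) ≤ 2 ^ ((c + d) * (Nat.log 2 n + 1)) :=
      Nat.pow_le_pow_right (by norm_num) (Nat.mul_le_mul_right _ (by omega))
    have h3 : 2 ^ ((c + d) * (Nat.log 2 n + 1) + 1) ≤ 2 ^ ((c + d + 1) * (Nat.log 2 n + 1)) :=
      Nat.pow_le_pow_right (by norm_num) (by nlinarith)
    rw [pow_succ] at h3
    have := hc n
    have := hd n
    omega
  | monomial k a =>
    refine ⟨a + k, fun n => ?_⟩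
    rw [Polynomial.eval_monomial]
    have h1 : n ≤ 2 ^ (Nat.log 2 n + 1) := (Nat.lt_pow_succ_log_self (by norm_num) n).le
    have h2 : a ≤ 2 ^ (a * (Nat.log 2 n + 1)) :=
      (Nat.lt_two_pow_self).le.trans
        (Nat.pow_le_pow_right (by norm_num) (Nat.le_mul_of_pos_right _ (by omega)))
    calc a * n ^ k ≤ 2 ^ (a * (Nat.log 2 n + 1)) * (2 ^ (Nat.log 2 n + 1)) ^ k :=
          Nat.mul_le_mul h2 (Nat.pow_le_pow_left h1 k)
      _ = 2 ^ ((a + k) * (Nat.log 2 n + 1)) := by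
          rw [← pow_mul, ← pow_add]
          congr 1
          ring

theorem length_bits_le_of_lt {n m : ℕ} (h : n < 2 ^ m) : n.bits.length ≤ m := by
  rw [Nat.size_eq_bits_len, Nat.size_le]
  exact h

theorem log_add_two_le (n : ℕ) : Nat.log 2 (n + 2) ≤ Nat.log 2 n + 2 := by
  have h := Nat.lt_pow_succ_log_self (b := 2) (by norm_num) n
  refine Nat.lt_succ_iff.1 (Nat.log_lt_of_lt_pow (by omega) ?_)
  have h1 : 1 ≤ 2 ^ Nat.log 2 n := Nat.one_le_two_pow
  rw [Nat.succ_eq_add_one, pow_succ] at h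
  rw [Nat.succ_eq_add_one, pow_succ, pow_succ, pow_succ]
  omega

/-! ### Splitting triples -/

namespace OutputSymbol

variable {α : Type}

theorem exists_split (z : List (TripleAlphabet α)) : ∃ x r, TripleSplit z x r := by
  induction z with
  | nil => exact ⟨[], [], rfl, by simp⟩
  | cons a z ih =>
    rcases a with a | a
    · obtain ⟨x, r, h1, h2⟩ := ih
      exact ⟨a :: x, r, by rw [h1]; rfl, h2⟩
    · exact ⟨[], .inr a :: z, rfl, by simp⟩

theorem TripleSplit.unique {z : List (TripleAlphabet α)} {x x' : List α}
    {r r' : List (TripleAlphabet α)} (h : TripleSplit z x r) (h' : TripleSplit z x' r') :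
    x = x' ∧ r = r' := by
  induction x generalizing z x' with
  | nil =>
    cases x' with
    | nil => exact ⟨rfl, h.1.symm.trans h'.1⟩
    | cons a x' =>
      refine absurd ?_ (h.2 a)
      have := h.1.symm.trans h'.1
      simp only [List.map_nil, List.nil_append] at this
      rw [this]
      rfl
  | cons a x ih =>
    cases x' with
    | nil =>
      refine absurd ?_ (h'.2 a)
      have := h'.1.symm.trans h.1
      simp only [List.map_nil, List.nil_append] at this
      rw [this]
      rfl
    | cons a' x' =>
      have := h.1.symm.trans h'.1
      simp only [List.map_cons, List.cons_append, List.cons.injEq, Sum.inl.injEq] at this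
      obtain ⟨rfl, he⟩ := this
      obtain ⟨rfl, rfl⟩ := ih ⟨rfl, h.2⟩ ⟨he, h'.2⟩
      exact ⟨rfl, rfl⟩

theorem split_encodeTriple (x : List α) (j : ℕ) (d : Option α) :
    TripleSplit (encodeTriple x j d) x (tripleEnd j d) := by
  refine ⟨encodeTriple_eq x j d, fun a => ?_⟩
  unfold tripleEnd
  cases j.bits <;> simp

theorem mem_bitsLanguage_iff {f : List α →. List α} {z : List (TripleAlphabet α)} {x : List α}
    {r : List (TripleAlphabet α)} (h : TripleSplit z x r) :
    z ∈ bitsLanguage f ↔ ∃ y ∈ f x, ∃ j d, 1 ≤ j ∧ r = tripleEnd j d ∧ y[j - 1]? = d := by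
  constructor
  · rintro ⟨x', j, d, rfl, hj, y, hy, hd⟩
    obtain ⟨rfl, rfl⟩ := h.unique (split_encodeTriple x' j d)
    exact ⟨y, hy, j, d, hj, rfl, hd⟩
  · rintro ⟨y, hy, j, d, hj, rfl, hd⟩
    exact ⟨x, j, d, h.1.trans (encodeTriple_eq x j d).symm, hj, y, hy, hd⟩

end OutputSymbol

theorem encodeTriple_inj {α : Type} {x x' : List α} {j j' : ℕ} {d d' : Option α}
    (h : encodeTriple x j d = encodeTriple x' j' d') : x = x' ∧ j = j' ∧ d = d' := by
  have h1 := OutputSymbol.split_encodeTriple x j d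
  rw [h] at h1
  obtain ⟨h2, h3⟩ := h1.unique (OutputSymbol.split_encodeTriple x' j' d')
  exact ⟨h2, OutputSymbol.tripleEnd_inj h3⟩

/-! ### Computing a function symbol by symbol -/

namespace Symbolwise

variable {α : Type}

theorem exists_machine [Fintype α] {N : NTM (TripleAlphabet α) Empty} (hN : N.IsLogspace)
    (t a₀ b₀ : ℕ) (hab : 0 < a₀ + b₀) (q : Polynomial ℕ) :
    ∃ M : NTM α α, M.IsLogspace ∧ ∀ x, ∃ F, q.eval x.length < F ∧
      ∀ (_ : DecidableEq α) y, M.numAcceptWith x y =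
        (loopVal (fun j d => a₀ + b₀ * N.numAccept (encodeTriple x j d) ^ t) F 0 []).count y := by
  classical
  have := Fintype.ofFinite N.WorkTape
  obtain ⟨c₀, hc₀⟩ := exists_eval_le_two_pow (q + 1)
  -- This base makes the clock start at least at `2 ^ ((2 * c₀ + 1) * log (n + 2))`. As `log n + 1 ≤
  -- 2 * log (n + 2)`, this exceeds `q`; counting to `n + 2` keeps the logarithm positive for short
  -- inputs.
  obtain ⟨b, hb⟩ : ∃ b, b + 2 = 2 ^ (2 * c₀ + 1) :=
    ⟨2 ^ (2 * c₀ + 1) - 2, by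
      have : 1 ≤ 2 ^ (2 * c₀) := Nat.one_le_two_pow
      rw [pow_succ]
      omega⟩
  obtain ⟨⟨cN, hcN⟩, -⟩ := id hN
  set c := 2 * c₀ + 1 with hc
  -- In units of `log n + 1`, the terms pay for the clock, the index `j`, and the work heads of `N`
  -- on the triple; the last 1 makes the bound for these heads strict.
  set C := 3 + 3 * c + cN * (3 * c + 3) + 1 with hC
  have key : ∀ x : List α,
      (core N t a₀ b₀ b).Ev x (C * (Nat.log 2 x.length + 1)) (core N t a₀ b₀ b).toNTM.start
        (loopVal (fun j d => a₀ + b₀ * N.numAccept (encodeTriple x j d) ^ t)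
          (digitsVal (binDigits b (x.length + 2))) 0 []) := by
    intro x
    set K := Nat.log 2 x.length + 1 with hK
    have h1 : (x.length + 2).bits.length ≤ 3 * K := by
      have := length_bits_le (x.length + 2)
      have := log_add_two_le x.length
      omega
    have hF : digitsVal (binDigits b (x.length + 2)) < 2 ^ (3 * c * K) := by
      refine (digitsVal_lt _).trans_le ?_
      rw [length_binDigits, hb, ← pow_mul]
      exact Nat.pow_le_pow_right (by norm_num) (by nlinarith)
    have h2 := length_bits_le_of_lt hF
    have hCK : C * K = 3 * K + 3 * c * K + cN * ((3 * c + 3) * K) + K := by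
      rw [hC]
      ring
    refine ev_all hab (by omega) (by omega) fun j d hj hjF => ?_
    obtain ⟨ms, hms⟩ := hN.exists_eval (encodeTriple x j d)
    refine ⟨ms, hms.mono ?_⟩
    rintro _ ⟨w, hw, rfl⟩
    have hj' : j.bits.length ≤ 3 * c * K := (length_bits_mono hjF).trans h2
    refine ⟨fun τ => ?_, ?_⟩
    · refine (hcN _ w hw τ).trans_lt ?_
      have hlog : Nat.log 2 (encodeTriple x j d).length ≤ (3 * c + 2) * K := by
        refine Nat.lt_succ_iff.1 (Nat.log_lt_of_lt_pow (by simp [Virtual.length_encodeTriple]) ?_)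
        rw [Virtual.length_encodeTriple]
        have e1 : x.length < 2 ^ K := Nat.lt_pow_succ_log_self (by norm_num) _
        have e2 : 3 * c * K < 2 ^ (3 * c * K) := Nat.lt_two_pow_self
        have e3 : 2 ^ K ≤ 2 ^ ((3 * c + 2) * K) :=
          Nat.pow_le_pow_right (by norm_num) (by nlinarith)
        have e4 : 2 ^ (3 * c * K) ≤ 2 ^ ((3 * c + 2) * K) :=
          Nat.pow_le_pow_right (by norm_num) (by nlinarith)
        rw [Nat.succ_eq_add_one, pow_succ]
        omega
      have e1 : cN * (Nat.log 2 (encodeTriple x j d).length + 1) ≤ cN * ((3 * c + 3) * K) :=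
        Nat.mul_le_mul_left _ (by nlinarith)
      exact_mod_cast (by omega : cN * (Nat.log 2 (encodeTriple x j d).length + 1) < C * K)
    · have := NTM.inputHead_le (M := N) (x := encodeTriple x j d) w
      rw [Virtual.length_encodeTriple] at this
      omega
  refine ⟨(core N t a₀ b₀ b).toNTM, NTM.isLogspace_of_eval C fun x => ⟨_, key x⟩, fun x =>
    ⟨digitsVal (binDigits b (x.length + 2)), ?_, fun _ y => (key x).numAcceptWith_eq y⟩⟩
  have h1 := hc₀ x.length
  rw [Polynomial.eval_add, Polynomial.eval_one] at h1
  have h2 := pow_log_le_digitsVal b (n := x.length + 2) (by omega)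
  rw [hb, ← pow_mul] at h2
  refine lt_of_lt_of_le (Nat.lt_of_succ_le h1) (le_trans (Nat.pow_le_pow_right (by norm_num) ?_) h2)
  have h3 : Nat.log 2 x.length ≤ Nat.log 2 (x.length + 2) := Nat.log_mono_right (by omega)
  have h4 : 1 ≤ Nat.log 2 (x.length + 2) := Nat.log_pos (by norm_num) (by omega)
  have h5 : Nat.log 2 x.length + 1 ≤ 2 * Nat.log 2 (x.length + 2) := by omega
  calc c₀ * (Nat.log 2 x.length + 1) ≤ c₀ * (2 * Nat.log 2 (x.length + 2)) :=
        Nat.mul_le_mul_left _ h5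
    _ ≤ c * Nat.log 2 (x.length + 2) := by
        rw [hc]
        nlinarith

/-! ### Multiplicities of output words modulo `k` -/

/-- The multiplicity of the word `s` from the position `j` on. -/
def wordVal (ψ : ℕ → Option α → ℕ) : ℕ → List α → ℕ
  | j, [] => ψ (j + 1) none
  | j, c :: s => ψ (j + 1) (some c) * wordVal ψ (j + 1) s

theorem prefix_of_mem_loopVal [Fintype α] {ψ : ℕ → Option α → ℕ} {F j : ℕ} {out y : List α}
    (hy : y ∈ loopVal ψ F j out) : out <+: y := by
  induction F generalizing j out with
  | zero => simp [loopVal] at hy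
  | succ F ih =>
    rw [loopVal, Multiset.mem_sum] at hy
    obtain ⟨d, -, hy⟩ := hy
    have hy' := Multiset.mem_of_mem_nsmul hy
    cases d with
    | none => rw [Multiset.mem_singleton.1 hy']
    | some c => exact (List.prefix_append _ _).trans (ih hy')

/-- Outputs extend the word guessed so far, so only the summand of the right next symbol
contributes. The end symbol also costs one tick of the clock, hence the strict inequality. -/
theorem count_loopVal [Fintype α] [DecidableEq α] (ψ : ℕ → Option α → ℕ) (F j : ℕ)
    (out s : List α) :
    (loopVal ψ F j out).count (out ++ s) = if s.length < F then wordVal ψ j s else 0 := by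
  induction F generalizing j out s with
  | zero => simp [loopVal]
  | succ F ih =>
    rw [loopVal, Multiset.count_sum', Fintype.sum_option]
    simp only [Multiset.count_nsmul]
    cases s with
    | nil =>
      rw [Finset.sum_eq_zero]
      · simp [wordVal]
      · intro c _
        rw [Multiset.count_eq_zero_of_notMem, mul_zero]
        intro h
        have := (prefix_of_mem_loopVal h).length_le
        simp at this
    | cons c s =>
      have h0 : Multiset.count (out ++ c :: s) ({out} : Multiset (List α)) = 0 :=
        Multiset.count_eq_zero_of_notMem (by simp)
      rw [h0, mul_zero, zero_add, Finset.sum_eq_single c]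
      · rw [List.append_cons, ih]
        simp [wordVal]
      · intro c' _ hc'
        rw [Multiset.count_eq_zero_of_notMem, mul_zero]
        intro h
        have := prefix_of_mem_loopVal h
        rw [List.prefix_append_right_inj] at this
        simp [hc'] at this
      · simp

open Classical in
-- A product of indicators is the indicator of the conjunction. The witnesses for the first symbol
-- and for the tail are the same word, as `g` has at most one value; if it has none, the factor of
-- the end symbol is already 0.
theorem wordVal_modEq {k : ℕ} {ψ : ℕ → Option α → ℕ} {g : Part (List α)}
    (h : ∀ j d, ψ (j + 1) d ≡ if ∃ y ∈ g, y[j]? = d then 1 else 0 [MOD k]) (j : ℕ) (s : List α) :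
    wordVal ψ j s ≡ if ∃ y ∈ g, y.drop j = s then 1 else 0 [MOD k] := by
  induction s generalizing j with
  | nil =>
    rw [wordVal]
    refine (h j none).trans ?_
    simp only [List.getElem?_eq_none_iff, List.drop_eq_nil_iff]
    rfl
  | cons c s ih =>
    rw [wordVal]
    refine ((h j (some c)).mul (ih (j + 1))).trans ?_
    have : (∃ y ∈ g, y.drop j = c :: s) ↔
        (∃ y ∈ g, y[j]? = some c) ∧ ∃ y ∈ g, y.drop (j + 1) = s := by
      constructor
      · rintro ⟨y, hy, hd⟩
        refine ⟨⟨y, hy, ?_⟩, y, hy, ?_⟩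
        · rw [← List.head?_drop, hd]
          rfl
        · rw [← List.tail_drop, hd]
          rfl
      · rintro ⟨⟨y, hy, h1⟩, y', hy', h2⟩
        obtain rfl := Part.mem_unique hy hy'
        refine ⟨y, hy, ?_⟩
        rw [← List.head?_drop] at h1
        rw [← List.tail_drop] at h2
        rw [← h2, List.cons_head?_tail h1]
    by_cases h1 : ∃ y ∈ g, y[j]? = some c <;> by_cases h2 : ∃ y ∈ g, y.drop (j + 1) = s
    · rw [if_pos h1, if_pos h2, if_pos (this.2 ⟨h1, h2⟩)]
    · rw [if_pos h1, if_neg h2, if_neg fun h => h2 (this.1 h).2]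
    · rw [if_neg h1, if_pos h2, if_neg fun h => h1 (this.1 h).1]
    · rw [if_neg h1, if_neg h2, if_neg fun h => h2 (this.1 h).2]

open Classical in
/-- A function is computed by a machine of the class `FUL` if its symbols can be verified by
counting. -/
theorem mem_FUL [Finite α] {k t a₀ b₀ : ℕ} (hab : 0 < a₀ + b₀) {f : List α →. List α}
    (hf : PolyLength f) {φ : List (TripleAlphabet α) → ℕ} (hφ : φ ∈ NumL (TripleAlphabet α))
    (h : ∀ z, a₀ + b₀ * φ z ^ t ≡ if z ∈ bitsLanguage f then 1 else 0 [MOD k]) :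
    f ∈ FUL α k := by
  have := Fintype.ofFinite α
  obtain ⟨N, hN, hφN⟩ := hφ
  obtain ⟨q, hq⟩ := hf
  obtain ⟨M, hM, hx⟩ := exists_machine hN t a₀ b₀ hab q
  refine ⟨M, hM, fun x y => ?_⟩
  obtain ⟨F, hF, hcount⟩ := hx x
  have hψ : ∀ j d, a₀ + b₀ * N.numAccept (encodeTriple x (j + 1) d) ^ t ≡
      if ∃ y ∈ f x, y[j]? = d then 1 else 0 [MOD k] := by
    intro j d
    rw [← hφN]
    convert h (encodeTriple x (j + 1) d) using 2
    refine ⟨fun ⟨y, hy, hd⟩ => ⟨x, j + 1, d, rfl, by omega, y, hy, hd⟩, ?_⟩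
    rintro ⟨x', j', d', he, hj, y, hy, hd⟩
    obtain ⟨rfl, rfl, rfl⟩ := encodeTriple_inj he
    exact ⟨y, hy, hd⟩
  have hc := count_loopVal (fun j d => a₀ + b₀ * N.numAccept (encodeTriple x j d) ^ t) F 0 [] y
  rw [List.nil_append, ← hcount _ y] at hc
  have hw := wordVal_modEq
    (ψ := fun j d => a₀ + b₀ * N.numAccept (encodeTriple x j d) ^ t) hψ 0 y
  simp only [List.drop_zero, exists_eq_right] at hw
  constructor
  · intro hy
    -- The clock is long enough for `f x`; words too long for it have multiplicity zero, as required
    -- below.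
    rw [hc, if_pos ((hq x y hy).trans_lt hF)]
    simpa [hy] using hw
  · intro hy
    rw [hc]
    split_ifs
    · simpa [hy] using hw
    · rfl

end Symbolwise

/-! ### Deciding the symbols of a function -/

namespace OutputSymbol

variable {α : Type}

/-- The counter never exceeds the running time of `M`, so it has logarithmic length. -/
theorem exists_machine [Finite α] {M : NTM α α} (hM : M.IsLogspace) {a₀ b₀ : ℕ}
    (hab : 0 < a₀ + b₀) :
    ∃ N : NTM (TripleAlphabet α) Empty, N.IsLogspace ∧ ∀ z x r, TripleSplit z x r →
      ∃ ms : Multiset (List α), (∀ (_ : DecidableEq α) y, M.numAcceptWith x y = ms.count y) ∧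
        N.numAccept z = a₀ + b₀ * (ms.map (agree r 0)).sum := by
  classical
  have := Fintype.ofFinite α
  obtain ⟨⟨cM, hcM⟩, q, hq⟩ := id hM
  obtain ⟨c₁, hc₁⟩ := exists_eval_le_two_pow q
  have key : ∀ z x r, TripleSplit z x r → ∃ ms : Multiset (List α),
      (∀ (_ : DecidableEq α) y, M.numAcceptWith x y = ms.count y) ∧
      (core M a₀ b₀).Ev z ((cM + c₁ + 1) * (Nat.log 2 z.length + 1)) (core M a₀ b₀).toNTM.start
        ((a₀ + b₀ * (ms.map (agree r 0)).sum) • {[]}) := by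
    intro z x r hz
    obtain ⟨ms, hms⟩ := hM.exists_eval x
    refine ⟨ms, fun _ y => hms.numAcceptWith_eq y, ?_⟩
    have hlog : Nat.log 2 x.length ≤ Nat.log 2 z.length := Nat.log_mono_right hz.length_le
    set K := Nat.log 2 z.length + 1 with hK
    have hCK : (cM + c₁ + 1) * K = cM * K + c₁ * K + K := by ring
    have h1 : cM * (Nat.log 2 x.length + 1) ≤ cM * K := Nat.mul_le_mul_left _ (by omega)
    have h2 : c₁ * (Nat.log 2 x.length + 1) ≤ c₁ * K := Nat.mul_le_mul_left _ (by omega)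
    refine ev_all hab hz (T := q.eval x.length) (length_bits_le_of_lt ?_) ?_ hms
    · refine (hc₁ _).trans_lt (Nat.pow_lt_pow_right (by norm_num) ?_)
      omega
    · rintro _ ⟨w, hw, rfl⟩
      refine ⟨fun τ => (hcM x w hw τ).trans ?_, NTM.inputHead_le w,
        (NTM.output_length_le w).trans (hq x w hw)⟩
      exact_mod_cast (by omega : cM * (Nat.log 2 x.length + 1) ≤ (cM + c₁ + 1) * K)
  refine ⟨(core M a₀ b₀).toNTM, NTM.isLogspace_of_eval (cM + c₁ + 1) fun z => ?_,
    fun z x r hz => ?_⟩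
  · obtain ⟨x, r, hz⟩ := exists_split z
    obtain ⟨ms, -, h⟩ := key z x r hz
    exact ⟨_, h⟩
  · obtain ⟨ms, h1, h2⟩ := key z x r hz
    refine ⟨ms, h1, ?_⟩
    rw [h2.numAccept_eq]
    simp

open Classical in
theorem agree_zero (r : List (TripleAlphabet α)) (y : List α) :
    agree r 0 y = if ∃ j d, 1 ≤ j ∧ r = tripleEnd j d ∧ y[j - 1]? = d then 1 else 0 := by
  unfold agree
  rcases h : parse r with _ | ⟨j, d⟩
  · rw [if_neg]
    rintro ⟨j, d, h1, h2, -⟩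
    rw [parse_eq_some.2 ⟨h1, h2⟩] at h
    simp at h
  · obtain ⟨h1, rfl⟩ := parse_eq_some.1 h
    have hd : (∃ j' d', 1 ≤ j' ∧ tripleEnd j d = tripleEnd j' d' ∧ y[j' - 1]? = d') ↔
        y[j - 1]? = d := by
      constructor
      · rintro ⟨j', d', -, he, h⟩
        obtain ⟨rfl, rfl⟩ := tripleEnd_inj he
        exact h
      · exact fun h => ⟨j, d, h1, rfl, h⟩
    cases d with
    | none =>
      have h2 : y.length < j ↔ y[j - 1]? = none := by
        rw [List.getElem?_eq_none_iff]
        omega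
      by_cases h3 : y[j - 1]? = none
      · rw [if_pos (hd.2 h3)]
        exact if_pos (h2.2 h3)
      · rw [if_neg (mt hd.1 h3)]
        exact if_neg (mt h2.1 h3)
    | some c =>
      by_cases h3 : y[j - 1]? = some c
      · rw [if_pos (hd.2 h3)]
        exact if_pos ⟨h1, h3⟩
      · rw [if_neg (mt hd.1 h3)]
        exact if_neg fun h => h3 h.2

open Classical in
-- Modulo `k` the multiset of outputs is the single word `f x`, or empty outside the domain.
-- Spurious outputs occur in multiples of `k` and vanish from the sum.
theorem sum_agree_modEq {k : ℕ} (hk : 2 ≤ k) {f : List α →. List α}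
    {z : List (TripleAlphabet α)} {x : List α} {r : List (TripleAlphabet α)}
    (hz : TripleSplit z x r) {ms : Multiset (List α)}
    (h : ∀ y, (y ∈ f x → ms.count y ≡ 1 [MOD k]) ∧ (y ∉ f x → ms.count y ≡ 0 [MOD k])) :
    (ms.map (agree r 0)).sum ≡ if z ∈ bitsLanguage f then 1 else 0 [MOD k] := by
  have h1 : (ms.map (agree r 0)).sum ≡
      ∑ y ∈ ms.toFinset, (if y ∈ f x then 1 else 0) * agree r 0 y [MOD k] := by
    rw [Finset.sum_multiset_map_count]
    simp only [smul_eq_mul]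
    refine Nat.ModEq.sum fun y _ => Nat.ModEq.mul_right _ ?_
    split_ifs with hy
    · exact (h y).1 hy
    · exact (h y).2 hy
  refine h1.trans ?_
  rw [mem_bitsLanguage_iff hz]
  by_cases hx : ∃ y₀, y₀ ∈ f x
  · obtain ⟨y₀, hy₀⟩ := hx
    have hmem : y₀ ∈ ms.toFinset := by
      rw [Multiset.mem_toFinset]
      by_contra hn
      have := (h y₀).1 hy₀
      rw [Multiset.count_eq_zero_of_notMem hn, Nat.ModEq, Nat.zero_mod,
        Nat.mod_eq_of_lt (by omega)] at this
      omega
    rw [Finset.sum_eq_single_of_mem y₀ hmem, if_pos hy₀, one_mul, agree_zero]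
    · by_cases hj : ∃ j d, 1 ≤ j ∧ r = tripleEnd j d ∧ y₀[j - 1]? = d
      · rw [if_pos hj, if_pos ⟨y₀, hy₀, hj⟩]
      · rw [if_neg hj, if_neg]
        rintro ⟨y, hy, hj'⟩
        rw [Part.mem_unique hy hy₀] at hj'
        exact hj hj'
    · intro y _ hy
      rw [if_neg (fun hy' => hy (Part.mem_unique hy' hy₀)), zero_mul]
  · rw [if_neg fun ⟨y, hy, _⟩ => hx ⟨y, hy⟩, Finset.sum_eq_zero]
    intro y _
    rw [if_neg fun hy => hx ⟨y, hy⟩, zero_mul]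

/-- A count congruent to 1 is nonzero as `k ≥ 2`, so some branch really writes `f x`, one symbol per
step at most. -/
theorem polyLength_of_mem_FUL {k : ℕ} (hk : 2 ≤ k) {f : List α →. List α} (hf : f ∈ FUL α k) :
    PolyLength f := by
  obtain ⟨M, ⟨-, q, hq⟩, hM⟩ := hf
  refine ⟨q, fun x y hy => ?_⟩
  have h1 := (hM x y).1 hy
  have h2 : M.numAcceptWith x y ≠ 0 := by
    intro h
    rw [h, Nat.ModEq, Nat.zero_mod, Nat.mod_eq_of_lt (by omega)] at h1
    omega
  obtain ⟨w, ⟨hw, -⟩, rfl⟩ := Set.nonempty_of_ncard_ne_zero h2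
  exact (NTM.output_length_le w).trans (hq x w hw)

open Classical in
theorem exists_numL [Finite α] {k a₀ b₀ : ℕ} (hk : 2 ≤ k) (hab : 0 < a₀ + b₀)
    {f : List α →. List α} (hf : f ∈ FUL α k) :
    ∃ φ ∈ NumL (TripleAlphabet α), ∀ z, ∃ n, φ z = a₀ + b₀ * n ∧
      n ≡ if z ∈ bitsLanguage f then 1 else 0 [MOD k] := by
  obtain ⟨M, hM, hMf⟩ := hf
  obtain ⟨N, hN, h⟩ := exists_machine hM hab
  refine ⟨N.numAccept, ⟨N, hN, fun _ => rfl⟩, fun z => ?_⟩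
  obtain ⟨x, r, hz⟩ := exists_split z
  obtain ⟨ms, h1, h2⟩ := h z x r hz
  refine ⟨_, h2, sum_agree_modEq hk hz fun y => ?_⟩
  have := hMf x y
  rwa [h1 _ y] at this

end OutputSymbol

/-! ### The classes -/

section Classes

variable {α : Type} [Finite α] {p e : ℕ}

theorem FUL_subset_FModL (hp : p.Prime) (he : 1 ≤ e) : FUL α (p ^ e) ⊆ FModL α p := by
  classical
  intro f hf
  have hk : 2 ≤ p ^ e := hp.two_le.trans (Nat.le_self_pow (by omega) p)
  refine ⟨OutputSymbol.polyLength_of_mem_FUL hk hf, ?_⟩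
  obtain ⟨φ, hφ, h⟩ := OutputSymbol.exists_numL (a₀ := 0) (b₀ := 1) hk (by norm_num) hf
  refine ⟨φ, hφ, fun z => ?_⟩
  obtain ⟨n, h1, h2⟩ := h z
  have h3 := h2.of_dvd (dvd_pow_self p (by omega : e ≠ 0))
  rw [h1, zero_add, one_mul]
  split_ifs at h3 with hz
  · refine iff_of_true hz fun h0 => ?_
    have := h3.symm.trans h0
    rw [Nat.ModEq, Nat.zero_mod, Nat.mod_eq_of_lt hp.one_lt] at this
    omega
  · exact iff_of_false hz fun h0 => h0 h3

theorem FUL_subset_FCoModL (hp : p.Prime) (he : 1 ≤ e) : FUL α (p ^ e) ⊆ FCoModL α p := by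
  classical
  intro f hf
  have hk : 2 ≤ p ^ e := hp.two_le.trans (Nat.le_self_pow (by omega) p)
  refine ⟨OutputSymbol.polyLength_of_mem_FUL hk hf, ?_⟩
  -- Modulo `p` the value `1 + (p - 1) * n` is `1 - n`, which exchanges the residues 0 and 1.
  obtain ⟨φ, hφ, h⟩ := OutputSymbol.exists_numL (a₀ := 1) (b₀ := p - 1) hk (by omega) hf
  refine ⟨φ, hφ, fun z => ?_⟩
  obtain ⟨n, h1, h2⟩ := h z
  have h3 := ((h2.of_dvd (dvd_pow_self p (by omega : e ≠ 0))).mul_left (p - 1)).add_left 1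
  rw [h1]
  have hp1 := hp.one_lt
  split_ifs at h3 with hz
  · refine iff_of_true hz (h3.trans ?_)
    rw [mul_one, Nat.add_sub_cancel' hp1.le, Nat.ModEq, Nat.mod_self, Nat.zero_mod]
  · refine iff_of_false hz fun h0 => ?_
    have := h3.symm.trans h0
    rw [Nat.ModEq, Nat.zero_mod, mul_zero, add_zero, Nat.mod_eq_of_lt hp1] at this
    omega

theorem pow_totient_modEq (hp : p.Prime) (he : 1 ≤ e) (n : ℕ) [Decidable (n ≡ 0 [MOD p])] :
    n ^ (p ^ e).totient ≡ if n ≡ 0 [MOD p] then 0 else 1 [MOD p ^ e] := by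
  split_ifs with h
  · rw [Nat.modEq_zero_iff_dvd] at h ⊢
    -- If `p` divides `n`, the power is divisible by `p ^ t`; this suffices since `t = p ^ (e - 1) *
    -- (p - 1)` and `e - 1 < p ^ (e - 1)`.
    have h1 : e ≤ (p ^ e).totient := by
      rw [Nat.totient_prime_pow hp (by omega)]
      have : e - 1 < p ^ (e - 1) := Nat.lt_pow_self hp.one_lt
      exact (by omega : e ≤ p ^ (e - 1)).trans
        (Nat.le_mul_of_pos_right _ (by have := hp.one_lt; omega))
    exact (pow_dvd_pow p h1).trans (pow_dvd_pow_of_dvd h _)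
  · rw [Nat.modEq_zero_iff_dvd] at h
    exact Nat.ModEq.pow_totient (((hp.coprime_iff_not_dvd.2 h).symm).pow_right e)

theorem FModL_subset_FUL (hp : p.Prime) (he : 1 ≤ e) : FModL α p ⊆ FUL α (p ^ e) := by
  classical
  rintro f ⟨hf, φ, hφ, h⟩
  refine Symbolwise.mem_FUL (t := (p ^ e).totient) (a₀ := 0) (b₀ := 1) (by norm_num) hf hφ
    fun z => ?_
  rw [zero_add, one_mul]
  refine (pow_totient_modEq hp he (φ z)).trans ?_
  by_cases hz : φ z ≡ 0 [MOD p]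
  · rw [if_pos hz, if_neg fun hz' => (h z).1 hz' hz]
  · rw [if_neg hz, if_pos ((h z).2 hz)]

theorem FCoModL_subset_FUL (hp : p.Prime) (he : 1 ≤ e) : FCoModL α p ⊆ FUL α (p ^ e) := by
  classical
  rintro f ⟨hf, φ, hφ, h⟩
  -- Here `p ^ e - 1` acts as `-1`, so the weight of a symbol is `1 - φ ^ t` modulo `p ^ e`.
  refine Symbolwise.mem_FUL (t := (p ^ e).totient) (a₀ := 1) (b₀ := p ^ e - 1) (by omega) hf hφ
    fun z => ?_
  refine (((pow_totient_modEq hp he (φ z)).mul_left _).add_left 1).trans ?_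
  by_cases hz : φ z ≡ 0 [MOD p]
  · rw [if_pos hz, if_pos ((h z).2 hz), mul_zero, add_zero]
  · rw [if_neg hz, if_neg fun hz' => hz ((h z).1 hz'), mul_one,
      Nat.add_sub_cancel' (Nat.one_le_pow _ _ hp.pos), Nat.ModEq, Nat.mod_self, Nat.zero_mod]

end Classes

theorem mainTheorem6 (α : Type) [Finite α] (p e : ℕ) (hp : p.Prime) (he : 1 ≤ e) :
    FUL α (p ^ e) = FModL α p ∧ FModL α p = FCoModL α p ∧
    ∀ f : List α →. List α, PolyLength f → bitsLanguage f ∈ ModL (TripleAlphabet α) p →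
      ∃ M : NTM α α, M.IsLogspace ∧ ∀ x y,
        (y ∈ f x → M.numAcceptWith x y ≡ 1 [MOD p ^ e]) ∧
        (y ∉ f x → M.numAcceptWith x y ≡ 0 [MOD p ^ e]) := by
  have h1 : FUL α (p ^ e) = FModL α p :=
    (FUL_subset_FModL hp he).antisymm (FModL_subset_FUL hp he)
  have h2 : FUL α (p ^ e) = FCoModL α p :=
    (FUL_subset_FCoModL hp he).antisymm (FCoModL_subset_FUL hp he)
  exact ⟨h1, h1.symm.trans h2, fun f hf hb => FModL_subset_FUL hp he ⟨hf, hb⟩⟩
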